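/- Work with $\mathbb Z/2$-graded vector spaces over a field $\mathbf k$ of characteristic zero. Operads have operations of arity $n\ge 1$ only. Let $\mathcal O$ be an admissible dg operad, i.e. a unital dg operad such that $\mathcal O(1)=\mathbf k\cdot\mathbf 1$ is one-dimensional and every $\mathcal O(n)$ is finite-dimensional. Let $V$ be a dg vector space, $\mathcal E(V)$, $\mathcal E(V)(n)=\operatorname{Hom}(V^{\otimes n},V)$, its endomorphism operad, and $f:\mathcal O\to\mathcal E(V)$ a unital map of dg operads (an $\mathcal O$-algebra structure on $V$). Let $\mathsf{BV}\mathcal O$ be the unital dg operad freely generated over $\mathcal O$ by an odd operation $s$ and an even operation $t$ of arity $1$ subject to $s^2=0$, $t^2=t$, $st=ts=0$, with differential extending that of $\mathcal O$ and $d(s)=\mathbf 1-t$, $d(t)=0$. Let $i:\mathsf{bv}\mathcal O\hookrightarrow\mathsf{BV}\mathcal O$ be its truncation by the idempotent $t$: $\mathsf{bv}\mathcal O(n)$ consists of the $x\in\mathsf{BV}\mathcal O(n)$ with $t\circ_1x=x$ and $x\circ_jt=x$ for $1\le j\le n$. It is closed under compositions, permutations and the differential, and its operad unit is $t$. A Hodge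 decomposition of $V$ is a pair of linear operators on $V$, $S$ odd and $T$ even, with $S^2=0$, $T^2=T$, $dT=Td$, $ST=TS=0$ and $dS+Sd=\operatorname{id}-T$. Let $(S_1,T_1)$ and $(S_2,T_2)$ be two Hodge decompositions of $V$, and let $h_1,h_2:\mathsf{BV}\mathcal O\to\mathcal E(V)$ be the unital maps of dg operads which they determine, i.e. $h_j$ equals $f$ on $\mathcal O$, $h_j(s)=S_j$ and $h_j(t)=T_j$. For $j=1,2$, the unital $\mathsf{bv}\mathcal O$-algebra structure on $V$ corresponding to $h_j\circ i$ is the map of dg operads $g_j:\mathsf{bv}\mathcal O\to\mathcal E(V)$ which agrees with $h_j\circ i$ in all arities $n\ge2$ and sends the unit $t$ of $\mathsf{bv}\mathcal O$ to $\operatorname{id}_V$. Then $g_1$ and $g_2$ exist and are Sullivan homotopic: there is a unital map of dg operads $F:\mathsf{bv}\mathcal O\to\mathcal E(V)\otimes\mathbf k[z,dz]$ (where $z$ is even, $d(z)=dz$) such that $(\operatorname{id}\otimes\operatorname{ev}_0)\circ F=g_1$ and $(\operatorname{id}\otimes\operatorname{ev}_1)\circ F=g_2$, where $\operatorname{ev}_c$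 is the evaluation $z\mapsto c$, $dz\mapsto0$. In other words, the $\mathsf{bv}\mathcal O$-algebra structures on $V$ given by the two Hodge decompositions are homotopy equivalent. -/

import Mathlib

open scoped TensorProduct

universe u v w

/-! Everything is `ℤ/2`-graded over a field `k`; parities are elements of `ZMod 2`. -/

/-- The Koszul sign `(-1)^(a b)`. -/
def ksign (k : Type u) [Field k] (a b : ZMod 2) : k := (-1) ^ (a.val * b.val)

section Leaves

variable {m n l : ℕ}

/-- When a tree with `n + 1` leaves is grafted onto leaf `i` of a tree with `m + 1` leaves, its leaf
`q` becomes leaf `i + q` of the result, which has `m + n + 1` leaves. Leaves are counted from 0. -/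
def leafIn (i : Fin (m + 1)) (h : m + n = l) (q : Fin (n + 1)) : Fin (l + 1) :=
  ⟨i.val + q.val, by omega⟩

/-- In the same grafting, a leaf `p ≠ i` of the tree with `m + 1` leaves becomes leaf `p` of the
result when `p < i`, and leaf `p + n` when `p > i`. (The value at `p = i` is never used.) -/
def leafOut (i : Fin (m + 1)) (h : m + n = l) (p : Fin (m + 1)) : Fin (l + 1) :=
  ⟨if p.val ≤ i.val then p.val else p.val + n, by split <;> omega⟩

end Leaves

/-- The operations (without the laws) of a unital dg operad: `Op n a` is the space of operations
with `n + 1` inputs and of parity `a`, so that all arities `≥ 1` occur.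
Arities and parities of results are given up to a proof of equality: for `h : m + n = l` and
`hg : a + b = c`, `comp i h hg x y` is the partial composition `x ∘_i y`. -/
structure DGOperadData (k : Type u) [Field k] where
  Op : ℕ → ZMod 2 → Type v
  [addCommGroup : ∀ n a, AddCommGroup (Op n a)]
  [module : ∀ n a, Module k (Op n a)]
  one : Op 0 0
  comp : ∀ {m n l : ℕ} {a b c : ZMod 2} (_ : Fin (m + 1)) (_ : m + n = l) (_ : a + b = c),
    Op m a →ₗ[k] Op n b →ₗ[k] Op l c
  act : ∀ {n : ℕ} {a : ZMod 2} (_ : Equiv.Perm (Fin (n + 1))), Op n a →ₗ[k] Op n a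
  d : ∀ {n : ℕ} {a b : ZMod 2} (_ : a + 1 = b), Op n a →ₗ[k] Op n b

attribute [instance] DGOperadData.addCommGroup DGOperadData.module

/-- The laws of a unital dg operad. The permutation `σ` acts by giving to input `j` the new
number `σ j`. -/
structure DGOperadData.IsDGOperad {k : Type u} [Field k] (P : DGOperadData.{u, v} k) : Prop where
  one_comp : ∀ {n : ℕ} {a : ZMod 2} (x : P.Op n a),
    P.comp 0 (Nat.zero_add n) (zero_add a) P.one x = x
  comp_one : ∀ {n : ℕ} {a : ZMod 2} (i : Fin (n + 1)) (x : P.Op n a),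
    P.comp i (Nat.add_zero n) (add_zero a) x P.one = x
  /-- `(x ∘_i y) ∘_{i+j} z = x ∘_i (y ∘_j z)` -/
  assoc_seq : ∀ {m n p mn np l : ℕ} {a b c ab bc e : ZMod 2}
    (i : Fin (m + 1)) (j : Fin (n + 1)) (h₁ : m + n = mn) (h₂ : mn + p = l)
    (h₃ : n + p = np) (h₄ : m + np = l) (g₁ : a + b = ab) (g₂ : ab + c = e)
    (g₃ : b + c = bc) (g₄ : a + bc = e) (x : P.Op m a) (y : P.Op n b) (z : P.Op p c),
    P.comp (leafIn i h₁ j) h₂ g₂ (P.comp i h₁ g₁ x y) z =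
      P.comp i h₄ g₄ x (P.comp j h₃ g₃ y z)
  /-- `(x ∘_i y) ∘_{j+n} z = (-1)^(|y||z|) (x ∘_j z) ∘_i y` for `i < j`, `n + 1` the arity of `y` -/
  assoc_par : ∀ {m n p mn mp l : ℕ} {a b c ab ac e : ZMod 2}
    (i j : Fin (m + 1)) (_ : i < j) (h₁ : m + n = mn) (h₂ : mn + p = l)
    (h₃ : m + p = mp) (h₄ : mp + n = l) (g₁ : a + b = ab) (g₂ : ab + c = e)
    (g₃ : a + c = ac) (g₄ : ac + b = e) (x : P.Op m a) (y : P.Op n b) (z : P.Op p c),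
    P.comp (leafOut i h₁ j) h₂ g₂ (P.comp i h₁ g₁ x y) z =
      ksign k b c • P.comp (leafOut j h₃ i) h₄ g₄ (P.comp j h₃ g₃ x z) y
  act_one : ∀ {n : ℕ} {a : ZMod 2} (x : P.Op n a), P.act 1 x = x
  act_mul : ∀ {n : ℕ} {a : ZMod 2} (σ τ : Equiv.Perm (Fin (n + 1))) (x : P.Op n a),
    P.act (σ * τ) x = P.act σ (P.act τ x)
  /-- `ρ` is the permutation of the leaves of `x ∘_i y` induced by `σ` and `τ`. -/
  act_comp : ∀ {m n l : ℕ} {a b c : ZMod 2} (i : Fin (m + 1)) (h : m + n = l) (hg : a + b = c)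
    (σ : Equiv.Perm (Fin (m + 1))) (τ : Equiv.Perm (Fin (n + 1)))
    (ρ : Equiv.Perm (Fin (l + 1)))
    (_ : ∀ q, ρ (leafIn i h q) = leafIn (σ i) h (τ q))
    (_ : ∀ p, p ≠ i → ρ (leafOut i h p) = leafOut (σ i) h (σ p))
    (x : P.Op m a) (y : P.Op n b),
    P.comp (σ i) h hg (P.act σ x) (P.act τ y) = P.act ρ (P.comp i h hg x y)
  d_d : ∀ {n : ℕ} {a b c : ZMod 2} (h₁ : a + 1 = b) (h₂ : b + 1 = c) (x : P.Op n a),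
    P.d h₂ (P.d h₁ x) = 0
  d_one : ∀ {b : ZMod 2} (h : 0 + 1 = b), P.d h P.one = 0
  d_act : ∀ {n : ℕ} {a b : ZMod 2} (h : a + 1 = b) (σ : Equiv.Perm (Fin (n + 1)))
    (x : P.Op n a), P.d h (P.act σ x) = P.act σ (P.d h x)
  d_comp : ∀ {m n l : ℕ} {a b c a' b' c' : ZMod 2} (i : Fin (m + 1)) (h : m + n = l)
    (hg : a + b = c) (ha : a + 1 = a') (hb : b + 1 = b') (hc : c + 1 = c')
    (g₁ : a' + b = c') (g₂ : a + b' = c') (x : P.Op m a) (y : P.Op n b),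
    P.d hc (P.comp i h hg x y) =
      P.comp i h g₁ (P.d ha x) y + ksign k 1 a • P.comp i h g₂ x (P.d hb y)

/-- A unital dg operad. -/
structure DGOperad (k : Type u) [Field k] extends DGOperadData.{u, v} k where
  laws : toDGOperadData.IsDGOperad

/-- An operad is admissible if `O(1)` is the line spanned by the unit and every `O(n)` is
finite-dimensional. -/
structure DGOperad.IsAdmissible {k : Type u} [Field k] (O : DGOperad.{u, v} k) : Prop where
  one_ne_zero : O.one ≠ 0
  arity_one_even : ∀ x : O.Op 0 0, ∃ c : k, x = c • O.one
  arity_one_odd : ∀ x : O.Op 0 1, x = 0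
  finite : ∀ n a, Module.Finite k (O.Op n a)

/-- Maps of dg operads. Compatibility with the units is the separate property `IsUnital`. -/
structure DGOperadHom {k : Type u} [Field k] (P : DGOperadData.{u, v} k)
    (Q : DGOperadData.{u, w} k) where
  app : ∀ {n : ℕ} {a : ZMod 2}, P.Op n a →ₗ[k] Q.Op n a
  map_comp : ∀ {m n l : ℕ} {a b c : ZMod 2} (i : Fin (m + 1)) (h : m + n = l) (hg : a + b = c)
    (x : P.Op m a) (y : P.Op n b), app (P.comp i h hg x y) = Q.comp i h hg (app x) (app y)
  map_act : ∀ {n : ℕ} {a : ZMod 2} (σ : Equiv.Perm (Fin (n + 1))) (x : P.Op n a),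
    app (P.act σ x) = Q.act σ (app x)
  map_d : ∀ {n : ℕ} {a b : ZMod 2} (h : a + 1 = b) (x : P.Op n a),
    app (P.d h x) = Q.d h (app x)

/-- The map sends the unit to the unit. -/
def DGOperadHom.IsUnital {k : Type u} [Field k] {P : DGOperadData.{u, v} k}
    {Q : DGOperadData.{u, w} k} (f : DGOperadHom P Q) : Prop :=
  f.app P.one = Q.one

/-! ### The endomorphism operad of a dg vector space -/

/-- A dg vector space: `V = V₀ ⊕ V₁` with an odd differential. -/
structure DGSpace (k : Type u) [Field k] where
  carrier : Type v
  [addCommGroup : AddCommGroup carrier]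
  [module : Module k carrier]
  deg : ZMod 2 → Submodule k carrier
  [decomposition : DirectSum.Decomposition deg]
  d : carrier →ₗ[k] carrier
  d_mem : ∀ (a : ZMod 2) (x : carrier), x ∈ deg a → d x ∈ deg (a + 1)
  d_d : ∀ x, d (d x) = 0

attribute [instance] DGSpace.addCommGroup DGSpace.module DGSpace.decomposition

namespace DGSpace

variable {k : Type u} [Field k] (V : DGSpace.{u, v} k)

/-- The projection onto the summand of parity `a`. -/
noncomputable def proj (a : ZMod 2) : V.carrier →ₗ[k] V.carrier :=
  (V.deg a).subtype ∘ₗ DirectSum.component k (ZMod 2) (fun i => V.deg i) a ∘ₗ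
    (DirectSum.decomposeLinearEquiv V.deg).toLinearMap

/-- `x ↦ (-1)^(b |x|) x`, the sign picked up when something of parity `b` moves past `x`. -/
noncomputable def twist (b : ZMod 2) : V.carrier →ₗ[k] V.carrier :=
  ∑ a : ZMod 2, ksign k b a • V.proj a

/-- The `k`-multilinear maps `V × ⋯ × V → V` with `n + 1` arguments, i.e. `Hom(V^{⊗(n+1)}, V)`. -/
abbrev Multi (n : ℕ) := MultilinearMap k (fun _ : Fin (n + 1) => V.carrier) V.carrier

/-- The multilinear maps of parity `g`. -/
def endOp (n : ℕ) (g : ZMod 2) : Submodule k (V.Multi n) where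
  carrier := {f | ∀ (a : Fin (n + 1) → ZMod 2) (x : Fin (n + 1) → V.carrier),
    (∀ j, x j ∈ V.deg (a j)) → f x ∈ V.deg (g + ∑ j, a j)}
  zero_mem' := fun _ _ _ => Submodule.zero_mem _
  add_mem' := fun hf hg a x hx => Submodule.add_mem _ (hf a x hx) (hg a x hx)
  smul_mem' := fun c _ hf a x hx => Submodule.smul_mem _ c (hf a x hx)

end DGSpace

section Leaves

variable {m n l : ℕ} (i : Fin (m + 1)) (h : m + n = l)

theorem leafIn_injective : Function.Injective (leafIn (n := n) i h) := by
  intro p q hpq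
  simp only [leafIn, Fin.mk.injEq] at hpq
  exact Fin.ext (by omega)

theorem leafOut_injective : Function.Injective (leafOut i h) := by
  intro p q hpq
  simp only [leafOut, Fin.mk.injEq] at hpq
  apply Fin.ext
  split at hpq <;> split at hpq <;> omega

theorem leafIn_ne_leafOut (q : Fin (n + 1)) (p : Fin (m + 1)) (hp : p ≠ i) :
    leafIn i h q ≠ leafOut i h p := by
  intro hpq
  have hp' : p.val ≠ i.val := fun e => hp (Fin.ext e)
  simp only [leafIn, leafOut, Fin.mk.injEq] at hpq
  split at hpq <;> omega

/-- Every leaf of a grafted tree comes from exactly one of the two trees. -/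
theorem leaf_cases (j : Fin (l + 1)) :
    (∃ q, j = leafIn (n := n) i h q) ∨ ∃ p, p ≠ i ∧ j = leafOut i h p := by
  have hi := i.isLt
  have hj := j.isLt
  rcases lt_or_ge j.val i.val with h1 | h1
  · refine Or.inr ⟨⟨j.val, by omega⟩, fun e => ?_, ?_⟩
    · rw [← e] at h1; simp at h1
    · apply Fin.ext; simp [leafOut, h1.le]
  · rcases le_or_gt j.val (i.val + n) with h2 | h2
    · exact Or.inl ⟨⟨j.val - i.val, by omega⟩, Fin.ext (by simp [leafIn]; omega)⟩
    · refine Or.inr ⟨⟨j.val - n, by omega⟩, fun e => ?_, ?_⟩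
      · rw [← e] at h2; simp at h2; omega
      · apply Fin.ext
        simp only [leafOut]
        split <;> omega

theorem sum_leaves {M : Type*} [AddCommMonoid M] (a : Fin (l + 1) → M) :
    ∑ j, a j = (∑ p ∈ Finset.univ.erase i, a (leafOut i h p)) + ∑ q, a (leafIn (n := n) i h q) := by
  classical
  rw [← Finset.sum_image (f := a) (leafOut_injective i h).injOn,
    ← Finset.sum_image (f := a) (leafIn_injective i h).injOn, ← Finset.sum_union]
  · refine (Finset.sum_subset (Finset.subset_univ _) fun j _ hj => ?_).symm
    exfalso
    apply hj
    rcases leaf_cases i h j with ⟨q, rfl⟩ | ⟨p, hp, rfl⟩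
    · exact Finset.mem_union_right _ (Finset.mem_image_of_mem _ (Finset.mem_univ q))
    · exact Finset.mem_union_left _ (Finset.mem_image_of_mem _ (by simp [hp]))
  · rw [Finset.disjoint_left]
    intro j hj hj'
    simp only [Finset.mem_image, Finset.mem_erase] at hj hj'
    obtain ⟨p, hp, rfl⟩ := hj
    obtain ⟨q, _, hq⟩ := hj'
    exact leafIn_ne_leafOut i h q p hp.1 hq

end Leaves

namespace DGSpace

variable {k : Type u} [Field k] (V : DGSpace.{u, v} k)

theorem proj_of_mem {a : ZMod 2} {x : V.carrier} (hx : x ∈ V.deg a) (b : ZMod 2) :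
    V.proj b x = if b = a then x else 0 := by
  have : V.proj b x = (DirectSum.decompose V.deg x b : V.carrier) := rfl
  rw [this]
  split
  · subst b; exact DirectSum.decompose_of_mem_same V.deg hx
  · next hne => exact DirectSum.decompose_of_mem_ne V.deg hx (fun e => hne e.symm)

theorem proj_mem (a : ZMod 2) (x : V.carrier) : V.proj a x ∈ V.deg a :=
  (DirectSum.decompose V.deg x a).2

theorem twist_of_mem {a : ZMod 2} {x : V.carrier} (hx : x ∈ V.deg a) (b : ZMod 2) :
    V.twist b x = ksign k b a • x := by
  simp only [twist, LinearMap.sum_apply, LinearMap.smul_apply, V.proj_of_mem hx]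
  rw [Finset.sum_eq_single a] <;> simp +contextual

theorem twist_mem {a : ZMod 2} {x : V.carrier} (hx : x ∈ V.deg a) (b : ZMod 2) :
    V.twist b x ∈ V.deg a := by
  rw [V.twist_of_mem hx]; exact Submodule.smul_mem _ _ hx

variable {V}

/-- The arguments of `f` in the composition of `f` and `g` at place `i`. -/
def compArg {m n l : ℕ} (i : Fin (m + 1)) (h : m + n = l) (g : V.Multi n)
    (x : Fin (l + 1) → V.carrier) (p : Fin (m + 1)) : V.carrier :=
  if p = i then g (fun q => x (leafIn i h q)) else x (leafOut i h p)

theorem compArg_update_in {m n l : ℕ} (i : Fin (m + 1)) (h : m + n = l) (g : V.Multi n)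
    [DecidableEq (Fin (l + 1))] (x : Fin (l + 1) → V.carrier) (q : Fin (n + 1)) (y : V.carrier) :
    compArg i h g (Function.update x (leafIn i h q) y) =
      Function.update (compArg i h g x) i
        (g (Function.update (fun q => x (leafIn i h q)) q y)) := by
  funext p
  by_cases hp : p = i
  · subst hp
    simp only [compArg, if_true, Function.update_self]
    congr 1
    funext q'
    by_cases hq : q' = q
    · subst hq; simp
    · rw [Function.update_of_ne hq, Function.update_of_ne ((leafIn_injective p h).ne hq)]
  · rw [Function.update_of_ne hp]
    simp only [compArg, if_neg hp]
    rw [Function.update_of_ne (leafIn_ne_leafOut i h q p hp).symm]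

theorem compArg_update_out {m n l : ℕ} (i : Fin (m + 1)) (h : m + n = l) (g : V.Multi n)
    [DecidableEq (Fin (l + 1))] (x : Fin (l + 1) → V.carrier) (p : Fin (m + 1)) (hp : p ≠ i)
    (y : V.carrier) :
    compArg i h g (Function.update x (leafOut i h p) y) =
      Function.update (compArg i h g x) p y := by
  funext p'
  by_cases hpi : p' = i
  · subst hpi
    rw [Function.update_of_ne hp.symm]
    simp only [compArg, if_true]
    congr 1
    funext q
    rw [Function.update_of_ne (leafIn_ne_leafOut p' h q p hp)]
  · simp only [compArg, if_neg hpi]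
    by_cases hpp : p' = p
    · subst hpp; simp
    · rw [Function.update_of_ne hpp, Function.update_of_ne ((leafOut_injective i h).ne hpp),
        compArg, if_neg hpi]

/-- The composition without signs: `f(x₀, …, x_{i-1}, g(x_i, …, x_{i+n}), x_{i+n+1}, …)`. -/
def plainComp {m n l : ℕ} (i : Fin (m + 1)) (h : m + n = l) (f : V.Multi m) (g : V.Multi n) :
    V.Multi l where
  toFun x := f (compArg i h g x)
  map_update_add' x j y z := by
    rcases leaf_cases i h j with ⟨q, rfl⟩ | ⟨p, hp, rfl⟩
    · rw [compArg_update_in, compArg_update_in, compArg_update_in, g.map_update_add,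
        f.map_update_add]
    · rw [compArg_update_out _ _ _ _ _ hp, compArg_update_out _ _ _ _ _ hp,
        compArg_update_out _ _ _ _ _ hp, f.map_update_add]
  map_update_smul' x j c y := by
    rcases leaf_cases i h j with ⟨q, rfl⟩ | ⟨p, hp, rfl⟩
    · rw [compArg_update_in, compArg_update_in, g.map_update_smul, f.map_update_smul]
    · rw [compArg_update_out _ _ _ _ _ hp, compArg_update_out _ _ _ _ _ hp, f.map_update_smul]

/-- The precomposition of `f` with `φ` in place `i` and with the sign operator of parity `b` in all
earlier places. -/
noncomputable def precomp {m : ℕ} (b : ZMod 2) (i : Fin (m + 1)) (φ : V.carrier →ₗ[k] V.carrier)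
    (f : V.Multi m) : V.Multi m :=
  f.compLinearMap fun p => if p < i then V.twist b else if p = i then φ else LinearMap.id

theorem plainComp_mem {m n l : ℕ} {a b c : ZMod 2} (i : Fin (m + 1)) (h : m + n = l)
    (hg : a + b = c) {f : V.Multi m} {g : V.Multi n} (hf : f ∈ V.endOp m a)
    (hg' : g ∈ V.endOp n b) : plainComp i h f g ∈ V.endOp l c := by
  intro e x hx
  have key := hf (fun p => if p = i then b + ∑ q, e (leafIn (n := n) i h q) else e (leafOut i h p))
    (compArg i h g x) (fun p => by
      by_cases hp : p = i
      · simp only [compArg, if_pos hp]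
        exact hg' _ _ fun q => hx _
      · simp only [compArg, if_neg hp]
        exact hx _)
  have hs : (∑ p, if p = i then b + ∑ q, e (leafIn (n := n) i h q) else e (leafOut i h p))
      = b + ∑ j, e j := by
    rw [sum_leaves i h e, ← Finset.add_sum_erase _ _ (Finset.mem_univ i), if_pos rfl,
      Finset.sum_congr rfl (fun p hp => if_neg (Finset.ne_of_mem_erase hp))]
    abel
  rw [hs, ← add_assoc, hg] at key
  exact key

theorem precomp_mem {m : ℕ} {a g c : ZMod 2} (b : ZMod 2) (i : Fin (m + 1)) (hc : a + g = c)
    {φ : V.carrier →ₗ[k] V.carrier} (hφ : ∀ e x, x ∈ V.deg e → φ x ∈ V.deg (e + g))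
    {f : V.Multi m} (hf : f ∈ V.endOp m a) : precomp b i φ f ∈ V.endOp m c := by
  intro e x hx
  have key := hf (fun p => if p = i then e p + g else e p)
    (fun p => (if p < i then V.twist b else if p = i then φ else LinearMap.id) (x p)) (fun p => by
      rcases lt_trichotomy p i with h | h | h
      · simpa [h, h.ne] using V.twist_mem (hx p) b
      · simpa [h] using hφ _ _ (h ▸ hx p)
      · simpa [h.not_gt, h.ne'] using hx p)
  have hs : (∑ p, if p = i then e p + g else e p) = g + ∑ j, e j := by
    have : ∀ p, (if p = i then e p + g else e p) = e p + if p = i then g else 0 := by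
      intro p; split <;> simp
    simp only [this, Finset.sum_add_distrib, Finset.sum_ite_eq', Finset.mem_univ, if_true]
    abel
  rw [hs, ← add_assoc, hc] at key
  exact key

/-- The sign of the reordering of a word `x₀ x₁ ⋯` of parities `a` as `x_{σ 0} x_{σ 1} ⋯`. -/
noncomputable def reorderSign {n : ℕ} (σ : Equiv.Perm (Fin (n + 1))) (a : Fin (n + 1) → ZMod 2) :
    k :=
  ∏ p, ∏ q, if p < q ∧ σ q < σ p then ksign k (a (σ p)) (a (σ q)) else 1

/-- The action of a permutation on multilinear maps: on homogeneous arguments it is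
`± f(x_{σ 0}, x_{σ 1}, …)` with the sign of the reordering. -/
noncomputable def permute {n : ℕ} (σ : Equiv.Perm (Fin (n + 1))) : V.Multi n →ₗ[k] V.Multi n where
  toFun f := ∑ a : Fin (n + 1) → ZMod 2,
    (reorderSign σ a : k) • (f.compLinearMap fun p => V.proj (a (σ p))).domDomCongr σ
  map_add' f g := by
    rw [← Finset.sum_add_distrib]
    refine Finset.sum_congr rfl fun a _ => ?_
    rw [← smul_add]; rfl
  map_smul' c f := by
    rw [RingHom.id_apply, Finset.smul_sum]
    refine Finset.sum_congr rfl fun a _ => ?_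
    rw [smul_comm]; rfl

theorem permute_of_mem {n : ℕ} (σ : Equiv.Perm (Fin (n + 1))) (f : V.Multi n)
    (a : Fin (n + 1) → ZMod 2) (x : Fin (n + 1) → V.carrier) (hx : ∀ j, x j ∈ V.deg (a j)) :
    permute σ f x = (reorderSign σ a : k) • f (fun p => x (σ p)) := by
  simp only [permute, LinearMap.coe_mk, AddHom.coe_mk, _root_.sum_apply,
    _root_.smul_apply, MultilinearMap.domDomCongr_apply,
    MultilinearMap.compLinearMap_apply]
  rw [Finset.sum_eq_single a]
  · congr 2
    funext p
    rw [V.proj_of_mem (hx _), if_pos rfl]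
  · intro b _ hb
    obtain ⟨j, hj⟩ := Function.ne_iff.mp hb
    rw [f.map_coord_zero (σ.symm j), smul_zero]
    rw [Equiv.apply_symm_apply, V.proj_of_mem (hx j), if_neg hj]
  · simp

theorem permute_mem {n : ℕ} {g : ZMod 2} (σ : Equiv.Perm (Fin (n + 1))) {f : V.Multi n}
    (hf : f ∈ V.endOp n g) : permute σ f ∈ V.endOp n g := by
  intro a x hx
  rw [permute_of_mem σ f a x hx, ← Equiv.sum_comp σ a]
  exact Submodule.smul_mem _ _ (hf _ _ fun j => hx _)

theorem precomp_add {m : ℕ} (b : ZMod 2) (i : Fin (m + 1)) (φ : V.carrier →ₗ[k] V.carrier)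
    (f g : V.Multi m) : precomp b i φ (f + g) = precomp b i φ f + precomp b i φ g := rfl

theorem precomp_smul {m : ℕ} (b : ZMod 2) (i : Fin (m + 1)) (φ : V.carrier →ₗ[k] V.carrier)
    (c : k) (f : V.Multi m) : precomp b i φ (c • f) = c • precomp b i φ f := rfl

theorem plainComp_add_right {m n l : ℕ} (i : Fin (m + 1)) (h : m + n = l) (f : V.Multi m)
    (g g' : V.Multi n) : plainComp i h f (g + g') = plainComp i h f g + plainComp i h f g' := by
  ext x
  have key : ∀ g₁ : V.Multi n, compArg i h g₁ x =
      Function.update (compArg i h 0 x) i (g₁ fun q => x (leafIn i h q)) := by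
    intro g₁; funext p
    by_cases hp : p = i
    · subst hp; simp [compArg]
    · rw [Function.update_of_ne hp]; simp [compArg, hp]
  change f _ = f _ + f _
  rw [key (g + g'), key g, key g', ← f.map_update_add]
  rfl

theorem plainComp_smul_right {m n l : ℕ} (i : Fin (m + 1)) (h : m + n = l) (f : V.Multi m)
    (c : k) (g : V.Multi n) : plainComp i h f (c • g) = c • plainComp i h f g := by
  ext x
  have key : ∀ g₁ : V.Multi n, compArg i h g₁ x =
      Function.update (compArg i h 0 x) i (g₁ fun q => x (leafIn i h q)) := by
    intro g₁; funext p
    by_cases hp : p = i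
    · subst hp; simp [compArg]
    · rw [Function.update_of_ne hp]; simp [compArg, hp]
  change f _ = c • f _
  rw [key (c • g), key g, ← f.map_update_smul]
  rfl

variable (V)

/-- A linear map as an operation with one input. -/
def ofLinear (φ : V.carrier →ₗ[k] V.carrier) : V.Multi 0 :=
  φ.compMultilinearMap (MultilinearMap.ofSubsingleton k V.carrier V.carrier (0 : Fin 1)
    LinearMap.id)

theorem ofLinear_apply (φ : V.carrier →ₗ[k] V.carrier) (x : Fin 1 → V.carrier) :
    V.ofLinear φ x = φ (x 0) := rfl

theorem ofLinear_mem {g : ZMod 2} {φ : V.carrier →ₗ[k] V.carrier}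
    (hφ : ∀ e x, x ∈ V.deg e → φ x ∈ V.deg (e + g)) : V.ofLinear φ ∈ V.endOp 0 g := by
  intro a x hx
  rw [ofLinear_apply, add_comm]
  simpa using hφ _ _ (hx 0)

/-- The endomorphism operad: `E(V)(n) = Hom(V^{⊗ n}, V)`, with
`(f ∘_i g)(x) = (-1)^(|g|(|x₀| + ⋯ + |x_{i-1}|)) f(x₀, …, x_{i-1}, g(x_i, …), …)` and
`(d f)(x) = d (f x) - (-1)^|f| ∑_p (-1)^(|x₀| + ⋯ + |x_{p-1}|) f(x₀, …, d x_p, …)`. -/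
noncomputable def endOperad : DGOperadData.{u, v} k where
  Op n g := V.endOp n g
  one := ⟨V.ofLinear LinearMap.id, V.ofLinear_mem fun e x hx => by simpa using hx⟩
  comp {m n l a b c} i h hg := LinearMap.mk₂ k
    (fun f g => ⟨plainComp i h (precomp b i LinearMap.id f.1) g.1,
      plainComp_mem i h hg (precomp_mem b i (add_zero a) (fun e x hx => by simpa using hx) f.2)
        g.2⟩)
    (fun _ _ _ => rfl)
    (fun _ _ _ => rfl)
    (fun f g g' => Subtype.ext (plainComp_add_right i h _ g.1 g'.1))
    (fun c f g => Subtype.ext (plainComp_smul_right i h _ c g.1))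
  act σ := (permute σ).restrict fun _ hf => permute_mem σ hf
  d {n a b} hab :=
    { toFun := fun f => ⟨V.d.compMultilinearMap f.1 -
          ksign k 1 a • ∑ p, precomp 1 p V.d f.1,
        Submodule.sub_mem _
          (fun e x hx => by
            have := V.d_mem _ _ (f.2 e x hx)
            rwa [add_right_comm, hab] at this)
          (Submodule.smul_mem _ _ (Submodule.sum_mem _ fun p _ =>
            precomp_mem 1 p hab V.d_mem f.2))⟩
      map_add' := fun f g => Subtype.ext (by
        simp only [Submodule.coe_add, precomp_add, Finset.sum_add_distrib, smul_add,
          LinearMap.compMultilinearMap_add]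
        abel)
      map_smul' := fun c f => Subtype.ext (by
        simp only [Submodule.coe_smul, precomp_smul, ← Finset.smul_sum, RingHom.id_apply,
          LinearMap.compMultilinearMap_smul, smul_sub]
        rw [smul_comm]) }

end DGSpace

/-! ### Homotopies -/

namespace DGOperadData

variable {k : Type u} [Field k] (P : DGOperadData.{u, v} k)

/-- Operations of equal parities are the same. -/
def castParity {n : ℕ} {a b : ZMod 2} (h : a = b) : P.Op n a →ₗ[k] P.Op n b :=
  h ▸ LinearMap.id

open Polynomial in
/-- The product on `P ⊗ k[z]` induced by a partial composition and the product of polynomials. -/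
noncomputable def polyComp {m n l : ℕ} {a b c : ZMod 2} (i : Fin (m + 1)) (h : m + n = l)
    (hg : a + b = c) :
    (P.Op m a ⊗[k] k[X]) →ₗ[k] (P.Op n b ⊗[k] k[X]) →ₗ[k] (P.Op l c ⊗[k] k[X]) :=
  TensorProduct.map₂ (P.comp i h hg) (LinearMap.mul k k[X])

open Polynomial in
/-- The dg operad `P ⊗ D`, where `D = k[z, dz]` is the polynomial de Rham algebra of the line.
The pair `(x, y)` stands for `x + y dz`, with `x` and `y` polynomials in `z` with coefficients in
`P`. -/
noncomputable def tensorDeRham : DGOperadData.{u, max u v} k where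
  Op n a := (P.Op n a ⊗[k] k[X]) × (P.Op n (a + 1) ⊗[k] k[X])
  one := (P.one ⊗ₜ 1, 0)
  comp {m n l a b c} i h hg := LinearMap.mk₂ k
    (fun x y => (P.polyComp i h hg x.1 y.1,
      P.polyComp i h (by rw [← hg, add_assoc] : a + (b + 1) = c + 1) x.1 y.2 +
        ksign k 1 b • P.polyComp i h (by rw [← hg, add_right_comm] : a + 1 + b = c + 1) x.2 y.1))
    (fun x x' y => by
      ext1
      · simp
      · simp only [Prod.fst_add, Prod.snd_add, map_add, LinearMap.add_apply, smul_add]; abel)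
    (fun r x y => by ext1 <;> simp [smul_comm r])
    (fun x y y' => by
      ext1
      · simp
      · simp only [Prod.fst_add, Prod.snd_add, map_add, smul_add]; abel)
    (fun r x y => by ext1 <;> simp [smul_comm r])
  act σ := LinearMap.prodMap ((P.act σ).rTensor k[X]) ((P.act σ).rTensor k[X])
  d {n a b} h := LinearMap.prod
    ((P.d h).rTensor k[X] ∘ₗ LinearMap.fst k _ _)
    (ksign k 1 a • TensorProduct.map
        (P.castParity (by rw [← h, add_assoc, CharTwo.add_self_eq_zero, add_zero] : a = b + 1))
        Polynomial.derivative ∘ₗ LinearMap.fst k _ _ +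
      (P.d (by rw [h] : a + 1 + 1 = b + 1)).rTensor k[X] ∘ₗ LinearMap.snd k _ _)

open Polynomial in
/-- The evaluation `id ⊗ ev_c : P ⊗ D → P`, with `z ↦ c` and `dz ↦ 0`. -/
noncomputable def evalAt (c : k) {n : ℕ} {a : ZMod 2} :
    P.tensorDeRham.Op n a →ₗ[k] P.Op n a :=
  (TensorProduct.rid k (P.Op n a)).toLinearMap ∘ₗ (Polynomial.leval c).lTensor (P.Op n a) ∘ₗ
    LinearMap.fst k (P.Op n a ⊗[k] k[X]) (P.Op n (a + 1) ⊗[k] k[X])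

end DGOperadData

/-- Two maps of dg operads `P → Q` are (Sullivan) homotopic if they are the values at `z = 0` and
`z = 1` of a (unital) map of dg operads `P → Q ⊗ k[z, dz]`. -/
def DGOperadHom.Homotopic {k : Type u} [Field k] {P : DGOperadData.{u, v} k}
    {Q : DGOperadData.{u, w} k} (f₀ f₁ : DGOperadHom P Q) : Prop :=
  ∃ F : DGOperadHom P Q.tensorDeRham, F.IsUnital ∧
    (∀ (n : ℕ) (a : ZMod 2) (x : P.Op n a), Q.evalAt 0 (F.app x) = f₀.app x) ∧
    (∀ (n : ℕ) (a : ZMod 2) (x : P.Op n a), Q.evalAt 1 (F.app x) = f₁.app x)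

/-! ### The operad `BV O` -/

/-- Formal expressions in operations of `O` and two further operations `s` (odd) and `t` (even)
with one input, built with the operations of a dg operad. -/
inductive BVTerm {k : Type u} [Field k] (O : DGOperadData.{u, v} k) :
    ℕ → ZMod 2 → Type (max u v)
  | of {n : ℕ} {a : ZMod 2} (x : O.Op n a) : BVTerm O n a
  | s : BVTerm O 0 1
  | t : BVTerm O 0 0
  | zero {n : ℕ} {a : ZMod 2} : BVTerm O n a
  | add {n : ℕ} {a : ZMod 2} (x y : BVTerm O n a) : BVTerm O n a
  | smul {n : ℕ} {a : ZMod 2} (r : k) (x : BVTerm O n a) : BVTerm O n a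
  | comp {m n l : ℕ} {a b c : ZMod 2} (i : Fin (m + 1)) (h : m + n = l) (hg : a + b = c)
      (x : BVTerm O m a) (y : BVTerm O n b) : BVTerm O l c
  | act {n : ℕ} {a : ZMod 2} (σ : Equiv.Perm (Fin (n + 1))) (x : BVTerm O n a) : BVTerm O n a
  | d {n : ℕ} {a b : ZMod 2} (h : a + 1 = b) (x : BVTerm O n a) : BVTerm O n b

open BVTerm in
/-- The equalities between expressions that hold in `BV O`: the smallest congruence for which the
quotient is a unital dg operad with a unital map from `O`, and such that
`s² = 0`, `t² = t`, `st = ts = 0`, `d s = 1 - t`, `d t = 0`. -/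
inductive BVRel {k : Type u} [Field k] (O : DGOperadData.{u, v} k) :
    ∀ {n : ℕ} {a : ZMod 2}, BVTerm O n a → BVTerm O n a → Prop
  -- an equivalence relation compatible with all operations
  | refl {n : ℕ} {a : ZMod 2} (x : BVTerm O n a) : BVRel O x x
  | symm {n : ℕ} {a : ZMod 2} {x y : BVTerm O n a} : BVRel O x y → BVRel O y x
  | trans {n : ℕ} {a : ZMod 2} {x y z : BVTerm O n a} : BVRel O x y → BVRel O y z → BVRel O x z
  | congr_add {n : ℕ} {a : ZMod 2} {x x' y y' : BVTerm O n a} :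
      BVRel O x x' → BVRel O y y' → BVRel O (add x y) (add x' y')
  | congr_smul {n : ℕ} {a : ZMod 2} (r : k) {x x' : BVTerm O n a} :
      BVRel O x x' → BVRel O (smul r x) (smul r x')
  | congr_comp {m n l : ℕ} {a b c : ZMod 2} (i : Fin (m + 1)) (h : m + n = l) (hg : a + b = c)
      {x x' : BVTerm O m a} {y y' : BVTerm O n b} :
      BVRel O x x' → BVRel O y y' → BVRel O (comp i h hg x y) (comp i h hg x' y')
  | congr_act {n : ℕ} {a : ZMod 2} (σ : Equiv.Perm (Fin (n + 1))) {x x' : BVTerm O n a} :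
      BVRel O x x' → BVRel O (act σ x) (act σ x')
  | congr_d {n : ℕ} {a b : ZMod 2} (h : a + 1 = b) {x x' : BVTerm O n a} :
      BVRel O x x' → BVRel O (d h x) (d h x')
  -- the vector space laws
  | add_assoc {n : ℕ} {a : ZMod 2} (x y z : BVTerm O n a) :
      BVRel O (add (add x y) z) (add x (add y z))
  | add_comm {n : ℕ} {a : ZMod 2} (x y : BVTerm O n a) : BVRel O (add x y) (add y x)
  | zero_add {n : ℕ} {a : ZMod 2} (x : BVTerm O n a) : BVRel O (add zero x) x
  | neg_add {n : ℕ} {a : ZMod 2} (x : BVTerm O n a) : BVRel O (add (smul (-1) x) x) zero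
  | smul_add {n : ℕ} {a : ZMod 2} (r : k) (x y : BVTerm O n a) :
      BVRel O (smul r (add x y)) (add (smul r x) (smul r y))
  | add_smul {n : ℕ} {a : ZMod 2} (r r' : k) (x : BVTerm O n a) :
      BVRel O (smul (r + r') x) (add (smul r x) (smul r' x))
  | mul_smul {n : ℕ} {a : ZMod 2} (r r' : k) (x : BVTerm O n a) :
      BVRel O (smul (r * r') x) (smul r (smul r' x))
  | one_smul {n : ℕ} {a : ZMod 2} (x : BVTerm O n a) : BVRel O (smul 1 x) x
  -- linearity of the operations
  | comp_add_left {m n l : ℕ} {a b c : ZMod 2} (i : Fin (m + 1)) (h : m + n = l) (hg : a + b = c)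
      (x x' : BVTerm O m a) (y : BVTerm O n b) :
      BVRel O (comp i h hg (add x x') y) (add (comp i h hg x y) (comp i h hg x' y))
  | comp_smul_left {m n l : ℕ} {a b c : ZMod 2} (i : Fin (m + 1)) (h : m + n = l)
      (hg : a + b = c) (r : k) (x : BVTerm O m a) (y : BVTerm O n b) :
      BVRel O (comp i h hg (smul r x) y) (smul r (comp i h hg x y))
  | comp_add_right {m n l : ℕ} {a b c : ZMod 2} (i : Fin (m + 1)) (h : m + n = l)
      (hg : a + b = c) (x : BVTerm O m a) (y y' : BVTerm O n b) :
      BVRel O (comp i h hg x (add y y')) (add (comp i h hg x y) (comp i h hg x y'))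
  | comp_smul_right {m n l : ℕ} {a b c : ZMod 2} (i : Fin (m + 1)) (h : m + n = l)
      (hg : a + b = c) (r : k) (x : BVTerm O m a) (y : BVTerm O n b) :
      BVRel O (comp i h hg x (smul r y)) (smul r (comp i h hg x y))
  | act_add {n : ℕ} {a : ZMod 2} (σ : Equiv.Perm (Fin (n + 1))) (x y : BVTerm O n a) :
      BVRel O (act σ (add x y)) (add (act σ x) (act σ y))
  | act_smul {n : ℕ} {a : ZMod 2} (σ : Equiv.Perm (Fin (n + 1))) (r : k) (x : BVTerm O n a) :
      BVRel O (act σ (smul r x)) (smul r (act σ x))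
  | d_add {n : ℕ} {a b : ZMod 2} (h : a + 1 = b) (x y : BVTerm O n a) :
      BVRel O (d h (add x y)) (add (d h x) (d h y))
  | d_smul {n : ℕ} {a b : ZMod 2} (h : a + 1 = b) (r : k) (x : BVTerm O n a) :
      BVRel O (d h (smul r x)) (smul r (d h x))
  -- the laws of a unital dg operad
  | one_comp {n : ℕ} {a : ZMod 2} (x : BVTerm O n a) :
      BVRel O (comp 0 (Nat.zero_add n) (_root_.zero_add a) (of O.one) x) x
  | comp_one {n : ℕ} {a : ZMod 2} (i : Fin (n + 1)) (x : BVTerm O n a) :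
      BVRel O (comp i (Nat.add_zero n) (_root_.add_zero a) x (of O.one)) x
  | assoc_seq {m n p mn np l : ℕ} {a b c ab bc e : ZMod 2}
      (i : Fin (m + 1)) (j : Fin (n + 1)) (h₁ : m + n = mn) (h₂ : mn + p = l)
      (h₃ : n + p = np) (h₄ : m + np = l) (g₁ : a + b = ab) (g₂ : ab + c = e)
      (g₃ : b + c = bc) (g₄ : a + bc = e)
      (x : BVTerm O m a) (y : BVTerm O n b) (z : BVTerm O p c) :
      BVRel O (comp (leafIn i h₁ j) h₂ g₂ (comp i h₁ g₁ x y) z)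
        (comp i h₄ g₄ x (comp j h₃ g₃ y z))
  | assoc_par {m n p mn mp l : ℕ} {a b c ab ac e : ZMod 2}
      (i j : Fin (m + 1)) (hij : i < j) (h₁ : m + n = mn) (h₂ : mn + p = l)
      (h₃ : m + p = mp) (h₄ : mp + n = l) (g₁ : a + b = ab) (g₂ : ab + c = e)
      (g₃ : a + c = ac) (g₄ : ac + b = e)
      (x : BVTerm O m a) (y : BVTerm O n b) (z : BVTerm O p c) :
      BVRel O (comp (leafOut i h₁ j) h₂ g₂ (comp i h₁ g₁ x y) z)
        (smul (ksign k b c) (comp (leafOut j h₃ i) h₄ g₄ (comp j h₃ g₃ x z) y))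
  | act_one {n : ℕ} {a : ZMod 2} (x : BVTerm O n a) : BVRel O (act 1 x) x
  | act_mul {n : ℕ} {a : ZMod 2} (σ τ : Equiv.Perm (Fin (n + 1))) (x : BVTerm O n a) :
      BVRel O (act (σ * τ) x) (act σ (act τ x))
  | act_comp {m n l : ℕ} {a b c : ZMod 2} (i : Fin (m + 1)) (h : m + n = l) (hg : a + b = c)
      (σ : Equiv.Perm (Fin (m + 1))) (τ : Equiv.Perm (Fin (n + 1)))
      (ρ : Equiv.Perm (Fin (l + 1)))
      (hin : ∀ q, ρ (leafIn i h q) = leafIn (σ i) h (τ q))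
      (hout : ∀ p, p ≠ i → ρ (leafOut i h p) = leafOut (σ i) h (σ p))
      (x : BVTerm O m a) (y : BVTerm O n b) :
      BVRel O (comp (σ i) h hg (act σ x) (act τ y)) (act ρ (comp i h hg x y))
  | d_d {n : ℕ} {a b c : ZMod 2} (h₁ : a + 1 = b) (h₂ : b + 1 = c) (x : BVTerm O n a) :
      BVRel O (d h₂ (d h₁ x)) zero
  | d_act {n : ℕ} {a b : ZMod 2} (h : a + 1 = b) (σ : Equiv.Perm (Fin (n + 1)))
      (x : BVTerm O n a) : BVRel O (d h (act σ x)) (act σ (d h x))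
  | d_comp {m n l : ℕ} {a b c a' b' c' : ZMod 2} (i : Fin (m + 1)) (h : m + n = l)
      (hg : a + b = c) (ha : a + 1 = a') (hb : b + 1 = b') (hc : c + 1 = c')
      (g₁ : a' + b = c') (g₂ : a + b' = c') (x : BVTerm O m a) (y : BVTerm O n b) :
      BVRel O (d hc (comp i h hg x y))
        (add (comp i h g₁ (d ha x) y) (smul (ksign k 1 a) (comp i h g₂ x (d hb y))))
  -- `O → BV O` is a map of dg operads
  | of_add {n : ℕ} {a : ZMod 2} (x y : O.Op n a) : BVRel O (of (x + y)) (add (of x) (of y))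
  | of_smul {n : ℕ} {a : ZMod 2} (r : k) (x : O.Op n a) : BVRel O (of (r • x)) (smul r (of x))
  | of_comp {m n l : ℕ} {a b c : ZMod 2} (i : Fin (m + 1)) (h : m + n = l) (hg : a + b = c)
      (x : O.Op m a) (y : O.Op n b) :
      BVRel O (of (O.comp i h hg x y)) (comp i h hg (of x) (of y))
  | of_act {n : ℕ} {a : ZMod 2} (σ : Equiv.Perm (Fin (n + 1))) (x : O.Op n a) :
      BVRel O (of (O.act σ x)) (act σ (of x))
  | of_d {n : ℕ} {a b : ZMod 2} (h : a + 1 = b) (x : O.Op n a) :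
      BVRel O (of (O.d h x)) (d h (of x))
  -- the relations between `s` and `t`, and their differentials
  | s_s : BVRel O (comp 0 (Nat.zero_add 0) (by decide : (1 : ZMod 2) + 1 = 0) s s) zero
  | t_t : BVRel O (comp 0 (Nat.zero_add 0) (_root_.zero_add 0) t t) t
  | s_t : BVRel O (comp 0 (Nat.zero_add 0) (_root_.add_zero 1) s t) zero
  | t_s : BVRel O (comp 0 (Nat.zero_add 0) (_root_.zero_add 1) t s) zero
  | d_s : BVRel O (d (by decide : (1 : ZMod 2) + 1 = 0) s) (add (of O.one) (smul (-1) t))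
  | d_t : BVRel O (d (_root_.zero_add 1) t) zero

/-- The operations of `BV O`: expressions modulo the equalities that hold. -/
def BVOp {k : Type u} [Field k] (O : DGOperadData.{u, v} k) (n : ℕ) (a : ZMod 2) :
    Type (max u v) :=
  Quot (BVRel O (n := n) (a := a))

namespace BVOp

variable {k : Type u} [Field k] {O : DGOperadData.{u, v} k} {n : ℕ} {a : ZMod 2}

/-- The operation given by an expression. -/
def mk (x : BVTerm O n a) : BVOp O n a := Quot.mk _ x

theorem sound {x y : BVTerm O n a} (h : BVRel O x y) : mk x = mk y := Quot.sound h

theorem ind {C : BVOp O n a → Prop} (h : ∀ x, C (mk x)) (x : BVOp O n a) : C x := Quot.ind h x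

instance : Zero (BVOp O n a) := ⟨mk .zero⟩

instance : Add (BVOp O n a) :=
  ⟨Quot.map₂ .add (fun _ _ _ h => .congr_add (.refl _) h) (fun _ _ _ h => .congr_add h (.refl _))⟩

instance : SMul k (BVOp O n a) := ⟨fun r => Quot.map (.smul r) fun _ _ h => .congr_smul r h⟩

instance : Neg (BVOp O n a) := ⟨fun x => (-1 : k) • x⟩

theorem mk_add (x y : BVTerm O n a) : mk (.add x y) = mk x + mk y := rfl
theorem mk_smul (r : k) (x : BVTerm O n a) : mk (.smul r x) = r • mk x := rfl

protected theorem add_comm' (x y : BVOp O n a) : x + y = y + x := by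
  induction x using ind; induction y using ind; exact sound (.add_comm _ _)

protected theorem zero_add' (x : BVOp O n a) : 0 + x = x := by
  induction x using ind; exact sound (.zero_add _)

instance : AddCommGroup (BVOp O n a) where
  add_assoc x y z := by
    induction x using ind; induction y using ind; induction z using ind
    exact sound (.add_assoc _ _ _)
  zero_add := BVOp.zero_add'
  add_zero x := by rw [BVOp.add_comm', BVOp.zero_add']
  neg_add_cancel x := by induction x using ind; exact sound (.neg_add _)
  add_comm := BVOp.add_comm'
  nsmul := nsmulRec
  zsmul := zsmulRec

protected theorem add_smul' (r r' : k) (x : BVOp O n a) : (r + r') • x = r • x + r' • x := by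
  induction x using ind; exact sound (.add_smul _ _ _)

instance : Module k (BVOp O n a) where
  one_smul x := by induction x using ind; exact sound (.one_smul _)
  mul_smul r r' x := by induction x using ind; exact sound (.mul_smul _ _ _)
  smul_add r x y := by
    induction x using ind; induction y using ind; exact sound (.smul_add _ _ _)
  smul_zero r := by
    have h : ∀ y : BVOp O n a, r • (0 + y) = r • (0 : BVOp O n a) + r • y := fun y => by
      induction y using ind; exact sound (.smul_add _ _ _)
    have := h 0
    rw [zero_add] at this
    exact (left_eq_add.mp this)
  add_smul := BVOp.add_smul'
  zero_smul x := by
    have := BVOp.add_smul' (0 : k) 0 x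
    rw [zero_add] at this
    exact (left_eq_add.mp this)

end BVOp

/-- The dg operad `BV O`, generated over `O` by an odd operation `s` and an even operation `t`, both
with one input, subject to `s² = 0`, `t² = t`, `st = ts = 0`, with `d s = 1 - t` and `d t = 0`. -/
def bvResolution {k : Type u} [Field k] (O : DGOperadData.{u, v} k) :
    DGOperadData.{u, max u v} k where
  Op n a := BVOp O n a
  one := BVOp.mk (.of O.one)
  comp i h hg := LinearMap.mk₂ k
    (Quot.map₂ (.comp i h hg) (fun _ _ _ e => .congr_comp i h hg (.refl _) e)
      (fun _ _ _ e => .congr_comp i h hg e (.refl _)))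
    (fun x x' y => by
      induction x using BVOp.ind; induction x' using BVOp.ind; induction y using BVOp.ind
      exact BVOp.sound (.comp_add_left ..))
    (fun r x y => by
      induction x using BVOp.ind; induction y using BVOp.ind
      exact BVOp.sound (.comp_smul_left ..))
    (fun x y y' => by
      induction x using BVOp.ind; induction y using BVOp.ind; induction y' using BVOp.ind
      exact BVOp.sound (.comp_add_right ..))
    (fun r x y => by
      induction x using BVOp.ind; induction y using BVOp.ind
      exact BVOp.sound (.comp_smul_right ..))
  act σ :=
    { toFun := Quot.map (.act σ) fun _ _ e => .congr_act σ e
      map_add' := fun x y => by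
        induction x using BVOp.ind; induction y using BVOp.ind
        exact BVOp.sound (.act_add ..)
      map_smul' := fun r x => by
        induction x using BVOp.ind; exact BVOp.sound (.act_smul ..) }
  d h :=
    { toFun := Quot.map (.d h) fun _ _ e => .congr_d h e
      map_add' := fun x y => by
        induction x using BVOp.ind; induction y using BVOp.ind
        exact BVOp.sound (.d_add ..)
      map_smul' := fun r x => by
        induction x using BVOp.ind; exact BVOp.sound (.d_smul ..) }

/-- `j : O → BV O`. -/
def bvOf {k : Type u} [Field k] (O : DGOperadData.{u, v} k) :
    DGOperadHom O (bvResolution O) where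
  app :=
    { toFun := fun x => BVOp.mk (.of x)
      map_add' := fun _ _ => BVOp.sound (.of_add ..)
      map_smul' := fun _ _ => BVOp.sound (.of_smul ..) }
  map_comp _ _ _ _ _ := BVOp.sound (.of_comp ..)
  map_act _ _ := BVOp.sound (.of_act ..)
  map_d _ _ := BVOp.sound (.of_d ..)

/-- The generator `s` of `BV O`. -/
def bvS {k : Type u} [Field k] (O : DGOperadData.{u, v} k) : (bvResolution O).Op 0 1 :=
  BVOp.mk .s

/-- The generator `t` of `BV O`. -/
def bvT {k : Type u} [Field k] (O : DGOperadData.{u, v} k) : (bvResolution O).Op 0 0 :=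
  BVOp.mk .t

theorem bvResolution_isDGOperad {k : Type u} [Field k] (O : DGOperadData.{u, v} k) :
    (bvResolution O).IsDGOperad where
  one_comp x := by induction x using BVOp.ind; exact BVOp.sound (.one_comp ..)
  comp_one i x := by induction x using BVOp.ind; exact BVOp.sound (.comp_one ..)
  assoc_seq i j h₁ h₂ h₃ h₄ g₁ g₂ g₃ g₄ x y z := by
    induction x using BVOp.ind; induction y using BVOp.ind; induction z using BVOp.ind
    exact BVOp.sound (.assoc_seq ..)
  assoc_par i j hij h₁ h₂ h₃ h₄ g₁ g₂ g₃ g₄ x y z := by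
    induction x using BVOp.ind; induction y using BVOp.ind; induction z using BVOp.ind
    exact BVOp.sound (.assoc_par _ _ hij ..)
  act_one x := by induction x using BVOp.ind; exact BVOp.sound (.act_one ..)
  act_mul σ τ x := by induction x using BVOp.ind; exact BVOp.sound (.act_mul ..)
  act_comp i h hg σ τ ρ hin hout x y := by
    induction x using BVOp.ind; induction y using BVOp.ind
    exact BVOp.sound (.act_comp i h hg σ τ ρ hin hout ..)
  d_d h₁ h₂ x := by induction x using BVOp.ind; exact BVOp.sound (.d_d ..)
  d_one := by
    rintro b rfl
    have h₁ : (bvResolution O).comp 0 (Nat.zero_add 0) (zero_add 0) (bvResolution O).one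
        (bvResolution O).one = (bvResolution O).one := BVOp.sound (.one_comp _)
    have h₂ : (bvResolution O).d rfl ((bvResolution O).comp 0 (Nat.zero_add 0) (zero_add 0)
        (bvResolution O).one (bvResolution O).one) =
      (bvResolution O).comp 0 (Nat.zero_add 0) (add_zero _)
        ((bvResolution O).d rfl (bvResolution O).one) (bvResolution O).one +
      ksign k 1 0 • (bvResolution O).comp 0 (Nat.zero_add 0) (zero_add _)
        (bvResolution O).one ((bvResolution O).d rfl (bvResolution O).one) :=
      BVOp.sound (.d_comp (O := O) 0 (Nat.zero_add 0) (zero_add 0) rfl rfl rfl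
        (add_zero _) (zero_add _) (.of O.one) (.of O.one))
    have h₃ : (bvResolution O).comp 0 (Nat.zero_add 0) (zero_add (0 + 1)) (bvResolution O).one
        ((bvResolution O).d rfl (bvResolution O).one) =
        (bvResolution O).d rfl (bvResolution O).one := BVOp.sound (.one_comp _)
    have h₄ : (bvResolution O).comp 0 (Nat.zero_add 0) (add_zero (0 + 1))
        ((bvResolution O).d rfl (bvResolution O).one) (bvResolution O).one =
        (bvResolution O).d rfl (bvResolution O).one := BVOp.sound (.comp_one _ _)
    rw [h₁, h₃, h₄, show ksign k 1 0 = 1 by simp [ksign], one_smul] at h₂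
    exact left_eq_add.mp h₂
  d_act h σ x := by induction x using BVOp.ind; exact BVOp.sound (.d_act ..)
  d_comp i h hg ha hb hc g₁ g₂ x y := by
    induction x using BVOp.ind; induction y using BVOp.ind
    exact BVOp.sound (.d_comp i h hg ha hb hc g₁ g₂ _ _)

/-! ### The operad `bv O` -/

theorem leafIn_zero_add {n : ℕ} (i : Fin (0 + 1)) (q : Fin (n + 1)) :
    leafIn i (Nat.zero_add n) q = q := Fin.ext (by simp only [leafIn]; omega)

theorem leafIn_add_zero {n : ℕ} (i : Fin (n + 1)) (q : Fin (0 + 1)) :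
    leafIn i (Nat.add_zero n) q = i := Fin.ext (by simp only [leafIn]; omega)

theorem leafOut_add_zero {n : ℕ} (i p : Fin (n + 1)) : leafOut i (Nat.add_zero n) p = p :=
  Fin.ext (by simp [leafOut])

/-- The operations of `BV O` whose root and leaves are all labelled by `t`: this is the image of
the idempotent `x ↦ t ∘ x ∘ (t, …, t)`. -/
def bvTruncOp {k : Type u} [Field k] (O : DGOperadData.{u, v} k) (n : ℕ) (a : ZMod 2) :
    Submodule k ((bvResolution O).Op n a) where
  carrier := {x | (bvResolution O).comp 0 (Nat.zero_add n) (zero_add a) (bvT O) x = x ∧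
    ∀ i, (bvResolution O).comp i (Nat.add_zero n) (add_zero a) x (bvT O) = x}
  zero_mem' := ⟨map_zero _, fun i => by rw [map_zero, LinearMap.zero_apply]⟩
  add_mem' hx hy := ⟨by rw [map_add, hx.1, hy.1],
    fun i => by rw [map_add, LinearMap.add_apply, hx.2, hy.2]⟩
  smul_mem' r x hx := ⟨by rw [map_smul, hx.1],
    fun i => by rw [map_smul, LinearMap.smul_apply, hx.2]⟩

section Truncation

variable {k : Type u} [Field k] {O : DGOperadData.{u, v} k}

theorem bvT_mem : bvT O ∈ bvTruncOp O 0 0 :=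
  ⟨BVOp.sound .t_t, fun i => by
    obtain rfl : i = 0 := Fin.ext (by omega)
    exact BVOp.sound .t_t⟩

theorem ksign_zero_right (a : ZMod 2) : ksign k a 0 = 1 := by simp [ksign]

theorem ksign_zero_left (a : ZMod 2) : ksign k 0 a = 1 := by simp [ksign]

theorem comp_mem_bvTruncOp {m n l : ℕ} {a b c : ZMod 2} (i : Fin (m + 1)) (h : m + n = l)
    (hg : a + b = c) {x : (bvResolution O).Op m a} {y : (bvResolution O).Op n b}
    (hx : x ∈ bvTruncOp O m a) (hy : y ∈ bvTruncOp O n b) :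
    (bvResolution O).comp i h hg x y ∈ bvTruncOp O l c := by
  have L := bvResolution_isDGOperad O
  refine ⟨?_, fun j => ?_⟩
  · have := L.assoc_seq 0 i (Nat.zero_add m) h h (Nat.zero_add l) (zero_add a) hg hg (zero_add c)
      (bvT O) x y
    rw [← this, hx.1, leafIn_zero_add]
  · rcases leaf_cases i h j with ⟨q, rfl⟩ | ⟨p, hp, rfl⟩
    · rw [L.assoc_seq i q h (Nat.add_zero l) (Nat.add_zero n) h hg (add_zero c) (add_zero b) hg
        x y (bvT O), hy.2]
    · rcases lt_or_gt_of_ne hp with hlt | hlt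
      · have := L.assoc_par p i hlt (Nat.add_zero m) h h (Nat.add_zero l) (add_zero a) hg hg
          (add_zero c) x (bvT O) y
        rw [ksign_zero_left, one_smul, hx.2] at this
        rw [leafOut_add_zero] at this
        exact this.symm
      · have := L.assoc_par i p hlt h (Nat.add_zero l) (Nat.add_zero m) h hg (add_zero c)
          (add_zero a) hg x y (bvT O)
        rw [this, ksign_zero_right, one_smul, hx.2, leafOut_add_zero]

theorem act_mem_bvTruncOp {n : ℕ} {a : ZMod 2} (σ : Equiv.Perm (Fin (n + 1)))
    {x : (bvResolution O).Op n a} (hx : x ∈ bvTruncOp O n a) :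
    (bvResolution O).act σ x ∈ bvTruncOp O n a := by
  have L := bvResolution_isDGOperad O
  refine ⟨?_, fun j => ?_⟩
  · have := L.act_comp (0 : Fin 1) (Nat.zero_add n) (zero_add a) 1 σ σ
      (fun q => by rw [leafIn_zero_add, leafIn_zero_add])
      (fun p hp => absurd (Fin.ext (by omega)) hp) (bvT O) x
    rw [L.act_one, hx.1] at this
    exact this
  · obtain ⟨i, rfl⟩ := σ.surjective j
    have := L.act_comp i (Nat.add_zero n) (add_zero a) σ 1 σ
      (fun q => by rw [leafIn_add_zero, leafIn_add_zero])
      (fun p _ => by rw [leafOut_add_zero, leafOut_add_zero]) x (bvT O)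
    rw [L.act_one, hx.2] at this
    exact this

theorem d_mem_bvTruncOp {n : ℕ} {a b : ZMod 2} (h : a + 1 = b)
    {x : (bvResolution O).Op n a} (hx : x ∈ bvTruncOp O n a) :
    (bvResolution O).d h x ∈ bvTruncOp O n b := by
  have L := bvResolution_isDGOperad O
  have ht : (bvResolution O).d (zero_add 1) (bvT O) = 0 := BVOp.sound .d_t
  refine ⟨?_, fun j => ?_⟩
  · have := L.d_comp 0 (Nat.zero_add n) (zero_add a) (zero_add 1) h h
      (by rw [add_comm, h]) (zero_add b) (bvT O) x
    rw [hx.1, ht, map_zero, LinearMap.zero_apply, zero_add, ksign_zero_right, one_smul] at this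
    exact this.symm
  · have := L.d_comp j (Nat.add_zero n) (add_zero a) h (zero_add 1) h (add_zero b) h x (bvT O)
    rw [hx.2, ht, map_zero, smul_zero, add_zero] at this
    exact this.symm

end Truncation

/-- The dg operad `bv O`, the truncation of `BV O` by the idempotent `t`. Its unit is `t`. -/
def bvTruncation {k : Type u} [Field k] (O : DGOperadData.{u, v} k) :
    DGOperadData.{u, max u v} k where
  Op n a := bvTruncOp O n a
  one := ⟨bvT O, bvT_mem⟩
  comp i h hg := LinearMap.mk₂ k
    (fun x y => ⟨(bvResolution O).comp i h hg x.1 y.1, comp_mem_bvTruncOp i h hg x.2 y.2⟩)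
    (fun x x' y => Subtype.ext (by simp))
    (fun r x y => Subtype.ext (by simp))
    (fun x y y' => Subtype.ext (by simp))
    (fun r x y => Subtype.ext (by simp))
  act σ := ((bvResolution O).act σ).restrict fun _ hx => act_mem_bvTruncOp σ hx
  d h := ((bvResolution O).d h).restrict fun _ hx => d_mem_bvTruncOp h hx

/-- `i : bv O → BV O`, the inclusion. (It does not preserve the unit.) -/
def bvInclusion {k : Type u} [Field k] (O : DGOperadData.{u, v} k) :
    DGOperadHom (bvTruncation O) (bvResolution O) where
  app := Submodule.subtype _
  map_comp _ _ _ _ _ := rfl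
  map_act _ _ := rfl
  map_d _ _ := rfl

/-! ### Hodge decompositions -/

/-- A Hodge decomposition of a dg vector space. -/
structure HodgeDecomposition {k : Type u} [Field k] (V : DGSpace.{u, w} k) where
  s : V.carrier →ₗ[k] V.carrier
  t : V.carrier →ₗ[k] V.carrier
  s_odd : ∀ (a : ZMod 2) (x : V.carrier), x ∈ V.deg a → s x ∈ V.deg (a + 1)
  t_even : ∀ (a : ZMod 2) (x : V.carrier), x ∈ V.deg a → t x ∈ V.deg (a + 0)
  s_s : ∀ x, s (s x) = 0
  t_t : ∀ x, t (t x) = t x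
  d_t : ∀ x, V.d (t x) = t (V.d x)
  s_t : ∀ x, s (t x) = 0
  t_s : ∀ x, t (s x) = 0
  homotopy : ∀ x, V.d (s x) + s (V.d x) = x - t x

/-- `h : BV O → E(V)` is the map determined by an `O`-algebra structure `f` on `V` and a Hodge
decomposition of `V`: it is `f` on `O` and sends `s`, `t` to the two operators. -/
structure HodgeDecomposition.Determines {k : Type u} [Field k] {V : DGSpace.{u, w} k}
    (H : HodgeDecomposition V) {O : DGOperadData.{u, v} k} (f : DGOperadHom O V.endOperad)
    (h : DGOperadHom (bvResolution O) V.endOperad) : Prop where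
  isUnital : h.IsUnital
  on_operad : ∀ (n : ℕ) (a : ZMod 2) (x : O.Op n a), h.app ((bvOf O).app x) = f.app x
  on_s : h.app (bvS O) = ⟨V.ofLinear H.s, V.ofLinear_mem H.s_odd⟩
  on_t : h.app (bvT O) = ⟨V.ofLinear H.t, V.ofLinear_mem H.t_even⟩

/-- `g` is the (unital) `bv O`-algebra structure corresponding to `h ∘ i`: it agrees with `h ∘ i` in
all arities `≥ 2`, and the unit of `bv O` acts by the identity of `V`. -/
structure IsBvAlgebraOf {k : Type u} [Field k] {V : DGSpace.{u, w} k}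
    {O : DGOperadData.{u, v} k} (h : DGOperadHom (bvResolution O) V.endOperad)
    (g : DGOperadHom (bvTruncation O) V.endOperad) : Prop where
  isUnital : g.IsUnital
  app_eq : ∀ (n : ℕ) (a : ZMod 2) (x : (bvTruncation O).Op n a), 1 ≤ n →
    g.app x = h.app ((bvInclusion O).app x)

/-! ### Signs -/

section Signs

variable {k : Type u} [Field k]

/-! Hodge decompositions of V do not form a convex set: the relations s² = 0 and t² = t are not
linear, so the two of them cannot be joined by a segment. The remedy is to enlarge V by a
contractible summand, fix s and t there once and for all, and let the O-algebra structure move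
instead.

Let W = V ⊕ C, where C = V ⊕ V[1] is the cone of the identity of V, with elements (x, u, w). The
projection t onto V and the contraction s(x, u, w) = (0, 0, u) of C satisfy the relations of `BV O`
(`thick_bvRelations`). There are no relations between s, t and O, so every unital O-algebra
structure on W extends to a `BV O`-structure with these s and t (`bvLift`). Since the image of t is
V, truncation gives a `bv O`-structure on V (`restrictHom`). Its unit t acts on V by the identity,
as a unital structure requires.

The O-structure on W starts as f on V in arities ≥ 2 and scalars in arity one (`extendHom`; this is
where O(1) = k·1 matters). It is then conjugated by an automorphism of the dg space W. For any odd
operator S, the map (u, w) ↦ S u from C to V has as its boundary a chain map P from C to V, and no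
condition on S² or on an idempotent is needed. The conjugating automorphism is (1 - P)(1 + ι)(1 -
P), with ι the inclusion of V as the u-summand of C. Because S enters linearly into P, it can be
replaced by the segment (1 - z)S₁ + zS₂ with coefficients in k[z, dz]. This gives a map `BV O` →
E(W) ⊗ k[z, dz] (`pathShear`), and its restriction to V is the required homotopy.

It remains to identify the ends. When S belongs to a Hodge decomposition (S, T), P(u, w) = u - T u +
S w, and the conjugated operations of arity ≥ 2 are z ↦ lift(f(retract z)) with retract(x, u, w) = T
x - P(u, w) and lift(y) = (T y, -y, 0) (`value_evalHom_pathShear`). The chain map `retract`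
intertwines s, t and O on W with S, T and O on V, hence all of `BV O` (`compatible_retract`). In
arities ≥ 2 all values on W have first component in the image of T (`value_mem_harmonic`). On a
truncated operation these two facts together give exactly the operation of V determined by the Hodge
decomposition (`transfer_app_eq`).

The preliminary parts show that E(V) and its tensor product with k[z, dz] satisfy the laws of a dg
operad, Koszul signs included. -/

theorem zmod_two_cases (a : ZMod 2) : a = 0 ∨ a = 1 := by
  revert a; decide

theorem ksign_eq_mul (a b : ZMod 2) : ksign k a b = ksign k 1 (a * b) := by
  rcases zmod_two_cases a with rfl | rfl <;> rcases zmod_two_cases b with rfl | rfl <;>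
    simp [ksign, ZMod.val_one]

theorem ksign_comm (a b : ZMod 2) : ksign k a b = ksign k b a := by
  rw [ksign, ksign, mul_comm]

theorem ksign_one_one : ksign k 1 1 = -1 := by simp [ksign, ZMod.val_one]

theorem ksign_add_right (a b c : ZMod 2) : ksign k a (b + c) = ksign k a b * ksign k a c := by
  rcases zmod_two_cases a with rfl | rfl <;> rcases zmod_two_cases b with rfl | rfl <;>
    rcases zmod_two_cases c with rfl | rfl <;>
    simp [ksign, ZMod.val_one, show (1 : ZMod 2) + 1 = 0 from rfl]

theorem ksign_add_left (a b c : ZMod 2) : ksign k (a + b) c = ksign k a c * ksign k b c := by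
  rw [ksign_comm, ksign_add_right, ksign_comm c a, ksign_comm c b]

theorem ksign_mul_self (a b : ZMod 2) : ksign k a b * ksign k a b = 1 := by
  rw [← ksign_add_right, CharTwo.add_self_eq_zero, ksign_zero_right]

theorem ksign_sum {ι : Type*} (s : Finset ι) (a : ZMod 2) (f : ι → ZMod 2) :
    ksign k a (∑ i ∈ s, f i) = ∏ i ∈ s, ksign k a (f i) := by
  classical
  induction s using Finset.induction_on with
  | empty => simp [ksign_zero_right]
  | insert i s hi ih => rw [Finset.sum_insert hi, Finset.prod_insert hi, ksign_add_right, ih]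

/-- The exponent of the sign of a reordering. -/
def reorderExp {n : ℕ} (σ : Equiv.Perm (Fin (n + 1))) (a : Fin (n + 1) → ZMod 2) : ZMod 2 :=
  ∑ p, ∑ q, if p < q ∧ σ q < σ p then a (σ p) * a (σ q) else 0

theorem reorderSign_eq {n : ℕ} (σ : Equiv.Perm (Fin (n + 1))) (a : Fin (n + 1) → ZMod 2) :
    (DGSpace.reorderSign σ a : k) = ksign k 1 (reorderExp σ a) := by
  rw [DGSpace.reorderSign, reorderExp, ksign_sum]
  refine Finset.prod_congr rfl fun p _ => ?_
  rw [ksign_sum]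
  refine Finset.prod_congr rfl fun q _ => ?_
  split
  · rw [ksign_eq_mul]
  · rw [ksign_zero_right]

theorem reorderExp_one {n : ℕ} (a : Fin (n + 1) → ZMod 2) : reorderExp 1 a = 0 := by
  refine Finset.sum_eq_zero fun p _ => Finset.sum_eq_zero fun q _ => if_neg ?_
  rintro ⟨h, h'⟩
  exact lt_asymm h h'

/-- Collects a double sum by unordered pairs, so that the contributions of (p, q) and (q, p) can be
compared or cancelled pair by pair. -/
theorem sum_pairs_eq {ι M : Type*} [Fintype ι] [LinearOrder ι] [AddCommMonoid M]
    (f : ι → ι → M) (hf : ∀ p, f p p = 0) :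
    ∑ p, ∑ q, f p q = ∑ p, ∑ q, if p < q then f p q + f q p else 0 := by
  have h₁ : ∀ p q, f p q = (if p < q then f p q else 0) + if q < p then f p q else 0 := by
    intro p q
    rcases lt_trichotomy p q with h | h | h
    · simp [h, h.not_gt]
    · subst h; simp [hf]
    · simp [h, h.not_gt]
  have h₂ : ∑ p, ∑ q, (if q < p then f p q else 0) = ∑ p, ∑ q, if p < q then f q p else 0 :=
    Finset.sum_comm
  calc ∑ p, ∑ q, f p q
      = ∑ p, ∑ q, ((if p < q then f p q else 0) + if q < p then f p q else 0) :=
        Finset.sum_congr rfl fun p _ => Finset.sum_congr rfl fun q _ => h₁ p q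
    _ = (∑ p, ∑ q, if p < q then f p q else 0) + ∑ p, ∑ q, if p < q then f q p else 0 := by
        rw [← h₂]; simp only [Finset.sum_add_distrib]
    _ = _ := by
        simp only [← Finset.sum_add_distrib]
        refine Finset.sum_congr rfl fun p _ => Finset.sum_congr rfl fun q _ => ?_
        split <;> simp

/-- A pair is inverted by `σ * τ` exactly when it is inverted by one, and only one, of τ and (after
applying τ) σ. A pair inverted by both contributes twice, which is zero mod 2. -/
theorem reorderExp_mul {n : ℕ} (σ τ : Equiv.Perm (Fin (n + 1))) (a : Fin (n + 1) → ZMod 2) :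
    reorderExp (σ * τ) a = reorderExp σ a + reorderExp τ (a ∘ σ) := by
  have h : reorderExp σ a = ∑ p, ∑ q, if τ p < τ q ∧ σ (τ q) < σ (τ p) then
      a (σ (τ p)) * a (σ (τ q)) else 0 := by
    rw [reorderExp, ← Equiv.sum_comp τ]
    exact Finset.sum_congr rfl fun p _ => (Equiv.sum_comp τ _).symm
  -- The inversions of σ have been reindexed by τ, so all three sums now run over the same unordered
  -- pairs.
  rw [h, reorderExp, reorderExp, sum_pairs_eq (fun p q => ite _ _ _) (fun p => by simp),
    sum_pairs_eq (fun p q => if τ p < τ q ∧ _ then _ else _) (fun p => by simp),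
    sum_pairs_eq (fun p q => if p < q ∧ τ q < τ p then _ else _) (fun p => by simp),
    ← Finset.sum_add_distrib]
  refine Finset.sum_congr rfl fun p _ => ?_
  rw [← Finset.sum_add_distrib]
  refine Finset.sum_congr rfl fun q _ => ?_
  by_cases hpq : p < q
  · have h₁ : τ p ≠ τ q := τ.injective.ne hpq.ne
    have h₂ : σ (τ p) ≠ σ (τ q) := σ.injective.ne h₁
    simp only [hpq, hpq.not_gt, if_true, true_and, false_and, if_false, add_zero,
      Equiv.Perm.mul_apply, Function.comp]
    have hm : a (σ (τ q)) * a (σ (τ p)) = a (σ (τ p)) * a (σ (τ q)) := mul_comm _ _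
    rw [hm]
    rcases lt_or_gt_of_ne h₁ with h₁ | h₁ <;> rcases lt_or_gt_of_ne h₂ with h₂ | h₂ <;>
      simp [h₁, h₂, h₁.not_gt, h₂.not_gt, CharTwo.add_self_eq_zero]
  · simp [hpq]

theorem leafIn_lt_leafIn {m n l : ℕ} (i : Fin (m + 1)) (h : m + n = l) (q q' : Fin (n + 1)) :
    leafIn i h q < leafIn i h q' ↔ q < q' := by
  simp only [leafIn, Fin.lt_def]; omega

theorem leafOut_lt_leafOut {m n l : ℕ} (i : Fin (m + 1)) (h : m + n = l) (p p' : Fin (m + 1)) :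
    leafOut i h p < leafOut i h p' ↔ p < p' := by
  simp only [leafOut, Fin.lt_def]; split <;> split <;> omega

theorem leafOut_lt_leafIn {m n l : ℕ} (i : Fin (m + 1)) (h : m + n = l) (q : Fin (n + 1))
    {p : Fin (m + 1)} (hp : p ≠ i) : leafOut i h p < leafIn i h q ↔ p < i := by
  have := fun e => hp (Fin.ext e)
  have := q.isLt
  simp only [leafIn, leafOut, Fin.lt_def]; split <;> omega

theorem leafIn_lt_leafOut {m n l : ℕ} (i : Fin (m + 1)) (h : m + n = l) (q : Fin (n + 1))
    {p : Fin (m + 1)} (hp : p ≠ i) : leafIn i h q < leafOut i h p ↔ i < p := by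
  have := fun e => hp (Fin.ext e)
  have := q.isLt
  simp only [leafIn, leafOut, Fin.lt_def]; split <;> omega

/-- The parities of the arguments of the outer operation of a composition at place `i`. -/
def compParity {m n l : ℕ} (i : Fin (m + 1)) (h : m + n = l) (b : ZMod 2)
    (a : Fin (l + 1) → ZMod 2) (p : Fin (m + 1)) : ZMod 2 :=
  if p = i then b + ∑ q, a (leafIn (n := n) i h q) else a (leafOut i h p)

/-- This is the sign identity behind the equivariance of composition in E(V). The inner operation,
of parity b, and its inputs, of total parity S, travel as one block of parity b + S. The extra sums
record the sign of moving the inner operation past the outer inputs before it. -/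
theorem reorderExp_comp {m n l : ℕ} (i : Fin (m + 1)) (h : m + n = l)
    (σ : Equiv.Perm (Fin (m + 1))) (τ : Equiv.Perm (Fin (n + 1))) (ρ : Equiv.Perm (Fin (l + 1)))
    (hin : ∀ q, ρ (leafIn i h q) = leafIn (σ i) h (τ q))
    (hout : ∀ p, p ≠ i → ρ (leafOut i h p) = leafOut (σ i) h (σ p))
    (b : ZMod 2) (a : Fin (l + 1) → ZMod 2) :
    (∑ p, if p < σ i then b * a (leafOut (σ i) h p) else 0) +
        reorderExp σ (compParity (σ i) h b a) + reorderExp τ (fun q => a (leafIn (σ i) h q)) =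
      reorderExp ρ a + ∑ p, if p < i then b * a (ρ (leafOut i h p)) else 0 := by
  set S := ∑ q, a (leafIn (n := n) (σ i) h q) with hS
  set c : Fin (m + 1) → ZMod 2 := fun p => a (leafOut (σ i) h (σ p)) with hc
  have hne : ∀ p ∈ Finset.univ.erase i, p ≠ i := fun p hp => Finset.ne_of_mem_erase hp
  have hSτ : ∑ q, a (ρ (leafIn (n := n) i h q)) = S := by
    rw [hS, ← Equiv.sum_comp τ fun q => a (leafIn (σ i) h q)]
    exact Finset.sum_congr rfl fun q _ => by rw [hin]
  have hB : ∀ p, p ≠ i → compParity (σ i) h b a (σ p) = c p := fun p hp =>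
    if_neg (σ.injective.ne hp)
  have hBi : compParity (σ i) h b a (σ i) = b + S := if_pos rfl
  have e₁ : (∑ p, if p < σ i then b * a (leafOut (σ i) h p) else 0) =
      ∑ p ∈ Finset.univ.erase i, if σ p < σ i then b * c p else 0 := by
    rw [← Equiv.sum_comp σ, ← Finset.add_sum_erase _ _ (Finset.mem_univ i),
      if_neg (lt_irrefl _), zero_add]
  have e₂ : (∑ p, if p < i then b * a (ρ (leafOut i h p)) else 0) =
      ∑ p ∈ Finset.univ.erase i, if p < i then b * c p else 0 := by
    rw [← Finset.add_sum_erase _ _ (Finset.mem_univ i), if_neg (lt_irrefl _), zero_add]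
    exact Finset.sum_congr rfl fun p hp => by rw [hout p (hne p hp)]
  have e₃ : reorderExp σ (compParity (σ i) h b a) =
      (∑ p ∈ Finset.univ.erase i, ∑ q ∈ Finset.univ.erase i,
        if p < q ∧ σ q < σ p then c p * c q else 0) +
      ∑ p ∈ Finset.univ.erase i, ((if p < i ∧ σ i < σ p then c p * (b + S) else 0) +
        if i < p ∧ σ p < σ i then c p * (b + S) else 0) := by
    rw [reorderExp, ← Finset.add_sum_erase _ _ (Finset.mem_univ i),
      ← Finset.add_sum_erase _ _ (Finset.mem_univ i), if_neg (by simp), zero_add,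
      ← Finset.sum_add_distrib, ← Finset.sum_add_distrib]
    refine Finset.sum_congr rfl fun p hp => ?_
    have h₁ : (∑ q ∈ Finset.univ.erase i, if p < q ∧ σ q < σ p then
        compParity (σ i) h b a (σ p) * compParity (σ i) h b a (σ q) else 0) =
        ∑ q ∈ Finset.univ.erase i, if p < q ∧ σ q < σ p then c p * c q else 0 :=
      Finset.sum_congr rfl fun q hq => by rw [hB q (hne q hq), hB p (hne p hp)]
    rw [← Finset.add_sum_erase _ _ (Finset.mem_univ i), hBi, hB p (hne p hp), ← h₁,
      hB p (hne p hp), mul_comm (b + S)]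
    abel
  -- Inversions of ρ are sorted by where the two leaves come from: both outer, one outer and one
  -- inner, or both inner. The mixed ones see only S, since ρ permutes inputs and not the inner
  -- operation.
  have e₄ : reorderExp ρ a =
      (∑ p ∈ Finset.univ.erase i, ∑ q ∈ Finset.univ.erase i,
        if p < q ∧ σ q < σ p then c p * c q else 0) +
      (∑ p ∈ Finset.univ.erase i, ((if p < i ∧ σ i < σ p then c p * S else 0) +
        if i < p ∧ σ p < σ i then c p * S else 0)) +
      reorderExp τ (fun q => a (leafIn (σ i) h q)) := by
    rw [reorderExp, sum_leaves i h, Finset.sum_add_distrib, ← add_assoc,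
      ← Finset.sum_add_distrib]
    have f₁ : ∀ p ∈ Finset.univ.erase i, (∑ r, if leafOut i h p < r ∧ ρ r < ρ (leafOut i h p)
        then a (ρ (leafOut i h p)) * a (ρ r) else 0) =
        (∑ q ∈ Finset.univ.erase i, if p < q ∧ σ q < σ p then c p * c q else 0) +
          if p < i ∧ σ i < σ p then c p * S else 0 := by
      intro p hp
      rw [sum_leaves i h]
      congr 1
      · refine Finset.sum_congr rfl fun q hq => ?_
        simp only [hout p (hne p hp), hout q (hne q hq), leafOut_lt_leafOut, hc]
      · simp only [hout p (hne p hp), hin, leafOut_lt_leafIn i h _ (hne p hp),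
          leafIn_lt_leafOut _ h _ (σ.injective.ne (hne p hp))]
        split
        · rw [← hSτ, Finset.mul_sum]
          exact Finset.sum_congr rfl fun q _ => by rw [hin]
        · exact Finset.sum_const_zero
    have f₂ : ∑ q : Fin (n + 1), (∑ r, if leafIn i h q < r ∧ ρ r < ρ (leafIn i h q)
        then a (ρ (leafIn i h q)) * a (ρ r) else 0) =
        (∑ p ∈ Finset.univ.erase i, if i < p ∧ σ p < σ i then c p * S else 0) +
          reorderExp τ (fun q => a (leafIn (σ i) h q)) := by
      have : ∀ q : Fin (n + 1), (∑ r, if leafIn i h q < r ∧ ρ r < ρ (leafIn i h q)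
          then a (ρ (leafIn i h q)) * a (ρ r) else 0) =
          (∑ p ∈ Finset.univ.erase i, if i < p ∧ σ p < σ i then
            c p * a (ρ (leafIn i h q)) else 0) +
          ∑ q', if q < q' ∧ τ q' < τ q then a (leafIn (σ i) h (τ q)) * a (leafIn (σ i) h (τ q'))
            else 0 := by
        intro q
        rw [sum_leaves i h]
        congr 1
        · refine Finset.sum_congr rfl fun p hp => ?_
          simp only [hout p (hne p hp), hin, leafIn_lt_leafOut i h q (hne p hp),
            leafOut_lt_leafIn _ h _ (σ.injective.ne (hne p hp)), hc, mul_comm]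
        · refine Finset.sum_congr rfl fun q' _ => ?_
          simp only [hin, leafIn_lt_leafIn]
      rw [Finset.sum_congr rfl fun q _ => this q, Finset.sum_add_distrib, Finset.sum_comm]
      congr 1
      refine Finset.sum_congr rfl fun p _ => ?_
      rw [← hSτ, Finset.mul_sum]
      split
      · rfl
      · exact Finset.sum_const_zero
    rw [Finset.sum_congr rfl f₁, f₂, Finset.sum_add_distrib]
    abel
  -- After the common terms are removed, this is one identity for each outer leaf p ≠ i: mod 2, [σ p
  -- < σ i] plus [σ inverts p and i] equals [p < i].
  have key : (∑ p ∈ Finset.univ.erase i, if σ p < σ i then b * c p else 0) +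
      (∑ p ∈ Finset.univ.erase i, ((if p < i ∧ σ i < σ p then c p * (b + S) else 0) +
        if i < p ∧ σ p < σ i then c p * (b + S) else 0)) =
      (∑ p ∈ Finset.univ.erase i, ((if p < i ∧ σ i < σ p then c p * S else 0) +
        if i < p ∧ σ p < σ i then c p * S else 0)) +
      ∑ p ∈ Finset.univ.erase i, if p < i then b * c p else 0 := by
    rw [← Finset.sum_add_distrib, ← Finset.sum_add_distrib]
    refine Finset.sum_congr rfl fun p hp => ?_
    have h₁ := hne p hp
    have h₂ := σ.injective.ne h₁
    have h₃ : b * c p + c p * (b + S) = c p * S := by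
      rw [mul_add, mul_comm b, ← add_assoc, CharTwo.add_self_eq_zero, zero_add]
    rcases lt_or_gt_of_ne h₁ with h₁ | h₁ <;> rcases lt_or_gt_of_ne h₂ with h₂ | h₂ <;>
      simp [h₁, h₂, h₁.not_gt, h₂.not_gt, h₃]
    ring
  rw [e₁, e₂, e₃, e₄]
  linear_combination key

end Signs

/-! ### The laws of the endomorphism operad -/

namespace DGSpace

variable {k : Type u} [Field k] (V : DGSpace.{u, v} k)

theorem proj_sum (x : V.carrier) : ∑ a : ZMod 2, V.proj a x = x := by
  classical
  have h := DirectSum.sum_support_decompose V.deg x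
  rw [Finset.sum_subset (Finset.subset_univ _)] at h
  · exact h
  · intro i _ hi
    rw [DFinsupp.notMem_support_iff.mp hi, ZeroMemClass.coe_zero]

variable {V}

/-- Multilinear maps are determined by their values on homogeneous arguments. -/
theorem multi_ext {n : ℕ} {M : Type*} [AddCommGroup M] [Module k M]
    {f g : MultilinearMap k (fun _ : Fin (n + 1) => V.carrier) M}
    (h : ∀ (a : Fin (n + 1) → ZMod 2) (x : Fin (n + 1) → V.carrier),
      (∀ j, x j ∈ V.deg (a j)) → f x = g x) : f = g := by
  classical
  ext x
  have hx : x = fun j => ∑ a : ZMod 2, V.proj a (x j) := by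
    funext j; rw [V.proj_sum]
  rw [hx, f.map_sum, g.map_sum]
  exact Finset.sum_congr rfl fun a _ => h a _ fun j => V.proj_mem _ _

theorem linear_ext {φ ψ : V.carrier →ₗ[k] V.carrier}
    (h : ∀ a, ∀ x ∈ V.deg a, φ x = ψ x) : φ = ψ := by
  ext x
  rw [← V.proj_sum x, map_sum, map_sum]
  exact Finset.sum_congr rfl fun a _ => h a _ (V.proj_mem _ _)

theorem twist_zero : V.twist 0 = LinearMap.id :=
  linear_ext fun a x hx => by rw [V.twist_of_mem hx, ksign_zero_left, one_smul]; rfl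

theorem twist_twist (b c : ZMod 2) (x : V.carrier) :
    V.twist b (V.twist c x) = V.twist (b + c) x := by
  have : V.twist b ∘ₗ V.twist c = V.twist (b + c) := linear_ext fun a x hx => by
    rw [LinearMap.comp_apply, V.twist_of_mem (V.twist_mem hx c), V.twist_of_mem hx,
      V.twist_of_mem hx, smul_smul, ksign_add_left]
  exact LinearMap.congr_fun this x

theorem twist_apply {n : ℕ} {b : ZMod 2} {f : V.Multi n} (hf : f ∈ V.endOp n b) (c : ZMod 2)
    (x : Fin (n + 1) → V.carrier) :
    V.twist c (f x) = ksign k b c • f fun j => V.twist c (x j) := by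
  have : (V.twist c).compMultilinearMap f =
      ksign k b c • f.compLinearMap fun _ => V.twist c := multi_ext fun a x hx => by
    rw [LinearMap.compMultilinearMap_apply, V.twist_of_mem (hf a x hx)]
    have : (fun j => V.twist c (x j)) = fun j => ksign k c (a j) • x j :=
      funext fun j => V.twist_of_mem (hx j) c
    rw [_root_.smul_apply, MultilinearMap.compLinearMap_apply, this, f.map_smul_univ,
      smul_smul, ksign_add_right, ksign_sum, ksign_comm]
  exact congrArg (fun g : V.Multi n => g x) this

/-- The arguments of the outer operation in a composition, with the Koszul signs. -/
noncomputable def signedArg {m n l : ℕ} (b : ZMod 2) (i : Fin (m + 1)) (h : m + n = l)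
    (g : V.Multi n) (x : Fin (l + 1) → V.carrier) (p : Fin (m + 1)) : V.carrier :=
  if p < i then V.twist b (x (leafOut i h p))
  else if p = i then g (fun q => x (leafIn i h q)) else x (leafOut i h p)

theorem comp_apply {m n l : ℕ} {a b c : ZMod 2} (i : Fin (m + 1)) (h : m + n = l)
    (hg : a + b = c) (f : V.endOp m a) (g : V.endOp n b) (x : Fin (l + 1) → V.carrier) :
    (V.endOperad.comp i h hg f g : V.endOp l c).1 x = f.1 (signedArg b i h g.1 x) := by
  change f.1 (fun p => (if p < i then V.twist b else if p = i then LinearMap.id else LinearMap.id)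
    (compArg i h g.1 x p)) = _
  congr 1
  funext p
  rcases lt_trichotomy p i with hp | hp | hp
  · simp [signedArg, compArg, hp, hp.ne]
  · simp [signedArg, compArg, hp]
  · simp [signedArg, compArg, hp.not_gt, hp.ne']

theorem signedArg_zero {m n l : ℕ} (i : Fin (m + 1)) (h : m + n = l)
    (g : V.Multi n) (x : Fin (l + 1) → V.carrier) : signedArg 0 i h g x = compArg i h g x := by
  funext p
  rcases lt_trichotomy p i with hp | hp | hp
  · simp [signedArg, compArg, hp, hp.ne, twist_zero]
  · simp [signedArg, compArg, hp]
  · simp [signedArg, compArg, hp.not_gt, hp.ne']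

theorem act_apply_of_mem {n : ℕ} {g : ZMod 2} (σ : Equiv.Perm (Fin (n + 1))) (f : V.endOp n g)
    (a : Fin (n + 1) → ZMod 2) (x : Fin (n + 1) → V.carrier) (hx : ∀ j, x j ∈ V.deg (a j)) :
    (V.endOperad.act σ f : V.endOp n g).1 x =
      ksign k 1 (reorderExp σ a) • f.1 fun p => x (σ p) := by
  rw [← reorderSign_eq]
  exact permute_of_mem σ f.1 a x hx

theorem compArg_mem {m n l : ℕ} (i : Fin (m + 1)) (h : m + n = l) {b : ZMod 2} {g : V.Multi n}
    (hg : g ∈ V.endOp n b) {a : Fin (l + 1) → ZMod 2} {x : Fin (l + 1) → V.carrier}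
    (hx : ∀ j, x j ∈ V.deg (a j)) (p : Fin (m + 1)) :
    compArg i h g x p ∈ V.deg (compParity (n := n) i h b a p) := by
  by_cases hp : p = i
  · simp only [compArg, compParity, if_pos hp]
    exact hg _ _ fun q => hx _
  · simp only [compArg, compParity, if_neg hp]
    exact hx _

theorem comp_apply_of_mem {m n l : ℕ} {a b c : ZMod 2} (i : Fin (m + 1)) (h : m + n = l)
    (hg : a + b = c) (f : V.endOp m a) (g : V.endOp n b) (e : Fin (l + 1) → ZMod 2)
    (x : Fin (l + 1) → V.carrier) (hx : ∀ j, x j ∈ V.deg (e j)) :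
    (V.endOperad.comp i h hg f g : V.endOp l c).1 x =
      ksign k 1 (∑ p, if p < i then b * e (leafOut i h p) else 0) •
        f.1 (compArg i h g.1 x) := by
  have : signedArg b i h g.1 x = fun p =>
      ksign k 1 (if p < i then b * e (leafOut i h p) else 0) • compArg i h g.1 x p := by
    funext p
    rcases lt_trichotomy p i with hp | hp | hp
    · simp only [signedArg, compArg, hp, hp.ne, if_true, if_false]
      rw [V.twist_of_mem (hx _), ksign_eq_mul]
    · simp [signedArg, compArg, hp, ksign_zero_right]
    · simp [signedArg, compArg, hp.not_gt, hp.ne', ksign_zero_right]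
  rw [comp_apply, this, f.1.map_smul_univ, ksign_sum]

theorem end_one_comp {n : ℕ} {a : ZMod 2} (x : V.endOp n a) :
    V.endOperad.comp 0 (Nat.zero_add n) (zero_add a) V.endOperad.one x = x := by
  refine Subtype.ext (MultilinearMap.ext fun v => ?_)
  erw [comp_apply]
  change signedArg a 0 (Nat.zero_add n) x.1 v 0 = x.1 v
  simp [signedArg, leafIn_zero_add]

theorem end_comp_one {n : ℕ} {a : ZMod 2} (i : Fin (n + 1)) (x : V.endOp n a) :
    V.endOperad.comp i (Nat.add_zero n) (add_zero a) x V.endOperad.one = x := by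
  refine Subtype.ext (MultilinearMap.ext fun v => ?_)
  erw [comp_apply]
  congr 1
  funext p
  rw [signedArg_zero]
  change (if p = i then v (leafIn i _ 0) else v (leafOut i _ p)) = _
  rw [leafIn_add_zero, leafOut_add_zero]
  split
  · next h => rw [h]
  · rfl

theorem leafIn_leafIn {m n p mn np l : ℕ} (i : Fin (m + 1)) (j : Fin (n + 1)) (h₁ : m + n = mn)
    (h₂ : mn + p = l) (h₃ : n + p = np) (h₄ : m + np = l) (q : Fin (p + 1)) :
    leafIn (leafIn i h₁ j) h₂ q = leafIn i h₄ (leafIn j h₃ q) :=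
  Fin.ext (by simp only [leafIn]; omega)

theorem leafOut_leafIn {m n p mn np l : ℕ} (i : Fin (m + 1)) (j : Fin (n + 1)) (h₁ : m + n = mn)
    (h₂ : mn + p = l) (h₃ : n + p = np) (h₄ : m + np = l) (q : Fin (n + 1)) :
    leafOut (leafIn i h₁ j) h₂ (leafIn i h₁ q) = leafIn i h₄ (leafOut j h₃ q) :=
  Fin.ext (by simp only [leafIn, leafOut, add_le_add_iff_left]; split <;> omega)

theorem leafOut_leafOut {m n p mn np l : ℕ} (i : Fin (m + 1)) (j : Fin (n + 1)) (h₁ : m + n = mn)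
    (h₂ : mn + p = l) (h₃ : n + p = np) (h₄ : m + np = l) (q : Fin (m + 1)) (hq : q ≠ i) :
    leafOut (leafIn i h₁ j) h₂ (leafOut i h₁ q) = leafOut i h₄ q := by
  have := fun e => hq (Fin.ext e)
  have := j.isLt
  refine Fin.ext ?_
  simp only [leafIn, leafOut]
  split <;> split <;> omega

theorem end_assoc_seq {m n p mn np l : ℕ} {a b c ab bc e : ZMod 2}
    (i : Fin (m + 1)) (j : Fin (n + 1)) (h₁ : m + n = mn) (h₂ : mn + p = l)
    (h₃ : n + p = np) (h₄ : m + np = l) (g₁ : a + b = ab) (g₂ : ab + c = e)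
    (g₃ : b + c = bc) (g₄ : a + bc = e) (x : V.endOp m a) (y : V.endOp n b) (z : V.endOp p c) :
    V.endOperad.comp (leafIn i h₁ j) h₂ g₂ (V.endOperad.comp i h₁ g₁ x y) z =
      V.endOperad.comp i h₄ g₄ x (V.endOperad.comp j h₃ g₃ y z) := by
  refine Subtype.ext (MultilinearMap.ext fun v => ?_)
  erw [comp_apply, comp_apply, comp_apply]
  congr 1
  funext r
  rcases lt_trichotomy r i with hr | hr | hr
  · have h := (leafOut_lt_leafIn i h₁ j hr.ne).mpr hr
    simp only [signedArg, hr, h, if_true]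
    rw [leafOut_leafOut i j h₁ h₂ h₃ h₄ r hr.ne, twist_twist, g₃]
  · subst hr
    rw [signedArg, if_neg (lt_irrefl _), if_pos rfl, signedArg, if_neg (lt_irrefl _), if_pos rfl]
    erw [comp_apply]
    congr 1
    funext q
    simp only [signedArg, leafIn_lt_leafIn, (leafIn_injective r h₁).eq_iff]
    simp only [leafOut_leafIn r j h₁ h₂ h₃ h₄, leafIn_leafIn r j h₁ h₂ h₃ h₄]
  · have h := (leafIn_lt_leafOut i h₁ j hr.ne').mpr hr
    simp only [signedArg, hr.not_gt, hr.ne', h.not_gt, h.ne', if_false]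
    rw [leafOut_leafOut i j h₁ h₂ h₃ h₄ r hr.ne']

/-- Both sides are x applied to the same tuple except in slot i. There one side twists the output of
y by the parity of z and the other twists the inputs of y. By `twist_apply` these differ by
(-1)^(|y||z|), and multilinearity of x extracts the sign. -/
theorem end_assoc_par {m n p mn mp l : ℕ} {a b c ab ac e : ZMod 2}
    (i j : Fin (m + 1)) (hij : i < j) (h₁ : m + n = mn) (h₂ : mn + p = l)
    (h₃ : m + p = mp) (h₄ : mp + n = l) (g₁ : a + b = ab) (g₂ : ab + c = e)
    (g₃ : a + c = ac) (g₄ : ac + b = e) (x : V.endOp m a) (y : V.endOp n b) (z : V.endOp p c) :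
    V.endOperad.comp (leafOut i h₁ j) h₂ g₂ (V.endOperad.comp i h₁ g₁ x y) z =
      ksign k b c • V.endOperad.comp (leafOut j h₃ i) h₄ g₄ (V.endOperad.comp j h₃ g₃ x z) y := by
  refine Subtype.ext (MultilinearMap.ext fun v => ?_)
  change _ = ksign k b c • (V.endOperad.comp (leafOut j h₃ i) h₄ g₄
    (V.endOperad.comp j h₃ g₃ x z) y : V.endOp l e).1 v
  erw [comp_apply, comp_apply, comp_apply, comp_apply]
  set L : Fin (m + 1) → V.carrier :=
    signedArg b i h₁ y.1 (signedArg c (leafOut i h₁ j) h₂ z.1 v) with hL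
  set R : Fin (m + 1) → V.carrier :=
    signedArg c j h₃ z.1 (signedArg b (leafOut j h₃ i) h₄ y.1 v) with hR
  have hi : R i = ksign k b c • L i := by
    simp only [hL, hR]
    rw [signedArg, if_pos hij, signedArg, if_neg (lt_irrefl _), if_pos rfl, twist_apply y.2,
      signedArg, if_neg (lt_irrefl _), if_pos rfl]
    congr 2
    funext q
    rw [signedArg, if_pos ((leafIn_lt_leafOut i h₁ q hij.ne').mpr hij)]
    congr 2
    refine Fin.ext ?_
    have := q.isLt
    simp only [leafIn, leafOut, Fin.lt_def] at *
    split <;> split <;> split <;> omega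
  have hne : ∀ r, r ≠ i → R r = L r := by
    intro r hr
    have hr' := fun e => hr (Fin.ext e)
    rcases lt_trichotomy r j with hrj | hrj | hrj
    · have e₁ : leafOut i h₁ r < leafOut i h₁ j := (leafOut_lt_leafOut ..).mpr hrj
      have e₂ : leafOut (leafOut i h₁ j) h₂ (leafOut i h₁ r) =
          leafOut (leafOut j h₃ i) h₄ (leafOut j h₃ r) := by
        refine Fin.ext ?_
        simp only [leafOut, Fin.lt_def] at *
        split_ifs <;> omega
      rcases lt_or_gt_of_ne hr with hri | hri
      · have e₃ : leafOut j h₃ r < leafOut j h₃ i := (leafOut_lt_leafOut ..).mpr hri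
        simp only [hL, hR, signedArg, hrj, hri, e₁, e₃, if_true, e₂]
        rw [twist_twist, twist_twist, add_comm]
      · have e₃ : leafOut j h₃ i < leafOut j h₃ r := (leafOut_lt_leafOut ..).mpr hri
        simp only [hL, hR, signedArg, hrj, hri.not_gt, hr, e₁, e₃.not_gt, e₃.ne', if_true, if_false,
          e₂]
    · subst hrj
      simp only [hL, hR, signedArg, lt_irrefl, hij.not_gt, hr, if_true, if_false]
      congr 1
      funext q
      have e₃ : leafOut r h₃ i < leafIn r h₃ q := (leafOut_lt_leafIn _ _ _ hij.ne).mpr hij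
      rw [if_neg e₃.not_gt, if_neg e₃.ne']
      congr 1
      refine Fin.ext ?_
      have := q.isLt
      simp only [leafIn, leafOut, Fin.lt_def] at *
      split_ifs <;> omega
    · have e₁ : leafOut i h₁ j < leafOut i h₁ r := (leafOut_lt_leafOut ..).mpr hrj
      have hri : i < r := hij.trans hrj
      have e₃ : leafOut j h₃ i < leafOut j h₃ r := (leafOut_lt_leafOut ..).mpr hri
      simp only [hL, hR, signedArg, hrj.not_gt, hrj.ne', hri.not_gt, hri.ne', e₁.not_gt, e₁.ne',
        e₃.not_gt, e₃.ne', if_false]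
      congr 1
      refine Fin.ext ?_
      simp only [leafOut, Fin.lt_def] at *
      split_ifs <;> omega
  have hRL : R = Function.update L i (ksign k b c • L i) := by
    funext r
    by_cases hr : r = i
    · subst hr; rw [Function.update_self, hi]
    · rw [Function.update_of_ne hr, hne r hr]
  rw [hRL, x.1.map_update_smul, Function.update_eq_self, smul_smul, ksign_mul_self, one_smul]

theorem end_act_one {n : ℕ} {a : ZMod 2} (x : V.endOp n a) : V.endOperad.act 1 x = x :=
  Subtype.ext <| multi_ext fun e v hv => by
    erw [act_apply_of_mem 1 x e v hv]
    rw [reorderExp_one, ksign_zero_right, one_smul]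
    rfl

theorem end_act_mul {n : ℕ} {a : ZMod 2} (σ τ : Equiv.Perm (Fin (n + 1))) (x : V.endOp n a) :
    V.endOperad.act (σ * τ) x = V.endOperad.act σ (V.endOperad.act τ x) :=
  Subtype.ext <| multi_ext fun e v hv => by
    erw [act_apply_of_mem _ x e v hv, act_apply_of_mem σ _ e v hv,
      act_apply_of_mem τ x (e ∘ σ) _ fun j => hv (σ j)]
    rw [smul_smul, reorderExp_mul, ksign_add_right]
    rfl

theorem end_act_comp {m n l : ℕ} {a b c : ZMod 2} (i : Fin (m + 1)) (h : m + n = l)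
    (hg : a + b = c) (σ : Equiv.Perm (Fin (m + 1))) (τ : Equiv.Perm (Fin (n + 1)))
    (ρ : Equiv.Perm (Fin (l + 1)))
    (hin : ∀ q, ρ (leafIn i h q) = leafIn (σ i) h (τ q))
    (hout : ∀ p, p ≠ i → ρ (leafOut i h p) = leafOut (σ i) h (σ p))
    (x : V.endOp m a) (y : V.endOp n b) :
    V.endOperad.comp (σ i) h hg (V.endOperad.act σ x) (V.endOperad.act τ y) =
      V.endOperad.act ρ (V.endOperad.comp i h hg x y) :=
  Subtype.ext <| multi_ext fun e v hv => by
    -- The action of τ on y only puts a sign in slot i of x. Writing this as a `Function.update`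
    -- lets multilinearity pull that sign out, and what is left is `reorderExp_comp`.
    have key : (fun p => compArg (σ i) h (V.endOperad.act τ y : V.endOp n b).1 v (σ p)) =
        Function.update (compArg i h y.1 fun r => v (ρ r)) i
          (ksign k 1 (reorderExp τ fun q => e (leafIn (σ i) h q)) •
            compArg i h y.1 (fun r => v (ρ r)) i) := by
      funext p
      by_cases hp : p = i
      · subst hp
        rw [Function.update_self]
        simp only [compArg, if_true, hin]
        exact act_apply_of_mem τ y _ _ fun q => hv _
      · rw [Function.update_of_ne hp]
        simp only [compArg, hp, σ.injective.ne hp, if_false, hout p hp]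
    erw [comp_apply_of_mem (σ i) h hg _ _ e v hv,
      act_apply_of_mem σ x _ _ (compArg_mem (σ i) h (V.endOperad.act τ y).2 hv), key,
      x.1.map_update_smul, Function.update_eq_self, act_apply_of_mem ρ _ e v hv,
      comp_apply_of_mem i h hg x y _ _ fun j => hv (ρ j)]
    rw [smul_smul, smul_smul, smul_smul, ← ksign_add_right, ← ksign_add_right, ← ksign_add_right]
    congr 2
    exact reorderExp_comp i h σ τ ρ hin hout b e

end DGSpace

/-! ### Graded operads with an inner differential -/

/-- The laws of a unital graded operad: those of a unital dg operad which do not involve the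
differential. -/
structure DGOperadData.IsGradedOperad {k : Type u} [Field k] (P : DGOperadData.{u, v} k) :
    Prop where
  one_comp : ∀ {n : ℕ} {a : ZMod 2} (x : P.Op n a),
    P.comp 0 (Nat.zero_add n) (zero_add a) P.one x = x
  comp_one : ∀ {n : ℕ} {a : ZMod 2} (i : Fin (n + 1)) (x : P.Op n a),
    P.comp i (Nat.add_zero n) (add_zero a) x P.one = x
  assoc_seq : ∀ {m n p mn np l : ℕ} {a b c ab bc e : ZMod 2}
    (i : Fin (m + 1)) (j : Fin (n + 1)) (h₁ : m + n = mn) (h₂ : mn + p = l)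
    (h₃ : n + p = np) (h₄ : m + np = l) (g₁ : a + b = ab) (g₂ : ab + c = e)
    (g₃ : b + c = bc) (g₄ : a + bc = e) (x : P.Op m a) (y : P.Op n b) (z : P.Op p c),
    P.comp (leafIn i h₁ j) h₂ g₂ (P.comp i h₁ g₁ x y) z =
      P.comp i h₄ g₄ x (P.comp j h₃ g₃ y z)
  assoc_par : ∀ {m n p mn mp l : ℕ} {a b c ab ac e : ZMod 2}
    (i j : Fin (m + 1)) (_ : i < j) (h₁ : m + n = mn) (h₂ : mn + p = l)
    (h₃ : m + p = mp) (h₄ : mp + n = l) (g₁ : a + b = ab) (g₂ : ab + c = e)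
    (g₃ : a + c = ac) (g₄ : ac + b = e) (x : P.Op m a) (y : P.Op n b) (z : P.Op p c),
    P.comp (leafOut i h₁ j) h₂ g₂ (P.comp i h₁ g₁ x y) z =
      ksign k b c • P.comp (leafOut j h₃ i) h₄ g₄ (P.comp j h₃ g₃ x z) y
  act_one : ∀ {n : ℕ} {a : ZMod 2} (x : P.Op n a), P.act 1 x = x
  act_mul : ∀ {n : ℕ} {a : ZMod 2} (σ τ : Equiv.Perm (Fin (n + 1))) (x : P.Op n a),
    P.act (σ * τ) x = P.act σ (P.act τ x)
  act_comp : ∀ {m n l : ℕ} {a b c : ZMod 2} (i : Fin (m + 1)) (h : m + n = l) (hg : a + b = c)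
    (σ : Equiv.Perm (Fin (m + 1))) (τ : Equiv.Perm (Fin (n + 1)))
    (ρ : Equiv.Perm (Fin (l + 1)))
    (_ : ∀ q, ρ (leafIn i h q) = leafIn (σ i) h (τ q))
    (_ : ∀ p, p ≠ i → ρ (leafOut i h p) = leafOut (σ i) h (σ p))
    (x : P.Op m a) (y : P.Op n b),
    P.comp (σ i) h hg (P.act σ x) (P.act τ y) = P.act ρ (P.comp i h hg x y)

namespace DGOperadData

variable {k : Type u} [Field k] {P : DGOperadData.{u, v} k}

theorem IsDGOperad.isGradedOperad (L : P.IsDGOperad) : P.IsGradedOperad where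
  one_comp := L.one_comp
  comp_one := L.comp_one
  assoc_seq := L.assoc_seq
  assoc_par := L.assoc_par
  act_one := L.act_one
  act_mul := L.act_mul
  act_comp := L.act_comp

namespace IsGradedOperad

variable (L : P.IsGradedOperad)
include L

/-- Grafting an operation with one input onto a leaf of the outer operation of a composition. -/
theorem comp_leafOut {m n l : ℕ} {a b c r ar cr : ZMod 2} (i p : Fin (m + 1)) (hp : p ≠ i)
    (h : m + n = l) (hg : a + b = c) (g₁ : c + r = cr) (g₂ : a + r = ar) (g₃ : ar + b = cr)
    (x : P.Op m a) (y : P.Op n b) (z : P.Op 0 r) :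
    P.comp (leafOut i h p) (Nat.add_zero l) g₁ (P.comp i h hg x y) z =
      ksign k b r • P.comp i h g₃ (P.comp p (Nat.add_zero m) g₂ x z) y := by
  rcases lt_or_gt_of_ne hp with hlt | hlt
  · have := L.assoc_par p i hlt (Nat.add_zero m) h h (Nat.add_zero l) g₂ g₃ hg g₁ x z y
    rw [leafOut_add_zero] at this
    rw [this, smul_smul, ksign_comm r b, ksign_mul_self, one_smul]
  · have := L.assoc_par i p hlt h (Nat.add_zero l) (Nat.add_zero m) h hg g₁ g₂ g₃ x y z
    rw [leafOut_add_zero] at this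
    exact this

/-- Grafting onto a leaf of the inner operation of a composition. -/
theorem comp_leafIn {m n l : ℕ} {a b c r br cr : ZMod 2} (i : Fin (m + 1)) (q : Fin (n + 1))
    (h : m + n = l) (hg : a + b = c) (g₁ : c + r = cr) (g₂ : b + r = br) (g₃ : a + br = cr)
    (x : P.Op m a) (y : P.Op n b) (z : P.Op 0 r) :
    P.comp (leafIn i h q) (Nat.add_zero l) g₁ (P.comp i h hg x y) z =
      P.comp i h g₃ x (P.comp q (Nat.add_zero n) g₂ y z) :=
  L.assoc_seq i q h (Nat.add_zero l) (Nat.add_zero n) h hg g₁ g₂ g₃ x y z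

/-- Grafting onto an operation with one input. -/
theorem unary_comp {m n l : ℕ} {a b c r rc ra : ZMod 2} (i : Fin (m + 1)) (h : m + n = l)
    (hg : a + b = c) (g₁ : r + c = rc) (g₂ : r + a = ra) (g₃ : ra + b = rc)
    (z : P.Op 0 r) (x : P.Op m a) (y : P.Op n b) :
    P.comp 0 (Nat.zero_add l) g₁ z (P.comp i h hg x y) =
      P.comp i h g₃ (P.comp 0 (Nat.zero_add m) g₂ z x) y := by
  have := L.assoc_seq 0 i (Nat.zero_add m) h h (Nat.zero_add l) g₂ g₃ hg g₁ z x y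
  rw [leafIn_zero_add] at this
  exact this.symm

/-- Grafting two operations with one input one after the other onto a leaf. -/
theorem comp_comp_unary {m : ℕ} {a b r ab abr br : ZMod 2} (i : Fin (m + 1)) (g₁ : a + b = ab)
    (g₂ : ab + r = abr) (g₃ : b + r = br) (g₄ : a + br = abr)
    (x : P.Op m a) (y : P.Op 0 b) (z : P.Op 0 r) :
    P.comp i (Nat.add_zero m) g₂ (P.comp i (Nat.add_zero m) g₁ x y) z =
      P.comp i (Nat.add_zero m) g₄ x (P.comp 0 (Nat.zero_add 0) g₃ y z) := by
  have := L.comp_leafIn i 0 (Nat.add_zero m) g₁ g₂ g₃ g₄ x y z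
  rw [leafIn_add_zero] at this
  exact this

/-- Grafting operations with one input onto two different leaves. -/
theorem comp_unary_comm {m : ℕ} {a b r ab ar e : ZMod 2} (i p : Fin (m + 1)) (hp : p ≠ i)
    (g₁ : a + b = ab) (g₂ : ab + r = e) (g₃ : a + r = ar) (g₄ : ar + b = e)
    (x : P.Op m a) (y : P.Op 0 b) (z : P.Op 0 r) :
    P.comp p (Nat.add_zero m) g₂ (P.comp i (Nat.add_zero m) g₁ x y) z =
      ksign k b r • P.comp i (Nat.add_zero m) g₄ (P.comp p (Nat.add_zero m) g₃ x z) y := by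
  have := L.comp_leafOut i p hp (Nat.add_zero m) g₁ g₂ g₃ g₄ x y z
  rw [leafOut_add_zero] at this
  exact this

theorem act_comp_unary {m : ℕ} {a b c : ZMod 2} (i : Fin (m + 1)) (hg : a + b = c)
    (σ : Equiv.Perm (Fin (m + 1))) (x : P.Op m a) (z : P.Op 0 b) :
    P.comp (σ i) (Nat.add_zero m) hg (P.act σ x) z =
      P.act σ (P.comp i (Nat.add_zero m) hg x z) := by
  have := L.act_comp i (Nat.add_zero m) hg σ 1 σ
    (fun q => by rw [leafIn_add_zero, leafIn_add_zero])
    (fun p _ => by rw [leafOut_add_zero, leafOut_add_zero]) x z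
  rw [L.act_one] at this
  exact this

theorem unary_comp_act {m : ℕ} {a b c : ZMod 2} (hg : b + a = c)
    (σ : Equiv.Perm (Fin (m + 1))) (z : P.Op 0 b) (x : P.Op m a) :
    P.comp 0 (Nat.zero_add m) hg z (P.act σ x) =
      P.act σ (P.comp 0 (Nat.zero_add m) hg z x) := by
  have := L.act_comp (0 : Fin 1) (Nat.zero_add m) hg 1 σ σ
    (fun q => by rw [leafIn_zero_add, leafIn_zero_add])
    (fun p hp => absurd (Fin.ext (by omega)) hp) z x
  rw [L.act_one] at this
  exact this

end IsGradedOperad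

/-- A graded operad whose differential is the bracket with an odd operation `δ` with one input such
that `δ² = 0` is a dg operad. -/
theorem IsGradedOperad.isDGOperad_of_inner (L : P.IsGradedOperad) (δ : P.Op 0 1)
    (hδ : P.comp 0 (Nat.zero_add 0) (show (1 : ZMod 2) + 1 = 0 from rfl) δ δ = 0)
    (hd : ∀ {n : ℕ} {a b : ZMod 2} (h : a + 1 = b) (x : P.Op n a),
      P.d h x = P.comp 0 (Nat.zero_add n) ((add_comm 1 a).trans h) δ x -
        ksign k 1 a • ∑ p, P.comp p (Nat.add_zero n) h x δ) : P.IsDGOperad where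
  one_comp := L.one_comp
  comp_one := L.comp_one
  assoc_seq := L.assoc_seq
  assoc_par := L.assoc_par
  act_one := L.act_one
  act_mul := L.act_mul
  act_comp := L.act_comp
  d_d {n a b c} h₁ h₂ x := by
    subst h₁
    obtain rfl : a = c := by rw [← h₂, add_assoc, CharTwo.add_self_eq_zero, add_zero]
    have e₁ : P.comp 0 (Nat.zero_add n) ((add_comm 1 _).trans h₂) δ
        (P.comp 0 (Nat.zero_add n) (add_comm 1 a) δ x) = 0 := by
      rw [L.unary_comp 0 (Nat.zero_add n) (add_comm 1 a) _ (show (1 : ZMod 2) + 1 = 0 from rfl)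
        (zero_add a), hδ, map_zero, LinearMap.zero_apply]
    have e₂ : ∀ p, P.comp 0 (Nat.zero_add n) ((add_comm 1 _).trans h₂) δ
        (P.comp p (Nat.add_zero n) rfl x δ) =
        P.comp p (Nat.add_zero n) h₂ (P.comp 0 (Nat.zero_add n) (add_comm 1 a) δ x) δ := fun p =>
      L.unary_comp p (Nat.add_zero n) rfl _ (add_comm 1 a) h₂ δ x δ
    -- Insertions of δ at two different leaves anticommute because δ is odd, and two insertions at
    -- the same leaf give δ² = 0.
    have e₃ : ∑ p, ∑ q, P.comp p (Nat.add_zero n) h₂ (P.comp q (Nat.add_zero n) rfl x δ) δ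
        = 0 := by
      rw [sum_pairs_eq]
      · refine Finset.sum_eq_zero fun p _ => Finset.sum_eq_zero fun q _ => ?_
        split
        · next hpq =>
          rw [L.comp_unary_comm p q hpq.ne' rfl h₂ rfl h₂, ksign_one_one, neg_one_smul,
            add_neg_cancel]
        · rfl
      · intro p
        rw [L.comp_comp_unary p rfl h₂ (show (1 : ZMod 2) + 1 = 0 from rfl) (add_zero a),
          hδ, map_zero]
    have e₄ : ksign k 1 (a + 1) = -ksign k 1 a := by
      rw [ksign_add_right, ksign_one_one, mul_neg_one]
    rw [hd h₂, hd rfl]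
    simp only [map_sub, map_smul, map_sum, e₁, e₂, LinearMap.sub_apply, LinearMap.smul_apply,
      LinearMap.sum_apply, Finset.sum_sub_distrib, ← Finset.smul_sum, e₃, e₄]
    simp
  d_one h := by
    subst h
    rw [hd, Fin.sum_univ_one, ksign_zero_right, one_smul]
    have h₁ : ∀ (g : (1 : ZMod 2) + 0 = 0 + 1), P.comp 0 (Nat.zero_add 0) g δ P.one =
        P.comp 0 (Nat.add_zero 0) (add_zero _) δ P.one := fun g => rfl
    rw [h₁, L.comp_one, sub_eq_zero]
    exact (L.one_comp δ).symm
  d_act {n a b} h σ x := by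
    rw [hd, hd, L.unary_comp_act, map_sub, map_smul, map_sum, ← Equiv.sum_comp σ]
    simp only [L.act_comp_unary]
  d_comp {m n l a b c a' b' c'} i h hg ha hb hc g₁ g₂ x y := by
    rw [hd, hd, hd, sum_leaves i h]
    have e₁ : P.comp 0 (Nat.zero_add l) ((add_comm 1 c).trans hc) δ (P.comp i h hg x y) =
        P.comp i h g₁ (P.comp 0 (Nat.zero_add m) ((add_comm 1 a).trans ha) δ x) y :=
      L.unary_comp ..
    have e₂ : ∀ p ∈ Finset.univ.erase i,
        P.comp (leafOut i h p) (Nat.add_zero l) hc (P.comp i h hg x y) δ =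
        ksign k 1 b • P.comp i h g₁ (P.comp p (Nat.add_zero m) ha x δ) y := fun p hp => by
      rw [L.comp_leafOut i p (Finset.ne_of_mem_erase hp) h hg hc ha g₁, ksign_comm]
    have e₃ : ∀ q, P.comp (leafIn i h q) (Nat.add_zero l) hc (P.comp i h hg x y) δ =
        P.comp i h g₂ x (P.comp q (Nat.add_zero n) hb y δ) := fun q => L.comp_leafIn ..
    -- On the edge joining x and y, δ appears once below x and once above y. These two terms enter
    -- with opposite signs and cancel, leaving δ at the root and at the leaves of the composite.
    have e₄ : P.comp i h g₁ (P.comp i (Nat.add_zero m) ha x δ) y =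
        P.comp i h g₂ x (P.comp 0 (Nat.zero_add n) ((add_comm 1 b).trans hb) δ y) := by
      have := L.assoc_seq i 0 (Nat.add_zero m) h (Nat.zero_add n) h ha g₁
        ((add_comm 1 b).trans hb) g₂ x δ y
      rw [leafIn_add_zero] at this
      exact this
    have e₅ : ksign k 1 c = ksign k 1 a * ksign k 1 b := by rw [← hg, ksign_add_right]
    rw [e₁, Finset.sum_congr rfl e₂, Finset.sum_congr rfl fun q _ => e₃ q,
      ← Finset.add_sum_erase (a := i) Finset.univ (fun p => P.comp p (Nat.add_zero m) ha x δ)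
        (Finset.mem_univ i)]
    simp only [map_sub, map_add, map_smul, map_sum, LinearMap.sub_apply, LinearMap.add_apply,
      LinearMap.smul_apply, LinearMap.sum_apply, e₄, e₅, ← Finset.smul_sum, smul_add, smul_sub,
      smul_smul]
    rw [mul_assoc, ksign_mul_self, mul_one]
    abel

end DGOperadData

/-! ### The endomorphism operad as a graded operad with inner differential -/

namespace DGSpace

variable {k : Type u} [Field k] (V : DGSpace.{u, v} k)

/-- The value of an operation of the endomorphism operad. -/
def value {n : ℕ} {g : ZMod 2} (x : Fin (n + 1) → V.carrier) :
    V.endOperad.Op n g →ₗ[k] V.carrier where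
  toFun f := (f : V.endOp n g).1 x
  map_add' _ _ := rfl
  map_smul' _ _ := rfl

variable {V} in
theorem op_ext {n : ℕ} {g : ZMod 2} {f f' : V.endOperad.Op n g}
    (h : ∀ x, V.value x f = V.value x f') : f = f' :=
  Subtype.ext (MultilinearMap.ext h)

theorem value_comp {m n l : ℕ} {a b c : ZMod 2} (i : Fin (m + 1)) (h : m + n = l)
    (hg : a + b = c) (f : V.endOperad.Op m a) (g : V.endOperad.Op n b)
    (x : Fin (l + 1) → V.carrier) :
    V.value x (V.endOperad.comp i h hg f g) =
      V.value (signedArg b i h (g : V.endOp n b).1 x) f :=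
  comp_apply i h hg f g x

theorem value_d {n : ℕ} {a b : ZMod 2} (h : a + 1 = b) (f : V.endOperad.Op n a)
    (x : Fin (n + 1) → V.carrier) :
    V.value x (V.endOperad.d h f) = V.d (V.value x f) - ksign k 1 a • ∑ p,
      V.value (fun q => (if q < p then V.twist 1 else if q = p then V.d else LinearMap.id) (x q))
        f := by
  change V.d _ - ksign k 1 a • (∑ p, precomp 1 p V.d (f : V.endOp n a).1) x = _
  rw [_root_.sum_apply]
  rfl

/-- An operator of parity `g` on `V`, as an operation of the endomorphism operad. -/
def unary {g : ZMod 2} (φ : V.carrier →ₗ[k] V.carrier)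
    (hφ : ∀ a x, x ∈ V.deg a → φ x ∈ V.deg (a + g)) : V.endOperad.Op 0 g :=
  ⟨V.ofLinear φ, V.ofLinear_mem hφ⟩

theorem endOperad_isGradedOperad : V.endOperad.IsGradedOperad where
  one_comp := end_one_comp
  comp_one := end_comp_one
  assoc_seq := end_assoc_seq
  assoc_par := end_assoc_par
  act_one := end_act_one
  act_mul := end_act_mul
  act_comp := end_act_comp

theorem value_unary_comp {n : ℕ} {a g b : ZMod 2} {φ : V.carrier →ₗ[k] V.carrier}
    (hφ : ∀ a x, x ∈ V.deg a → φ x ∈ V.deg (a + g)) (h : g + a = b) (f : V.endOperad.Op n a)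
    (x : Fin (n + 1) → V.carrier) :
    V.value x (V.endOperad.comp 0 (Nat.zero_add n) h (V.unary φ hφ) f) = φ (V.value x f) := by
  rw [value_comp]
  change φ (signedArg a 0 (Nat.zero_add n) (f : V.endOp n a).1 x 0) = _
  simp only [signedArg, lt_irrefl, if_true, if_false, leafIn_zero_add]
  rfl

theorem value_comp_unary {n : ℕ} {a g b : ZMod 2} {φ : V.carrier →ₗ[k] V.carrier}
    (hφ : ∀ a x, x ∈ V.deg a → φ x ∈ V.deg (a + g)) (p : Fin (n + 1)) (h : a + g = b)
    (f : V.endOperad.Op n a) (x : Fin (n + 1) → V.carrier) :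
    V.value x (V.endOperad.comp p (Nat.add_zero n) h f (V.unary φ hφ)) =
      V.value (fun q => (if q < p then V.twist g else if q = p then φ else LinearMap.id) (x q))
        f := by
  rw [value_comp]
  refine congrArg (fun y => V.value y f) (funext fun q => ?_)
  rcases lt_trichotomy q p with hq | hq | hq
  · simp [signedArg, hq, leafOut_add_zero]
  · simp [signedArg, hq, leafIn_add_zero, unary, ofLinear_apply]
  · simp [signedArg, hq.not_gt, hq.ne', leafOut_add_zero]

/-- The differential of E(V) is the bracket with the unary operation given by d itself, so all laws
involving it follow from the graded ones and d² = 0. -/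
theorem endOperad_isDGOperad : V.endOperad.IsDGOperad :=
  V.endOperad_isGradedOperad.isDGOperad_of_inner (V.unary V.d V.d_mem)
    (op_ext fun x => by
      rw [value_unary_comp, map_zero]
      exact V.d_d _)
    (fun h f => op_ext fun x => by
      simp only [value_d, map_sub, map_smul, map_sum, value_unary_comp, value_comp_unary])

end DGSpace

/-! ### The tensor product with the polynomial de Rham algebra -/

namespace DGOperadData

open Polynomial

variable {k : Type u} [Field k] {P : DGOperadData.{u, v} k}

@[simp]
theorem polyComp_tmul {m n l : ℕ} {a b c : ZMod 2} (i : Fin (m + 1)) (h : m + n = l)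
    (hg : a + b = c) (x : P.Op m a) (p : k[X]) (y : P.Op n b) (q : k[X]) :
    P.polyComp i h hg (x ⊗ₜ p) (y ⊗ₜ q) = P.comp i h hg x y ⊗ₜ (p * q) := rfl

/-- The derivative in the polynomial variable, with the parity transported along an equality. -/
noncomputable def polyDeriv (P : DGOperadData.{u, v} k) {n : ℕ} {a b : ZMod 2} (h : a = b) :
    P.Op n a ⊗[k] k[X] →ₗ[k] P.Op n b ⊗[k] k[X] :=
  TensorProduct.map (P.castParity h) Polynomial.derivative

@[simp]
theorem polyDeriv_tmul {n : ℕ} {a : ZMod 2} (x : P.Op n a) (p : k[X]) :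
    P.polyDeriv (rfl : a = a) (x ⊗ₜ p) = x ⊗ₜ derivative p := rfl

/-- Leibniz rule for d/dz. It carries no Koszul sign since z is even; the signs of dz are added in
`tensorDeRham`. -/
theorem polyDeriv_comp {m n l : ℕ} {a b c a' b' c' : ZMod 2} (i : Fin (m + 1)) (h : m + n = l)
    (hg : a + b = c) (ha : a = a') (hb : b = b') (hc : c = c') (g₁ : a' + b = c')
    (g₂ : a + b' = c') (x : P.Op m a ⊗[k] k[X]) (y : P.Op n b ⊗[k] k[X]) :
    P.polyDeriv hc (P.polyComp i h hg x y) =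
      P.polyComp i h g₁ (P.polyDeriv ha x) y + P.polyComp i h g₂ x (P.polyDeriv hb y) := by
  subst ha hb hc
  induction x using TensorProduct.induction_on with
  | zero => simp
  | add x x' hx hx' => simp only [map_add, LinearMap.add_apply, hx, hx']; abel
  | tmul x p =>
    induction y using TensorProduct.induction_on with
    | zero => simp
    | add y y' hy hy' => simp only [map_add, hy, hy']; abel
    | tmul y q =>
      simp only [polyComp_tmul, polyDeriv_tmul, derivative_mul, TensorProduct.tmul_add]

theorem polyDeriv_act {n : ℕ} {a b : ZMod 2} (h : a = b) (σ : Equiv.Perm (Fin (n + 1)))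
    (x : P.Op n a ⊗[k] k[X]) :
    P.polyDeriv h ((P.act σ).rTensor k[X] x) = (P.act σ).rTensor k[X] (P.polyDeriv h x) := by
  subst h
  induction x using TensorProduct.induction_on with
  | zero => simp
  | add x x' hx hx' => simp only [map_add, hx, hx']
  | tmul x p => simp

theorem polyDeriv_d {n : ℕ} {a b a' b' : ZMod 2} (h : a + 1 = b) (ha : a = a') (hb : b = b')
    (h' : a' + 1 = b') (x : P.Op n a ⊗[k] k[X]) :
    P.polyDeriv hb ((P.d h).rTensor k[X] x) = (P.d h').rTensor k[X] (P.polyDeriv ha x) := by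
  subst ha hb
  induction x using TensorProduct.induction_on with
  | zero => simp
  | add x x' hx hx' => simp only [map_add, hx, hx']
  | tmul x p => simp

/-- The component of `P ⊗ k[z, dz]` without `dz`. -/
noncomputable def drFst (P : DGOperadData.{u, v} k) (n : ℕ) (a : ZMod 2) :
    P.tensorDeRham.Op n a →ₗ[k] P.Op n a ⊗[k] k[X] :=
  LinearMap.fst k (P.Op n a ⊗[k] k[X]) (P.Op n (a + 1) ⊗[k] k[X])

/-- The coefficient of `dz` in an element of `P ⊗ k[z, dz]`. -/
noncomputable def drSnd (P : DGOperadData.{u, v} k) (n : ℕ) (a : ZMod 2) :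
    P.tensorDeRham.Op n a →ₗ[k] P.Op n (a + 1) ⊗[k] k[X] :=
  LinearMap.snd k (P.Op n a ⊗[k] k[X]) (P.Op n (a + 1) ⊗[k] k[X])

/-- The element `x + y dz` of `P ⊗ k[z, dz]`. -/
def drMk {n : ℕ} {a : ZMod 2} (x : P.Op n a ⊗[k] k[X]) (y : P.Op n (a + 1) ⊗[k] k[X]) :
    P.tensorDeRham.Op n a := (x, y)

@[simp]
theorem drFst_mk {n : ℕ} {a : ZMod 2} (x : P.Op n a ⊗[k] k[X]) (y : P.Op n (a + 1) ⊗[k] k[X]) :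
    P.drFst n a (drMk x y) = x := rfl

@[simp]
theorem drSnd_mk {n : ℕ} {a : ZMod 2} (x : P.Op n a ⊗[k] k[X]) (y : P.Op n (a + 1) ⊗[k] k[X]) :
    P.drSnd n a (drMk x y) = y := rfl

theorem dr_ext {n : ℕ} {a : ZMod 2} {x y : P.tensorDeRham.Op n a}
    (h₁ : P.drFst n a x = P.drFst n a y) (h₂ : P.drSnd n a x = P.drSnd n a y) : x = y :=
  Prod.ext h₁ h₂

@[simp]
theorem drFst_one : P.drFst 0 0 P.tensorDeRham.one = P.one ⊗ₜ 1 := rfl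

@[simp]
theorem drSnd_one : P.drSnd 0 0 P.tensorDeRham.one = 0 := rfl

@[simp]
theorem drFst_comp {m n l : ℕ} {a b c : ZMod 2} (i : Fin (m + 1)) (h : m + n = l)
    (hg : a + b = c) (x : P.tensorDeRham.Op m a) (y : P.tensorDeRham.Op n b) :
    P.drFst l c (P.tensorDeRham.comp i h hg x y) =
      P.polyComp i h hg (P.drFst m a x) (P.drFst n b y) := rfl

@[simp]
theorem drSnd_comp {m n l : ℕ} {a b c : ZMod 2} (i : Fin (m + 1)) (h : m + n = l)
    (hg : a + b = c) (x : P.tensorDeRham.Op m a) (y : P.tensorDeRham.Op n b) :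
    P.drSnd l c (P.tensorDeRham.comp i h hg x y) =
      P.polyComp i h (by rw [← hg, add_assoc] : a + (b + 1) = c + 1) (P.drFst m a x)
          (P.drSnd n b y) +
        ksign k 1 b • P.polyComp i h (by rw [← hg, add_right_comm] : a + 1 + b = c + 1)
          (P.drSnd m a x) (P.drFst n b y) :=
  rfl

@[simp]
theorem drFst_act {n : ℕ} {a : ZMod 2} (σ : Equiv.Perm (Fin (n + 1)))
    (x : P.tensorDeRham.Op n a) : P.drFst n a (P.tensorDeRham.act σ x) =
      (P.act σ).rTensor k[X] (P.drFst n a x) := rfl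

@[simp]
theorem drSnd_act {n : ℕ} {a : ZMod 2} (σ : Equiv.Perm (Fin (n + 1)))
    (x : P.tensorDeRham.Op n a) : P.drSnd n a (P.tensorDeRham.act σ x) =
      (P.act σ).rTensor k[X] (P.drSnd n a x) := rfl

@[simp]
theorem drFst_d {n : ℕ} {a b : ZMod 2} (h : a + 1 = b) (x : P.tensorDeRham.Op n a) :
    P.drFst n b (P.tensorDeRham.d h x) = (P.d h).rTensor k[X] (P.drFst n a x) := rfl

@[simp]
theorem drSnd_d {n : ℕ} {a b : ZMod 2} (h : a + 1 = b) (x : P.tensorDeRham.Op n a) :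
    P.drSnd n b (P.tensorDeRham.d h x) = ksign k 1 a • P.polyDeriv
        (by rw [← h, add_assoc, CharTwo.add_self_eq_zero, add_zero] : a = b + 1) (P.drFst n a x) +
      (P.d (by rw [h] : a + 1 + 1 = b + 1)).rTensor k[X] (P.drSnd n a x) := rfl

/-! ### The dg operad laws for polynomial and de Rham coefficients -/

section Laws

variable (L : P.IsDGOperad)
include L

theorem polyComp_seq {m n p mn np l : ℕ} {a b c ab bc e : ZMod 2}
    (i : Fin (m + 1)) (j : Fin (n + 1)) (h₁ : m + n = mn) (h₂ : mn + p = l)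
    (h₃ : n + p = np) (h₄ : m + np = l) (g₁ : a + b = ab) (g₂ : ab + c = e)
    (g₃ : b + c = bc) (g₄ : a + bc = e) (x : P.Op m a ⊗[k] k[X]) (y : P.Op n b ⊗[k] k[X])
    (z : P.Op p c ⊗[k] k[X]) :
    P.polyComp (leafIn i h₁ j) h₂ g₂ (P.polyComp i h₁ g₁ x y) z =
      P.polyComp i h₄ g₄ x (P.polyComp j h₃ g₃ y z) := by
  induction x using TensorProduct.induction_on with
  | zero => simp
  | add x x' hx hx' => simp only [map_add, LinearMap.add_apply, hx, hx']
  | tmul x p =>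
    induction y using TensorProduct.induction_on with
    | zero => simp
    | add y y' hy hy' => simp only [map_add, LinearMap.add_apply, hy, hy']
    | tmul y q =>
      induction z using TensorProduct.induction_on with
      | zero => simp
      | add z z' hz hz' => simp only [map_add, hz, hz']
      | tmul z r =>
        simp only [polyComp_tmul, mul_assoc]
        rw [L.assoc_seq i j h₁ h₂ h₃ h₄ g₁ g₂ g₃ g₄]

theorem polyComp_par {m n p mn mp l : ℕ} {a b c ab ac e : ZMod 2}
    (i j : Fin (m + 1)) (hij : i < j) (h₁ : m + n = mn) (h₂ : mn + p = l)
    (h₃ : m + p = mp) (h₄ : mp + n = l) (g₁ : a + b = ab) (g₂ : ab + c = e)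
    (g₃ : a + c = ac) (g₄ : ac + b = e) (x : P.Op m a ⊗[k] k[X]) (y : P.Op n b ⊗[k] k[X])
    (z : P.Op p c ⊗[k] k[X]) :
    P.polyComp (leafOut i h₁ j) h₂ g₂ (P.polyComp i h₁ g₁ x y) z =
      ksign k b c • P.polyComp (leafOut j h₃ i) h₄ g₄ (P.polyComp j h₃ g₃ x z) y := by
  induction x using TensorProduct.induction_on with
  | zero => simp
  | add x x' hx hx' => simp only [map_add, LinearMap.add_apply, hx, hx', smul_add]
  | tmul x p =>
    induction y using TensorProduct.induction_on with
    | zero => simp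
    | add y y' hy hy' => simp only [map_add, LinearMap.add_apply, hy, hy', smul_add]
    | tmul y q =>
      induction z using TensorProduct.induction_on with
      | zero => simp
      | add z z' hz hz' => simp only [map_add, LinearMap.add_apply, hz, hz', smul_add]
      | tmul z r =>
        simp only [polyComp_tmul, mul_right_comm]
        rw [L.assoc_par i j hij h₁ h₂ h₃ h₄ g₁ g₂ g₃ g₄, TensorProduct.smul_tmul']

theorem one_polyComp {n : ℕ} {a : ZMod 2} (x : P.Op n a ⊗[k] k[X]) :
    P.polyComp 0 (Nat.zero_add n) (zero_add a) (P.one ⊗ₜ 1) x = x := by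
  induction x using TensorProduct.induction_on with
  | zero => simp
  | add x x' hx hx' => simp only [map_add, hx, hx']
  | tmul x p => rw [polyComp_tmul, L.one_comp, one_mul]

theorem polyComp_one {n : ℕ} {a : ZMod 2} (i : Fin (n + 1)) (x : P.Op n a ⊗[k] k[X]) :
    P.polyComp i (Nat.add_zero n) (add_zero a) x (P.one ⊗ₜ 1) = x := by
  induction x using TensorProduct.induction_on with
  | zero => simp
  | add x x' hx hx' => simp only [map_add, LinearMap.add_apply, hx, hx']
  | tmul x p => rw [polyComp_tmul, L.comp_one, mul_one]

theorem polyComp_act {m n l : ℕ} {a b c : ZMod 2} (i : Fin (m + 1)) (h : m + n = l)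
    (hg : a + b = c) (σ : Equiv.Perm (Fin (m + 1))) (τ : Equiv.Perm (Fin (n + 1)))
    (ρ : Equiv.Perm (Fin (l + 1)))
    (hin : ∀ q, ρ (leafIn i h q) = leafIn (σ i) h (τ q))
    (hout : ∀ p, p ≠ i → ρ (leafOut i h p) = leafOut (σ i) h (σ p))
    (x : P.Op m a ⊗[k] k[X]) (y : P.Op n b ⊗[k] k[X]) :
    P.polyComp (σ i) h hg ((P.act σ).rTensor k[X] x) ((P.act τ).rTensor k[X] y) =
      (P.act ρ).rTensor k[X] (P.polyComp i h hg x y) := by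
  induction x using TensorProduct.induction_on with
  | zero => simp
  | add x x' hx hx' => simp only [map_add, LinearMap.add_apply, hx, hx']
  | tmul x p =>
    induction y using TensorProduct.induction_on with
    | zero => simp
    | add y y' hy hy' => simp only [map_add, hy, hy']
    | tmul y q =>
      simp only [polyComp_tmul, LinearMap.rTensor_tmul]
      rw [L.act_comp i h hg σ τ ρ hin hout]

theorem polyComp_d {m n l : ℕ} {a b c a' b' c' : ZMod 2} (i : Fin (m + 1)) (h : m + n = l)
    (hg : a + b = c) (ha : a + 1 = a') (hb : b + 1 = b') (hc : c + 1 = c')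
    (g₁ : a' + b = c') (g₂ : a + b' = c') (x : P.Op m a ⊗[k] k[X]) (y : P.Op n b ⊗[k] k[X]) :
    (P.d hc).rTensor k[X] (P.polyComp i h hg x y) =
      P.polyComp i h g₁ ((P.d ha).rTensor k[X] x) y +
        ksign k 1 a • P.polyComp i h g₂ x ((P.d hb).rTensor k[X] y) := by
  induction x using TensorProduct.induction_on with
  | zero => simp
  | add x x' hx hx' => simp only [map_add, LinearMap.add_apply, hx, hx', smul_add]; abel
  | tmul x p =>
    induction y using TensorProduct.induction_on with
    | zero => simp
    | add y y' hy hy' => simp only [map_add, hy, hy', smul_add]; abel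
    | tmul y q =>
      simp only [polyComp_tmul, LinearMap.rTensor_tmul]
      rw [L.d_comp i h hg ha hb hc g₁ g₂, TensorProduct.add_tmul, TensorProduct.smul_tmul']

theorem rTensor_d_d {n : ℕ} {a b c : ZMod 2} (h₁ : a + 1 = b) (h₂ : b + 1 = c)
    (x : P.Op n a ⊗[k] k[X]) : (P.d h₂).rTensor k[X] ((P.d h₁).rTensor k[X] x) = 0 := by
  induction x using TensorProduct.induction_on with
  | zero => simp
  | add x x' hx hx' => simp only [map_add, hx, hx', add_zero]
  | tmul x p => rw [LinearMap.rTensor_tmul, LinearMap.rTensor_tmul, L.d_d, TensorProduct.zero_tmul]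

theorem rTensor_act_one {n : ℕ} {a : ZMod 2} (x : P.Op n a ⊗[k] k[X]) :
    (P.act 1).rTensor k[X] x = x := by
  induction x using TensorProduct.induction_on with
  | zero => simp
  | add x x' hx hx' => simp only [map_add, hx, hx']
  | tmul x p => rw [LinearMap.rTensor_tmul, L.act_one]

theorem rTensor_act_mul {n : ℕ} {a : ZMod 2} (σ τ : Equiv.Perm (Fin (n + 1)))
    (x : P.Op n a ⊗[k] k[X]) :
    (P.act (σ * τ)).rTensor k[X] x = (P.act σ).rTensor k[X] ((P.act τ).rTensor k[X] x) := by
  induction x using TensorProduct.induction_on with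
  | zero => simp
  | add x x' hx hx' => simp only [map_add, hx, hx']
  | tmul x p => simp only [LinearMap.rTensor_tmul, L.act_mul]

theorem rTensor_d_act {n : ℕ} {a b : ZMod 2} (h : a + 1 = b) (σ : Equiv.Perm (Fin (n + 1)))
    (x : P.Op n a ⊗[k] k[X]) : (P.d h).rTensor k[X] ((P.act σ).rTensor k[X] x) =
      (P.act σ).rTensor k[X] ((P.d h).rTensor k[X] x) := by
  induction x using TensorProduct.induction_on with
  | zero => simp
  | add x x' hx hx' => simp only [map_add, hx, hx']
  | tmul x p => simp only [LinearMap.rTensor_tmul, L.d_act]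

/-- As dz² = 0, each law splits into two components. The one without dz is the law of P with
polynomial coefficients. In the other exactly one factor carries dz or is differentiated in z, and
only the signs of moving dz to the right remain to be compared. -/
theorem tensorDeRham_isDGOperad : P.tensorDeRham.IsDGOperad where
  one_comp x := by
    refine dr_ext ?_ ?_
    · rw [drFst_comp, drFst_one, one_polyComp L]
    · rw [drSnd_comp, drFst_one, drSnd_one, one_polyComp L, map_zero, LinearMap.zero_apply,
        smul_zero, add_zero]
  comp_one {n a} i x := by
    refine dr_ext ?_ ?_
    · rw [drFst_comp, drFst_one, polyComp_one L]
    · rw [drSnd_comp, drFst_one, drSnd_one, polyComp_one L, map_zero, ksign_zero_right, one_smul,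
        zero_add]
  assoc_seq {m n p mn np l a b c ab bc e} i j h₁ h₂ h₃ h₄ g₁ g₂ g₃ g₄ x y z := by
    have e₁ : ksign k 1 bc = ksign k 1 b * ksign k 1 c := by rw [← g₃, ksign_add_right]
    refine dr_ext (polyComp_seq L i j h₁ h₂ h₃ h₄ g₁ g₂ g₃ g₄ _ _ _) ?_
    simp only [drFst_comp, drSnd_comp, map_add, map_smul, LinearMap.add_apply,
      LinearMap.smul_apply, smul_add, smul_smul, e₁]
    rw [polyComp_seq L i j h₁ h₂ h₃ h₄ (ab := ab) (bc := bc + 1) _ _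
        (by rw [← g₃, add_assoc]) (by rw [← g₄, add_assoc]),
      polyComp_seq L i j h₁ h₂ h₃ h₄ (bc := bc + 1) _ _
        (by rw [← g₃, add_right_comm]) (by rw [← g₄, add_assoc]),
      polyComp_seq L i j h₁ h₂ h₃ h₄ _ _ g₃ (by rw [← g₄, add_right_comm]),
      mul_comm (ksign k 1 b)]
    abel
  assoc_par {m n p mn mp l a b c ab ac e} i j hij h₁ h₂ h₃ h₄ g₁ g₂ g₃ g₄ x y z := by
    refine dr_ext ?_ ?_
    · rw [map_smul]
      exact polyComp_par L i j hij h₁ h₂ h₃ h₄ g₁ g₂ g₃ g₄ _ _ _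
    simp only [drFst_comp, drSnd_comp, map_add, map_smul, LinearMap.add_apply,
      LinearMap.smul_apply, smul_add, smul_smul]
    rw [polyComp_par L i j hij h₁ h₂ h₃ h₄ _ _ (by rw [← g₃, add_assoc] : _ = ac + 1)
        (by rw [← g₄, add_right_comm]),
      polyComp_par L i j hij h₁ h₂ h₃ h₄ _ _ g₃ (by rw [← g₄, add_assoc]),
      polyComp_par L i j hij h₁ h₂ h₃ h₄ _ _ (by rw [← g₃, add_right_comm] : _ = ac + 1)
        (by rw [← g₄, add_right_comm])]
    simp only [smul_smul, ksign_add_left, ksign_add_right]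
    rw [ksign_comm b 1, mul_left_comm (ksign k 1 c) (ksign k b c), ksign_mul_self, mul_one]
    module
  act_one x := dr_ext (rTensor_act_one L _) (rTensor_act_one L _)
  act_mul σ τ x := dr_ext (rTensor_act_mul L σ τ _) (rTensor_act_mul L σ τ _)
  act_comp i h hg σ τ ρ hin hout x y := by
    refine dr_ext (polyComp_act L i h _ σ τ ρ hin hout _ _) ?_
    simp only [drFst_act, drSnd_act, drSnd_comp, polyComp_act L i h _ σ τ ρ hin hout, map_add,
      map_smul]
  d_d {n a b c} h₁ h₂ x := by
    -- The sign of the z-derivative alternates with parity, so the two mixed terms, d/dz after d and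
    -- d after d/dz, cancel.
    have e₁ : ksign k 1 b = -ksign k 1 a := by
      rw [← h₁, ksign_add_right, ksign_one_one, mul_neg_one]
    refine dr_ext (rTensor_d_d L h₁ h₂ _) ?_
    simp only [drFst_d, drSnd_d, map_add, map_smul, rTensor_d_d L, e₁, map_zero]
    rw [polyDeriv_d h₁ (b' := c + 1) (a' := b + 1)
      (by rw [← h₁, add_assoc, CharTwo.add_self_eq_zero, add_zero])
      (by rw [← h₂, add_assoc, CharTwo.add_self_eq_zero, add_zero]) (by rw [h₂])]
    module
  d_one {b} h := by
    refine dr_ext ?_ ?_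
    · rw [drFst_d, drFst_one, LinearMap.rTensor_tmul, L.d_one, TensorProduct.zero_tmul, map_zero]
    · rw [drSnd_d, drFst_one, drSnd_one, map_zero, add_zero, polyDeriv,
        TensorProduct.map_tmul, derivative_one, TensorProduct.tmul_zero, smul_zero, map_zero]
  d_act h σ x := by
    refine dr_ext (rTensor_d_act L h σ _) ?_
    simp only [drFst_act, drSnd_act, drSnd_d, polyDeriv_act, rTensor_d_act L, map_add, map_smul]
  d_comp {m n l a b c a' b' c'} i h hg ha hb hc g₁ g₂ x y := by
    have e₁ : ksign k 1 c = ksign k 1 a * ksign k 1 b := by rw [← hg, ksign_add_right]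
    have e₂ : ksign k 1 b' = -ksign k 1 b := by
      rw [← hb, ksign_add_right, ksign_one_one, mul_neg_one]
    have e₃ : ksign k 1 (a + 1) = -ksign k 1 a := by
      rw [ksign_add_right, ksign_one_one, mul_neg_one]
    have aa : ∀ {s t : ZMod 2}, s + 1 = t → s = t + 1 := fun h => by
      rw [← h, add_assoc, CharTwo.add_self_eq_zero, add_zero]
    refine dr_ext ?_ ?_
    · rw [map_add, map_smul]
      exact polyComp_d L i h hg ha hb hc g₁ g₂ _ _
    simp only [drFst_comp, drSnd_comp, drFst_d, drSnd_d, map_add, map_smul, LinearMap.add_apply,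
      LinearMap.smul_apply]
    rw [polyDeriv_comp i h hg (aa ha) (aa hb) (aa hc) (by rw [← g₁, add_right_comm])
        (by rw [← g₂, add_assoc]),
      polyComp_d L i h _ ha (by rw [hb] : b + 1 + 1 = b' + 1) _ (by rw [← g₁, add_assoc])
        (by rw [← g₂, add_assoc]),
      polyComp_d L i h _ (by rw [ha] : a + 1 + 1 = a' + 1) hb _ (by rw [← g₁, add_right_comm])
        (by rw [← g₂, add_right_comm])]
    simp only [e₁, e₂, e₃]
    module

end Laws

/-! ### Evaluations and constants for de Rham coefficients -/

/-- The evaluation of polynomials with coefficients in an operad. -/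
noncomputable def polyEval (P : DGOperadData.{u, v} k) (c : k) (n : ℕ) (a : ZMod 2) :
    P.Op n a ⊗[k] k[X] →ₗ[k] P.Op n a :=
  (TensorProduct.rid k (P.Op n a)).toLinearMap ∘ₗ (Polynomial.leval c).lTensor (P.Op n a)

@[simp]
theorem polyEval_tmul (c : k) {n : ℕ} {a : ZMod 2} (x : P.Op n a) (p : k[X]) :
    P.polyEval c n a (x ⊗ₜ p) = p.eval c • x := rfl

theorem evalAt_eq (c : k) {n : ℕ} {a : ZMod 2} (x : P.tensorDeRham.Op n a) :
    P.evalAt c x = P.polyEval c n a (P.drFst n a x) := rfl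

/-- The evaluation `z ↦ c`, `dz ↦ 0` as a map of dg operads. -/
noncomputable def evalHom (P : DGOperadData.{u, v} k) (c : k) :
    DGOperadHom P.tensorDeRham P where
  app := P.evalAt c
  map_comp {m n l a b e} i h hg x y := by
    rw [evalAt_eq, evalAt_eq, evalAt_eq, drFst_comp]
    generalize P.drFst _ _ x = x
    generalize P.drFst _ _ y = y
    induction x using TensorProduct.induction_on with
    | zero => simp only [map_zero, LinearMap.zero_apply]
    | add x x' hx hx' => simp only [map_add, LinearMap.add_apply, hx, hx']
    | tmul x p =>
      induction y using TensorProduct.induction_on with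
      | zero => simp only [map_zero]
      | add y y' hy hy' => simp only [map_add, hy, hy']
      | tmul y q =>
        simp only [polyComp_tmul, polyEval_tmul, eval_mul, map_smul, LinearMap.smul_apply,
          smul_smul, mul_comm]
  map_act {n a} σ x := by
    rw [evalAt_eq, evalAt_eq, drFst_act]
    generalize P.drFst _ _ x = x
    induction x using TensorProduct.induction_on with
    | zero => simp only [map_zero]
    | add x x' hx hx' => simp only [map_add, hx, hx']
    | tmul x p => simp only [LinearMap.rTensor_tmul, polyEval_tmul, map_smul]
  map_d {n a b} h x := by
    rw [evalAt_eq, evalAt_eq, drFst_d]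
    generalize P.drFst _ _ x = x
    induction x using TensorProduct.induction_on with
    | zero => simp only [map_zero]
    | add x x' hx hx' => simp only [map_add, hx, hx']
    | tmul x p => simp only [LinearMap.rTensor_tmul, polyEval_tmul, map_smul]

/-- The inclusion `x ↦ x ⊗ 1` as a map of dg operads. -/
noncomputable def constHom (P : DGOperadData.{u, v} k) : DGOperadHom P P.tensorDeRham where
  app {n a} := LinearMap.inl k (P.Op n a ⊗[k] k[X]) (P.Op n (a + 1) ⊗[k] k[X]) ∘ₗ
    (TensorProduct.mk k (P.Op n a) k[X]).flip 1
  map_comp i h hg x y := by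
    change drMk (P.comp i h hg x y ⊗ₜ 1) 0 = P.tensorDeRham.comp i h hg (drMk (x ⊗ₜ 1) 0)
      (drMk (y ⊗ₜ 1) 0)
    refine dr_ext ?_ ?_
    · rw [drFst_comp, drFst_mk, drFst_mk, drFst_mk, polyComp_tmul, mul_one]
    · simp only [drSnd_comp, drSnd_mk, map_zero, LinearMap.zero_apply, smul_zero, add_zero]
  map_act σ x := by
    change drMk (P.act σ x ⊗ₜ 1) 0 = P.tensorDeRham.act σ (drMk (x ⊗ₜ 1) 0)
    refine dr_ext ?_ ?_
    · rw [drFst_act, drFst_mk, drFst_mk, LinearMap.rTensor_tmul]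
    · rw [drSnd_act, drSnd_mk, drSnd_mk, map_zero]
  map_d {n a b} h x := by
    change drMk (P.d h x ⊗ₜ 1) 0 = P.tensorDeRham.d h (drMk (x ⊗ₜ 1) 0)
    refine dr_ext ?_ ?_
    · rw [drFst_d, drFst_mk, drFst_mk, LinearMap.rTensor_tmul]
    · rw [drSnd_d, drSnd_mk, drSnd_mk, drFst_mk, map_zero, add_zero, polyDeriv,
        TensorProduct.map_tmul, derivative_one, TensorProduct.tmul_zero, smul_zero]

theorem constHom_app {n : ℕ} {a : ZMod 2} (x : P.Op n a) :
    P.constHom.app x = drMk (x ⊗ₜ 1) 0 := rfl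

theorem evalHom_app (c : k) {n : ℕ} {a : ZMod 2} (x : P.tensorDeRham.Op n a) :
    (P.evalHom c).app x = P.polyEval c n a (P.drFst n a x) := rfl

theorem evalHom_constHom (c : k) {n : ℕ} {a : ZMod 2} (x : P.Op n a) :
    (P.evalHom c).app (P.constHom.app x) = x := by
  rw [evalHom_app, constHom_app, drFst_mk, polyEval_tmul, eval_one, one_smul]

end DGOperadData

/-! ### The universal property of `BV O` -/

section Universal

variable {k : Type u} [Field k] {O : DGOperadData.{u, v} k} {Q : DGOperadData.{u, w} k}

/-- The value of an expression in `O`, `s` and `t` in an operad. -/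
def bvTermValue (f : DGOperadHom O Q) (s : Q.Op 0 1) (t : Q.Op 0 0) :
    ∀ {n : ℕ} {a : ZMod 2}, BVTerm O n a → Q.Op n a
  | _, _, .of x => f.app x
  | _, _, .s => s
  | _, _, .t => t
  | _, _, .zero => 0
  | _, _, .add x y => bvTermValue f s t x + bvTermValue f s t y
  | _, _, .smul r x => r • bvTermValue f s t x
  | _, _, .comp i h hg x y => Q.comp i h hg (bvTermValue f s t x) (bvTermValue f s t y)
  | _, _, .act σ x => Q.act σ (bvTermValue f s t x)
  | _, _, .d h x => Q.d h (bvTermValue f s t x)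

/-- Images of `s` and `t` which satisfy the relations of `BV O`. -/
structure BVRelations (Q : DGOperadData.{u, w} k) (s : Q.Op 0 1) (t : Q.Op 0 0) : Prop where
  s_s : Q.comp 0 (Nat.zero_add 0) (by decide : (1 : ZMod 2) + 1 = 0) s s = 0
  t_t : Q.comp 0 (Nat.zero_add 0) (zero_add 0) t t = t
  s_t : Q.comp 0 (Nat.zero_add 0) (add_zero 1) s t = 0
  t_s : Q.comp 0 (Nat.zero_add 0) (zero_add 1) t s = 0
  d_s : Q.d (by decide : (1 : ZMod 2) + 1 = 0) s = Q.one - t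
  d_t : Q.d (zero_add 1) t = 0

/-- Every clause of `BVRel` is a congruence, a law of the dg operad Q, a property of the unital map
f, or one of the relations R. No clause links s, t and operations of O of higher arity, and this
freedom lets the O-structure be deformed with s and t fixed. -/
theorem bvTermValue_eq (L : Q.IsDGOperad) (f : DGOperadHom O Q) (hf : f.IsUnital)
    {s : Q.Op 0 1} {t : Q.Op 0 0} (R : BVRelations Q s t) {n : ℕ} {a : ZMod 2}
    {x y : BVTerm O n a} (h : BVRel O x y) : bvTermValue f s t x = bvTermValue f s t y := by
  induction h with
  | refl => rfl
  | symm _ ih => exact ih.symm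
  | trans _ _ ih ih' => exact ih.trans ih'
  | congr_add _ _ ih ih' => simp only [bvTermValue, ih, ih']
  | congr_smul _ _ ih => simp only [bvTermValue, ih]
  | congr_comp _ _ _ _ _ ih ih' => simp only [bvTermValue, ih, ih']
  | congr_act _ _ ih => simp only [bvTermValue, ih]
  | congr_d _ _ ih => simp only [bvTermValue, ih]
  | add_assoc => exact add_assoc _ _ _
  | add_comm => exact add_comm _ _
  | zero_add => exact zero_add _
  | neg_add => simp only [bvTermValue, neg_smul, one_smul, neg_add_cancel]
  | smul_add => exact smul_add _ _ _
  | add_smul => exact add_smul _ _ _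
  | mul_smul => exact mul_smul _ _ _
  | one_smul => exact one_smul _ _
  | comp_add_left => simp only [bvTermValue, map_add, LinearMap.add_apply]
  | comp_smul_left => simp only [bvTermValue, map_smul, LinearMap.smul_apply]
  | comp_add_right => simp only [bvTermValue, map_add]
  | comp_smul_right => simp only [bvTermValue, map_smul]
  | act_add => simp only [bvTermValue, map_add]
  | act_smul => simp only [bvTermValue, map_smul]
  | d_add => simp only [bvTermValue, map_add]
  | d_smul => simp only [bvTermValue, map_smul]
  | one_comp x => simp only [bvTermValue, show f.app O.one = Q.one from hf]; exact L.one_comp _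
  | comp_one i x =>
    simp only [bvTermValue, show f.app O.one = Q.one from hf]; exact L.comp_one _ _
  | assoc_seq => exact L.assoc_seq ..
  | assoc_par i j hij => exact L.assoc_par i j hij ..
  | act_one => exact L.act_one _
  | act_mul => exact L.act_mul _ _ _
  | act_comp i h hg σ τ ρ hin hout => exact L.act_comp i h hg σ τ ρ hin hout _ _
  | d_d => exact L.d_d _ _ _
  | d_act => exact L.d_act _ _ _
  | d_comp i h hg ha hb hc g₁ g₂ => exact L.d_comp i h hg ha hb hc g₁ g₂ _ _
  | of_add => exact map_add _ _ _
  | of_smul => exact map_smul _ _ _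
  | of_comp => exact f.map_comp ..
  | of_act => exact f.map_act _ _
  | of_d => exact f.map_d _ _
  | s_s => exact R.s_s
  | t_t => exact R.t_t
  | s_t => exact R.s_t
  | t_s => exact R.t_s
  | d_s =>
    simp only [bvTermValue, show f.app O.one = Q.one from hf, neg_smul, one_smul,
      ← sub_eq_add_neg]
    exact R.d_s
  | d_t => exact R.d_t

/-- The map out of `BV O` given by a map out of `O` and by images of `s` and `t`. -/
def bvLift (L : Q.IsDGOperad) (f : DGOperadHom O Q) (hf : f.IsUnital)
    {s : Q.Op 0 1} {t : Q.Op 0 0} (R : BVRelations Q s t) : DGOperadHom (bvResolution O) Q where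
  app :=
    { toFun := Quot.lift (bvTermValue f s t) fun _ _ h => bvTermValue_eq L f hf R h
      map_add' := fun x y => by
        induction x using BVOp.ind; induction y using BVOp.ind; rfl
      map_smul' := fun r x => by
        induction x using BVOp.ind; rfl }
  map_comp _ _ _ x y := by
    induction x using BVOp.ind; induction y using BVOp.ind; rfl
  map_act _ x := by induction x using BVOp.ind; rfl
  map_d _ x := by induction x using BVOp.ind; rfl

/-- A property of operations of `BV O` which is satisfied by the generators and inherited by
results of operations holds everywhere. -/
theorem bv_induction {C : ∀ {n : ℕ} {a : ZMod 2}, (bvResolution O).Op n a → Prop}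
    (of : ∀ {n : ℕ} {a : ZMod 2} (x : O.Op n a), C ((bvOf O).app x))
    (s : C (bvS O)) (t : C (bvT O)) (zero : ∀ {n : ℕ} {a : ZMod 2}, C (0 : (bvResolution O).Op n a))
    (add : ∀ {n : ℕ} {a : ZMod 2} (x y : (bvResolution O).Op n a), C x → C y → C (x + y))
    (smul : ∀ {n : ℕ} {a : ZMod 2} (r : k) (x : (bvResolution O).Op n a), C x → C (r • x))
    (comp : ∀ {m n l : ℕ} {a b c : ZMod 2} (i : Fin (m + 1)) (h : m + n = l) (hg : a + b = c)
      (x : (bvResolution O).Op m a) (y : (bvResolution O).Op n b), C x → C y →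
        C ((bvResolution O).comp i h hg x y))
    (act : ∀ {n : ℕ} {a : ZMod 2} (σ : Equiv.Perm (Fin (n + 1))) (x : (bvResolution O).Op n a),
      C x → C ((bvResolution O).act σ x))
    (d : ∀ {n : ℕ} {a b : ZMod 2} (h : a + 1 = b) (x : (bvResolution O).Op n a),
      C x → C ((bvResolution O).d h x))
    {n : ℕ} {a : ZMod 2} (x : (bvResolution O).Op n a) : C x := by
  induction x using BVOp.ind with
  | h x =>
    induction x with
    | of x => exact of x
    | s => exact s
    | t => exact t
    | zero => exact zero
    | add x y hx hy => exact add _ _ hx hy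
    | smul r x hx => exact smul r _ hx
    | comp i h hg x y hx hy => exact comp i h hg _ _ hx hy
    | act σ x hx => exact act σ _ hx
    | d h x hx => exact d h _ hx

/-- The composition of maps of dg operads. -/
def DGOperadHom.trans {P : DGOperadData.{u, v} k} {Q : DGOperadData.{u, w} k}
    {R : DGOperadData k} (f : DGOperadHom P Q) (g : DGOperadHom Q R) : DGOperadHom P R where
  app := g.app ∘ₗ f.app
  map_comp i h hg x y := by
    simp only [LinearMap.comp_apply, f.map_comp, g.map_comp]
  map_act σ x := by simp only [LinearMap.comp_apply, f.map_act, g.map_act]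
  map_d h x := by simp only [LinearMap.comp_apply, f.map_d, g.map_d]

end Universal

/-! ### Conjugation by an invertible operation with one input -/

namespace DGOperadData

variable {k : Type u} [Field k] {P : DGOperadData.{u, v} k}

/-- The grafting of an even operation with one input onto a leaf. -/
def graft (J : P.Op 0 0) {n : ℕ} {a : ZMod 2} (i : Fin (n + 1)) : Module.End k (P.Op n a) :=
  (P.comp i (Nat.add_zero n) (add_zero a)).flip J

theorem graft_apply (J : P.Op 0 0) {n : ℕ} {a : ZMod 2} (i : Fin (n + 1)) (x : P.Op n a) :
    graft J i x = P.comp i (Nat.add_zero n) (add_zero a) x J := rfl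

/-- The grafting of an even operation with one input onto the leaves in a list. -/
def graftList (J : P.Op 0 0) {n : ℕ} {a : ZMod 2} (s : List (Fin (n + 1))) :
    Module.End k (P.Op n a) :=
  (s.map (graft J)).prod

theorem graftList_nil (J : P.Op 0 0) {n : ℕ} {a : ZMod 2} (x : P.Op n a) :
    graftList J [] x = x := rfl

theorem graftList_cons (J : P.Op 0 0) {n : ℕ} {a : ZMod 2} (i : Fin (n + 1))
    (s : List (Fin (n + 1))) (x : P.Op n a) :
    graftList J (i :: s) x = graft J i (graftList J s x) := by
  rw [graftList, List.map_cons, List.prod_cons]; rfl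

theorem graftList_append (J : P.Op 0 0) {n : ℕ} {a : ZMod 2}
    (s s' : List (Fin (n + 1))) (x : P.Op n a) :
    graftList J (s ++ s') x = graftList J s (graftList J s' x) := by
  rw [graftList, List.map_append, List.prod_append]; rfl

/-- The grafting of an even operation with one input onto all leaves. -/
def graftAll (J : P.Op 0 0) {n : ℕ} {a : ZMod 2} : Module.End k (P.Op n a) :=
  graftList J (List.finRange (n + 1))

theorem app_graftList {Q : DGOperadData.{u, w} k} (f : DGOperadHom P Q) (J : P.Op 0 0) {n : ℕ}
    {a : ZMod 2} (s : List (Fin (n + 1))) (x : P.Op n a) :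
    f.app (graftList J s x) = graftList (f.app J) s (f.app x) := by
  induction s with
  | nil => rfl
  | cons i s ih => rw [graftList_cons, graftList_cons, ← ih]; exact f.map_comp ..

section Laws

variable (L : P.IsDGOperad)
include L

/-- As J is even, grafts onto distinct leaves commute without sign. The leaves of a composite may
therefore be listed tree by tree. -/
theorem graftList_perm (J : P.Op 0 0) {n : ℕ} {a : ZMod 2} {s s' : List (Fin (n + 1))}
    (h : s.Perm s') : (graftList J s : Module.End k (P.Op n a)) = graftList J s' := by
  refine (h.map _).prod_eq' (List.pairwise_map.mpr (List.pairwise_of_forall fun i j => ?_))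
  by_cases hij : j = i
  · subst hij; exact Commute.refl _
  · refine LinearMap.ext fun x => ?_
    have := L.isGradedOperad.comp_unary_comm j i (fun e => hij e.symm) (add_zero a) (add_zero a)
      (add_zero a) (add_zero a) x J J
    rw [ksign_zero_left, one_smul] at this
    exact this

theorem graftList_leafIn (J : P.Op 0 0) {m n l : ℕ} {a b c : ZMod 2} (i : Fin (m + 1))
    (h : m + n = l) (hg : a + b = c) (x : P.Op m a) (y : P.Op n b) (s : List (Fin (n + 1))) :
    graftList J (s.map (leafIn i h)) (P.comp i h hg x y) =
      P.comp i h hg x (graftList J s y) := by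
  induction s with
  | nil => rfl
  | cons q s ih =>
    rw [List.map_cons, graftList_cons, ih, graftList_cons]
    exact L.isGradedOperad.comp_leafIn i q h hg (add_zero c) (add_zero b) hg x _ J

theorem graftList_leafOut (J : P.Op 0 0) {m n l : ℕ} {a b c : ZMod 2} (i : Fin (m + 1))
    (h : m + n = l) (hg : a + b = c) (x : P.Op m a) (y : P.Op n b) (s : List (Fin (m + 1)))
    (hs : ∀ p ∈ s, p ≠ i) :
    graftList J (s.map (leafOut i h)) (P.comp i h hg x y) =
      P.comp i h hg (graftList J s x) y := by
  induction s with
  | nil => rfl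
  | cons p s ih =>
    rw [List.map_cons, graftList_cons, ih fun p hp => hs p (List.mem_cons_of_mem _ hp),
      graftList_cons, graft_apply,
      L.isGradedOperad.comp_leafOut i p (hs p List.mem_cons_self) h hg (add_zero c) (add_zero a)
        hg, ksign_zero_right, one_smul]
    rfl

/-- The leaves of the composite are those of y together with those of x other than i. The missing J
at leaf i is what conjugation has to supply. -/
theorem graftAll_comp (J : P.Op 0 0) {m n l : ℕ} {a b c : ZMod 2} (i : Fin (m + 1))
    (h : m + n = l) (hg : a + b = c) (x : P.Op m a) (y : P.Op n b) :
    graftAll J (P.comp i h hg x y) =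
      P.comp i h hg (graftList J ((List.finRange (m + 1)).erase i) x) (graftAll J y) := by
  have hne : ∀ p ∈ (List.finRange (m + 1)).erase i, p ≠ i := fun p hp =>
    ((List.nodup_finRange _).mem_erase_iff.mp hp).1
  have hp : (List.finRange (l + 1)).Perm
      (((List.finRange (m + 1)).erase i).map (leafOut i h) ++
        (List.finRange (n + 1)).map (leafIn i h)) := by
    refine (List.perm_ext_iff_of_nodup (List.nodup_finRange _) ?_).mpr fun j => ?_
    · refine List.Nodup.append (((List.nodup_finRange _).erase i).map (leafOut_injective i h))
        ((List.nodup_finRange _).map (leafIn_injective i h)) fun j hj hj' => ?_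
      obtain ⟨p, hp, rfl⟩ := List.mem_map.mp hj
      obtain ⟨q, _, hq⟩ := List.mem_map.mp hj'
      exact leafIn_ne_leafOut i h q p (hne p hp) hq
    · refine ⟨fun _ => ?_, fun _ => List.mem_finRange _⟩
      rcases leaf_cases i h j with ⟨q, rfl⟩ | ⟨p, hp, rfl⟩
      · exact List.mem_append_right _ (List.mem_map_of_mem (List.mem_finRange q))
      · exact List.mem_append_left _ (List.mem_map_of_mem
          ((List.nodup_finRange _).mem_erase_iff.mpr ⟨hp, List.mem_finRange p⟩))
  rw [graftAll, graftList_perm L J hp, graftList_append, graftList_leafIn L,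
    graftList_leafOut L J i h hg _ _ _ hne]
  rfl

theorem graftAll_eq (J : P.Op 0 0) {n : ℕ} {a : ZMod 2} (i : Fin (n + 1)) (x : P.Op n a) :
    graftAll J x = graft J i (graftList J ((List.finRange (n + 1)).erase i) x) := by
  rw [graftAll, graftList_perm L J (List.perm_cons_erase (List.mem_finRange i)), graftList_cons]

theorem graftAll_act (J : P.Op 0 0) {n : ℕ} {a : ZMod 2} (σ : Equiv.Perm (Fin (n + 1)))
    (x : P.Op n a) : graftAll J (P.act σ x) = P.act σ (graftAll J x) := by
  have h : ∀ s : List (Fin (n + 1)),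
      graftList J (s.map σ) (P.act σ x) = P.act σ (graftList J s x) := by
    intro s
    induction s with
    | nil => rfl
    | cons i s ih =>
      rw [List.map_cons, graftList_cons, ih, graftList_cons]
      exact L.isGradedOperad.act_comp_unary i (add_zero a) σ _ J
  have hp : (List.finRange (n + 1)).Perm ((List.finRange (n + 1)).map σ) :=
    (List.perm_ext_iff_of_nodup (List.nodup_finRange _)
      ((List.nodup_finRange _).map σ.injective)).mpr fun j =>
      ⟨fun _ => List.mem_map.mpr ⟨σ.symm j, List.mem_finRange _, σ.apply_symm_apply j⟩,
        fun _ => List.mem_finRange _⟩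
  exact (LinearMap.congr_fun (graftList_perm L J hp) (P.act σ x)).trans (h _)

theorem d_graftAll {J : P.Op 0 0} (hJ : P.d (zero_add 1) J = 0) {n : ℕ} {a b : ZMod 2}
    (h : a + 1 = b) (x : P.Op n a) : P.d h (graftAll J x) = graftAll J (P.d h x) := by
  rw [graftAll, graftAll]
  generalize List.finRange (n + 1) = s
  induction s with
  | nil => rfl
  | cons i s ih =>
    rw [graftList_cons, graftList_cons, ← ih, graft_apply,
      L.d_comp i (Nat.add_zero n) (add_zero a) h (zero_add 1) h (add_zero b) h, hJ, map_zero,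
      smul_zero, add_zero]
    rfl

/-- Conjugation by an even closed operation `J` with inverse `J'`. -/
def conj {J J' : P.Op 0 0} (hJ : P.d (zero_add 1) J = 0) (hJ' : P.d (zero_add 1) J' = 0)
    (hJJ' : P.comp 0 (Nat.zero_add 0) (zero_add 0) J J' = P.one) : DGOperadHom P P where
  app {n a} := P.comp 0 (Nat.zero_add n) (zero_add a) J' ∘ₗ graftAll J
  map_comp {m n l a b c} i h hg x y := by
    simp only [LinearMap.comp_apply]
    set Y := graftAll J y with hY
    set X := graftList J ((List.finRange (m + 1)).erase i) x with hX
    rw [graftAll_comp L, graftAll_eq L J i x, ← hX, ← hY, graft_apply,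
      L.isGradedOperad.unary_comp i h hg (zero_add c) (zero_add a) hg]
    -- In the composite of the two conjugates, the J on leaf i of x meets the J' at the root of y.
    -- They cancel by J J' = 1, which leaves the conjugate of the composite.
    have e₁ := L.assoc_seq i 0 (Nat.add_zero m) h (Nat.zero_add n) h (add_zero a) hg
      (zero_add b) hg (P.comp 0 (Nat.zero_add m) (zero_add a) J' X) J
      (P.comp 0 (Nat.zero_add n) (zero_add b) J' Y)
    have e₂ := L.isGradedOperad.unary_comp 0 (Nat.zero_add n) (zero_add b) (zero_add b)
      (zero_add 0) (zero_add b) J J' Y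
    have e₃ := L.isGradedOperad.unary_comp i (Nat.add_zero m) (add_zero a) (zero_add a)
      (zero_add a) (add_zero a) J' X J
    rw [leafIn_add_zero] at e₁
    rw [e₃, e₁, e₂, hJJ', L.one_comp]
  map_act {n a} σ x := by
    simp only [LinearMap.comp_apply, graftAll_act L]
    exact L.isGradedOperad.unary_comp_act (zero_add a) σ J' _
  map_d {n a b} h x := by
    simp only [LinearMap.comp_apply, ← d_graftAll L hJ]
    rw [L.d_comp 0 (Nat.zero_add n) (zero_add a) (zero_add 1) h h (by rw [add_comm, h])
      (zero_add b), hJ', map_zero, LinearMap.zero_apply, ksign_zero_right, one_smul]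
    exact (zero_add (P.comp 0 (Nat.zero_add n) (zero_add b) J' _)).symm

theorem conj_isUnital {J J' : P.Op 0 0} (hJ : P.d (zero_add 1) J = 0)
    (hJ' : P.d (zero_add 1) J' = 0)
    (hJJ' : P.comp 0 (Nat.zero_add 0) (zero_add 0) J J' = P.one)
    (hJ'J : P.comp 0 (Nat.zero_add 0) (zero_add 0) J' J = P.one) :
    (conj L hJ hJ' hJJ').IsUnital := by
  change P.comp 0 (Nat.zero_add 0) (zero_add 0) J' (P.comp 0 (Nat.add_zero 0) (add_zero 0)
    P.one J) = P.one
  exact (congrArg (P.comp 0 (Nat.zero_add 0) (zero_add 0) J') (L.one_comp J)).trans hJ'J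

end Laws

end DGOperadData

/-! ### Maps of dg vector spaces and operations -/

namespace DGSpace

variable {k : Type u} [Field k]

/-- Maps of dg vector spaces. -/
structure Map (V V' : DGSpace.{u, v} k) where
  toLinear : V.carrier →ₗ[k] V'.carrier
  map_deg : ∀ a x, x ∈ V.deg a → toLinear x ∈ V'.deg a
  map_d : ∀ x, toLinear (V.d x) = V'.d (toLinear x)

variable {V V' : DGSpace.{u, v} k}

instance : CoeFun (Map V V') fun _ => V.carrier → V'.carrier := ⟨fun f => f.toLinear⟩

theorem Map.map_twist (A : Map V V') (b : ZMod 2) (x : V.carrier) :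
    A (V.twist b x) = V'.twist b (A x) := by
  have : A.toLinear ∘ₗ V.twist b = V'.twist b ∘ₗ A.toLinear := by
    ext x
    rw [← V.proj_sum x, map_sum, map_sum]
    refine Finset.sum_congr rfl fun a _ => ?_
    have h := V.proj_mem a x
    rw [LinearMap.comp_apply, LinearMap.comp_apply, V.twist_of_mem h,
      V'.twist_of_mem (A.map_deg a _ h), map_smul]
  exact LinearMap.congr_fun this x

theorem value_act_of_mem {n : ℕ} {g : ZMod 2} (σ : Equiv.Perm (Fin (n + 1)))
    (f : V.endOperad.Op n g) (a : Fin (n + 1) → ZMod 2) (x : Fin (n + 1) → V.carrier)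
    (hx : ∀ j, x j ∈ V.deg (a j)) : V.value x (V.endOperad.act σ f) =
      ksign k 1 (reorderExp σ a) • V.value (fun p => x (σ p)) f :=
  act_apply_of_mem σ f a x hx

/-- A preserves parity and hence commutes with the Koszul twists, so only the slot filled by the
inner operation needs a hypothesis. -/
theorem map_signedArg (A : Map V V') {m n l : ℕ} (b : ZMod 2) (i : Fin (m + 1)) (h : m + n = l)
    (g : V.Multi n) (g' : V'.Multi n) (x : Fin (l + 1) → V.carrier)
    (hg : A (g fun q => x (leafIn i h q)) = g' fun q => A (x (leafIn i h q))) :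
    (fun p => A (signedArg b i h g x p)) = signedArg b i h g' fun j => A (x j) := by
  funext p
  simp only [signedArg]
  split
  · exact A.map_twist b _
  · split
    · exact hg
    · rfl

theorem map_dArg (A : Map V V') {n : ℕ} (p : Fin (n + 1)) (x : Fin (n + 1) → V.carrier) :
    (fun q => A ((if q < p then V.twist 1 else if q = p then V.d else LinearMap.id) (x q))) =
      fun q => (if q < p then V'.twist 1 else if q = p then V'.d else LinearMap.id) (A (x q)) := by
  funext q
  split
  · exact A.map_twist 1 _
  · split
    · exact A.map_d _
    · rfl

/-! ### Intertwined operations, and transfer of operations along a pair of maps -/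

/-- An operation `F` on `V` and an operation `f` on `V'` are compatible with a map `A : V → V'`. -/
def Compatible (A : Map V V') {n : ℕ} {a : ZMod 2} (F : V.endOperad.Op n a)
    (f : V'.endOperad.Op n a) : Prop :=
  ∀ x, A (V.value x F) = V'.value (fun j => A (x j)) f

theorem Compatible.comp {A : Map V V'} {m n l : ℕ} {a b c : ZMod 2} (i : Fin (m + 1))
    (h : m + n = l) (hg : a + b = c) {F : V.endOperad.Op m a} {f : V'.endOperad.Op m a}
    {G : V.endOperad.Op n b} {g : V'.endOperad.Op n b} (hF : Compatible A F f)
    (hG : Compatible A G g) :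
    Compatible A (V.endOperad.comp i h hg F G) (V'.endOperad.comp i h hg f g) := fun x => by
  rw [value_comp, value_comp, hF, map_signedArg A b i h _ (g : V'.endOp n b).1 x (hG _)]

theorem Compatible.act {A : Map V V'} {n : ℕ} {a : ZMod 2} (σ : Equiv.Perm (Fin (n + 1)))
    {F : V.endOperad.Op n a} {f : V'.endOperad.Op n a} (hF : Compatible A F f) :
    Compatible A (V.endOperad.act σ F) (V'.endOperad.act σ f) := by
  have : A.toLinear.compMultilinearMap (V.endOperad.act σ F : V.endOp n a).1 =
      ((V'.endOperad.act σ f : V'.endOp n a).1).compLinearMap fun _ => A.toLinear :=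
    multi_ext fun e x hx => by
      have h₁ := value_act_of_mem σ F e x hx
      have h₂ := value_act_of_mem σ f e (fun j => A (x j)) fun j => A.map_deg _ _ (hx j)
      rw [← hF] at h₂
      exact ((congrArg A.toLinear h₁).trans (map_smul _ _ _)).trans h₂.symm
  exact fun x => congrArg (fun φ => φ x) this

theorem Compatible.d {A : Map V V'} {n : ℕ} {a b : ZMod 2} (h : a + 1 = b)
    {F : V.endOperad.Op n a} {f : V'.endOperad.Op n a} (hF : Compatible A F f) :
    Compatible A (V.endOperad.d h F) (V'.endOperad.d h f) := fun x => by
  rw [value_d, value_d, map_sub, map_smul, map_sum, A.map_d, hF]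
  congr 2
  exact Finset.sum_congr rfl fun p _ => by rw [hF, map_dArg]

/-- The transfer `f ↦ B ∘ f ∘ (A, …, A)` of operations. -/
def transfer (A : Map V' V) (B : Map V V') (n : ℕ) (a : ZMod 2) :
    V.endOperad.Op n a →ₗ[k] V'.endOperad.Op n a where
  toFun f := ⟨B.toLinear.compMultilinearMap
      ((f : V.endOp n a).1.compLinearMap fun _ => A.toLinear),
    fun e _ hx => B.map_deg _ _ ((f : V.endOp n a).2 e _ fun j => A.map_deg _ _ (hx j))⟩
  map_add' _ _ := Subtype.ext <| MultilinearMap.ext fun _ => B.toLinear.map_add _ _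
  map_smul' _ _ := Subtype.ext <| MultilinearMap.ext fun _ => B.toLinear.map_smul _ _

theorem value_transfer (A : Map V' V) (B : Map V V') {n : ℕ} {a : ZMod 2}
    (f : V.endOperad.Op n a) (x : Fin (n + 1) → V'.carrier) :
    V'.value x (transfer A B n a f) = B (V.value (fun j => A (x j)) f) := rfl

/-- The composite of two transfers has A B inserted on the inner edge. Keeping g' separate from g
serves two purposes: g' = g when A B = 1 (extension to the thickening), and g' = A B g when A B is
only an idempotent (restriction to a summand). -/
theorem transfer_comp (A : Map V' V) (B : Map V V') {m n l : ℕ} {a b c : ZMod 2}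
    (i : Fin (m + 1)) (h : m + n = l) (hg : a + b = c) (f : V.endOperad.Op m a)
    (g g' : V.endOperad.Op n b)
    (hgg' : ∀ x : Fin (n + 1) → V'.carrier, A (B (V.value (fun j => A (x j)) g)) =
      V.value (fun j => A (x j)) g') :
    transfer A B l c (V.endOperad.comp i h hg f g') =
      V'.endOperad.comp i h hg (transfer A B m a f) (transfer A B n b g) :=
  op_ext fun x => by
    rw [value_transfer, value_comp, value_comp, value_transfer,
      map_signedArg A b i h _ (g' : V.endOp n b).1 x (hgg' _)]

theorem transfer_act (A : Map V' V) (B : Map V V') {n : ℕ} {a : ZMod 2}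
    (σ : Equiv.Perm (Fin (n + 1))) (f : V.endOperad.Op n a) :
    transfer A B n a (V.endOperad.act σ f) = V'.endOperad.act σ (transfer A B n a f) :=
  Subtype.ext <| multi_ext fun e x hx => by
    have h₁ := value_act_of_mem σ f e (fun j => A (x j)) fun j => A.map_deg _ _ (hx j)
    have h₂ := value_act_of_mem σ (transfer A B n a f) e x hx
    exact ((congrArg B.toLinear h₁).trans (map_smul _ _ _)).trans h₂.symm

theorem transfer_d (A : Map V' V) (B : Map V V') {n : ℕ} {a b : ZMod 2} (h : a + 1 = b)
    (f : V.endOperad.Op n a) :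
    transfer A B n b (V.endOperad.d h f) = V'.endOperad.d h (transfer A B n a f) :=
  op_ext fun x => by
    rw [value_transfer, value_d, value_d, map_sub, map_smul, map_sum, B.map_d, value_transfer]
    congr 2
    exact Finset.sum_congr rfl fun p _ => by rw [value_transfer, map_dArg]

theorem value_graftAll {φ : V.carrier →ₗ[k] V.carrier}
    (hφ : ∀ a x, x ∈ V.deg a → φ x ∈ V.deg (a + 0)) {n : ℕ} {a : ZMod 2}
    (f : V.endOperad.Op n a) (x : Fin (n + 1) → V.carrier) :
    V.value x (DGOperadData.graftAll (V.unary φ hφ) f) = V.value (fun j => φ (x j)) f := by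
  -- Without repetitions each leaf receives φ once, and since φ is even the twists on earlier
  -- arguments are trivial.
  have key : ∀ s : List (Fin (n + 1)), s.Nodup → ∀ x : Fin (n + 1) → V.carrier,
      V.value x (DGOperadData.graftList (V.unary φ hφ) s f) =
        V.value (fun j => if j ∈ s then φ (x j) else x j) f := by
    intro s
    induction s with
    | nil => intro _ x; simp [DGOperadData.graftList_nil]
    | cons i s ih =>
      intro hs x
      rw [DGOperadData.graftList_cons, DGOperadData.graft_apply, value_comp_unary, ih hs.of_cons]
      refine congrArg (fun y => V.value y f) (funext fun j => ?_)
      have hi : i ∉ s := (List.nodup_cons.mp hs).1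
      by_cases hj : j = i
      · subst hj; simp [hi]
      · simp [hj, twist_zero]
  refine (key _ (List.nodup_finRange _) x).trans ?_
  simp

theorem value_conj {φ φ' : V.carrier →ₗ[k] V.carrier}
    (hφ : ∀ a x, x ∈ V.deg a → φ x ∈ V.deg (a + 0))
    (hφ' : ∀ a x, x ∈ V.deg a → φ' x ∈ V.deg (a + 0)) {n : ℕ} {a : ZMod 2}
    (f : V.endOperad.Op n a) (x : Fin (n + 1) → V.carrier) :
    V.value x (V.endOperad.comp 0 (Nat.zero_add n) (zero_add a) (V.unary φ' hφ')
      (DGOperadData.graftAll (V.unary φ hφ) f)) = φ' (V.value (fun j => φ (x j)) f) := by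
  rw [value_unary_comp, value_graftAll]

/-! ### The sum of a dg vector space and a cone -/

section Thickening

variable (V)

/-- The summands of `V ⊕ V ⊕ V[1]`. -/
def thickDeg (a : ZMod 2) : Submodule k (V.carrier × V.carrier × V.carrier) :=
  (V.deg a).prod ((V.deg a).prod (V.deg (a + 1)))

/-- The projection of `V ⊕ V ⊕ V[1]` onto a summand. -/
noncomputable def thickProj (a : ZMod 2) :
    V.carrier × V.carrier × V.carrier →ₗ[k] V.thickDeg a :=
  ((V.proj a).prodMap ((V.proj a).prodMap (V.proj (a + 1)))).codRestrict (V.thickDeg a)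
    fun _ => ⟨V.proj_mem _ _, V.proj_mem _ _, V.proj_mem _ _⟩

theorem thickProj_of_mem {a : ZMod 2} (x : V.thickDeg a) (b : ZMod 2) (h : b ≠ a) :
    V.thickProj b x = 0 := by
  obtain ⟨⟨x, u, w⟩, hx, hu, hw⟩ := x
  have h' : b + 1 ≠ a + 1 := fun e => h (add_right_cancel e)
  refine Subtype.ext (Prod.ext ?_ (Prod.ext ?_ ?_))
  · exact (V.proj_of_mem hx b).trans (if_neg h)
  · exact (V.proj_of_mem hu b).trans (if_neg h)
  · exact (V.proj_of_mem hw (b + 1)).trans (if_neg h')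

theorem thickProj_self {a : ZMod 2} (x : V.thickDeg a) : V.thickProj a x = x := by
  obtain ⟨⟨x, u, w⟩, hx, hu, hw⟩ := x
  refine Subtype.ext (Prod.ext ?_ (Prod.ext ?_ ?_))
  · exact (V.proj_of_mem hx a).trans (if_pos rfl)
  · exact (V.proj_of_mem hu a).trans (if_pos rfl)
  · exact (V.proj_of_mem hw (a + 1)).trans (if_pos rfl)

open DirectSum in
noncomputable instance thickDecomposition : DirectSum.Decomposition V.thickDeg :=
  DirectSum.Decomposition.ofLinearMap V.thickDeg
    (∑ a : ZMod 2, DirectSum.lof k (ZMod 2) (fun a => V.thickDeg a) a ∘ₗ V.thickProj a)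
    (LinearMap.ext fun x => by
      simp only [LinearMap.comp_apply, LinearMap.sum_apply, map_sum, DirectSum.coeLinearMap_lof,
        LinearMap.id_apply]
      refine Prod.ext ?_ (Prod.ext ?_ ?_)
      · simp only [Prod.fst_sum]
        exact V.proj_sum _
      · simp only [Prod.fst_sum, Prod.snd_sum]
        exact V.proj_sum _
      · simp only [Prod.snd_sum]
        -- The third summand has shifted parity, so its sum of projections is reindexed by a ↦ a +
        -- 1.
        refine Eq.trans ?_ (V.proj_sum x.2.2)
        exact Equiv.sum_comp (Equiv.addRight (1 : ZMod 2)) fun a => V.proj a x.2.2)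
    (DirectSum.linearMap_ext _ fun a => LinearMap.ext fun x => by
      simp only [LinearMap.comp_apply, LinearMap.sum_apply, DirectSum.coeLinearMap_lof,
        LinearMap.id_apply]
      rw [Finset.sum_eq_single a, thickProj_self]
      · intro b _ hb
        rw [V.thickProj_of_mem x b hb, map_zero]
      · simp)

/-- The differential `(x, u, w) ↦ (d x, d u + w, -d w)` of `V ⊕ V ⊕ V[1]`. -/
def thickDiff : V.carrier × V.carrier × V.carrier →ₗ[k] V.carrier × V.carrier × V.carrier where
  toFun x := (V.d x.1, V.d x.2.1 + x.2.2, -V.d x.2.2)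
  map_add' x y := by
    refine Prod.ext (map_add _ _ _) (Prod.ext ?_ ?_)
    · simp only [Prod.snd_add, Prod.fst_add, map_add]; abel
    · simp only [Prod.snd_add, map_add]; abel
  map_smul' r x := by
    refine Prod.ext (map_smul _ _ _) (Prod.ext ?_ ?_)
    · simp
    · simp

/-- The sum `V ⊕ V ⊕ V[1]` of `V` and the cone of its identity, with
`d (x, u, w) = (d x, d u + w, -d w)`. -/
noncomputable def thick : DGSpace.{u, v} k where
  carrier := V.carrier × V.carrier × V.carrier
  deg := V.thickDeg
  d := V.thickDiff
  d_mem a x hx := ⟨V.d_mem _ _ hx.1, Submodule.add_mem _ (V.d_mem _ _ hx.2.1) hx.2.2,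
    Submodule.neg_mem _ (V.d_mem _ _ hx.2.2)⟩
  d_d x := by
    refine Prod.ext (V.d_d _) (Prod.ext ?_ ?_)
    · simp [thickDiff, V.d_d]
    · simp [thickDiff, V.d_d]

theorem thick_d (x u w : V.carrier) : V.thick.d (x, u, w) = (V.d x, V.d u + w, -V.d w) := rfl

/-- The inclusion of the first summand. -/
noncomputable def thickIn : Map V V.thick where
  toLinear := LinearMap.inl k V.carrier (V.carrier × V.carrier)
  map_deg _ _ hx := ⟨hx, Submodule.zero_mem _, Submodule.zero_mem _⟩
  map_d x := by
    change ((V.d x, 0, 0) : V.carrier × V.carrier × V.carrier) = V.thick.d (x, 0, 0)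
    rw [thick_d]; simp

/-- The projection onto the first summand. -/
noncomputable def thickPr : Map V.thick V where
  toLinear := LinearMap.fst k V.carrier (V.carrier × V.carrier)
  map_deg _ _ hx := hx.1
  map_d _ := rfl

theorem thickPr_thickIn (x : V.carrier) : V.thickPr (V.thickIn x) = x := rfl

end Thickening

end DGSpace

/-! ### Admissible operads acting through a summand -/

section Admissible

variable {k : Type u} [Field k] {O : DGOperad.{u, v} k}

/-- Reduces statements about operations of arity one, of either parity, to multiples of the unit; in
odd parity there is only zero. -/
theorem DGOperad.IsAdmissible.unary_cases (hO : O.IsAdmissible)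
    {C : ∀ {a : ZMod 2}, O.Op 0 a → Prop} (hzero : C (0 : O.Op 0 1))
    (hone : ∀ c : k, C (c • O.one)) {a : ZMod 2} (x : O.Op 0 a) : C x := by
  rcases zmod_two_cases a with rfl | rfl
  · obtain ⟨c, rfl⟩ := hO.arity_one_even x
    exact hone c
  · rw [hO.arity_one_odd x]
    exact hzero

/-- Transfer along a proper summand would send the unit to a projection, so arity one needs its own
map. A functional equal to 1 on the unit makes even unary operations act by scalars. -/
theorem DGOperad.IsAdmissible.exists_unary (hO : O.IsAdmissible) (Q : DGOperadData.{u, w} k) :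
    ∃ φ : ∀ a : ZMod 2, O.Op 0 a →ₗ[k] Q.Op 0 a, φ 0 O.one = Q.one := by
  obtain ⟨ε, hε⟩ := Module.Projective.exists_dual_eq_one k hO.one_ne_zero
  refine ⟨fun a => if h : a = 0 then
    Q.castParity h.symm ∘ₗ LinearMap.toSpanSingleton k _ Q.one ∘ₗ ε ∘ₗ O.castParity h else 0, ?_⟩
  simp only [dif_pos]
  change ε O.one • Q.one = Q.one
  rw [hε, one_smul]

end Admissible

namespace DGSpace

variable {k : Type u} [Field k] {O : DGOperad.{u, v} k} {V W : DGSpace.{u, w} k}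

/-- The operations of `O` with at least two inputs act on `W` through a summand `V`, and those with
one input act by scalars. -/
noncomputable def extendApp (f : DGOperadHom O.toDGOperadData V.endOperad) (A : Map W V)
    (B : Map V W)
    (φ : ∀ a : ZMod 2, O.Op 0 a →ₗ[k] W.endOperad.Op 0 a) :
    ∀ (n : ℕ) (a : ZMod 2), O.Op n a →ₗ[k] W.endOperad.Op n a
  | 0, a => φ a
  | n + 1, a => transfer A B (n + 1) a ∘ₗ f.app

/-- The `O`-algebra structure on `W` given by one on a summand `V`. -/
noncomputable def extendHom (hO : O.IsAdmissible) (f : DGOperadHom O.toDGOperadData V.endOperad)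
    (A : Map W V) (B : Map V W) (hAB : ∀ x, A (B x) = x)
    (φ : ∀ a : ZMod 2, O.Op 0 a →ₗ[k] W.endOperad.Op 0 a) (hφ : φ 0 O.one = W.endOperad.one) :
    DGOperadHom O.toDGOperadData W.endOperad where
  app {n a} := extendApp f A B φ n a
  map_comp {m n l a b c} i h hg x y := by
    have L := O.laws
    have LW := W.endOperad_isDGOperad
    -- If either factor is unary it is zero or a multiple of the unit, and the unit laws suffice.
    -- Otherwise both factors and the result have arity ≥ 2, and transfer is multiplicative since A
    -- B = 1.
    rcases m with _ | m
    · obtain rfl : n = l := by omega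
      obtain rfl : i = 0 := Fin.ext (by omega)
      revert hg
      refine hO.unary_cases (C := fun {a} x => ∀ hg : a + b = c,
        extendApp f A B φ n c (O.comp 0 h hg x y) = W.endOperad.comp 0 h hg
          (extendApp f A B φ 0 a x) (extendApp f A B φ n b y)) ?_ ?_ x
      · intro hg
        simp only [map_zero, LinearMap.zero_apply]
      · intro r hg
        obtain rfl : b = c := by rw [← hg, zero_add]
        simp only [map_smul, LinearMap.smul_apply]
        rw [L.one_comp, show extendApp f A B φ 0 0 O.one = W.endOperad.one from hφ, LW.one_comp]
    rcases n with _ | n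
    · obtain rfl : m + 1 = l := by omega
      revert hg
      refine hO.unary_cases (C := fun {b} y => ∀ hg : a + b = c,
        extendApp f A B φ (m + 1) c (O.comp i h hg x y) = W.endOperad.comp i h hg
          (extendApp f A B φ (m + 1) a x) (extendApp f A B φ 0 b y)) ?_ ?_ y
      · intro hg
        simp only [map_zero]
      · intro r hg
        obtain rfl : a = c := by rw [← hg, add_zero]
        simp only [map_smul]
        rw [L.comp_one, show extendApp f A B φ 0 0 O.one = W.endOperad.one from hφ, LW.comp_one]
    · obtain ⟨l, rfl⟩ : ∃ l', l = l' + 1 := ⟨l - 1, by omega⟩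
      change transfer A B (l + 1) c (f.app (O.comp i h hg x y)) = _
      rw [f.map_comp]
      exact transfer_comp A B i h hg _ _ _ fun x => by rw [hAB]
  map_act {n a} σ x := by
    rcases n with _ | n
    · obtain rfl : σ = 1 := Equiv.ext fun j => Fin.ext (by omega)
      rw [O.laws.act_one, W.endOperad_isDGOperad.act_one]
    · change transfer A B (n + 1) a (f.app (O.act σ x)) = _
      rw [f.map_act]
      exact transfer_act A B σ _
  map_d {n a b} h x := by
    rcases n with _ | n
    · refine hO.unary_cases (C := fun {a} x => ∀ h : a + 1 = b,
        extendApp f A B φ 0 b (O.d h x) = W.endOperad.d h (extendApp f A B φ 0 a x)) ?_ ?_ x h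
      · intro h; simp only [map_zero]
      · intro r h
        simp only [map_smul]
        rw [show extendApp f A B φ 0 0 O.one = W.endOperad.one from hφ, O.laws.d_one,
          W.endOperad_isDGOperad.d_one, map_zero]
    · change transfer A B (n + 1) b (f.app (O.d h x)) = _
      rw [f.map_d]
      exact transfer_d A B h _

end DGSpace

/-! ### Shears -/

namespace DGOperadData

variable {k : Type u} [Field k] {P : DGOperadData.{u, v} k}

section Shear

variable (L : P.IsDGOperad) {η : P.Op 0 0} (hη : P.d (zero_add 1) η = 0)
  (hηη : P.comp 0 (Nat.zero_add 0) (zero_add 0) η η = 0)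
include L

theorem one_comp_unary (x : P.Op 0 0) : P.comp 0 (Nat.zero_add 0) (zero_add 0) P.one x = x :=
  L.one_comp x

theorem comp_one_unary (x : P.Op 0 0) : P.comp 0 (Nat.zero_add 0) (zero_add 0) x P.one = x :=
  L.comp_one 0 x

include hηη in
theorem one_add_comp_one_sub :
    P.comp 0 (Nat.zero_add 0) (zero_add 0) (P.one + η) (P.one - η) = P.one := by
  simp only [map_add, map_sub, LinearMap.add_apply, one_comp_unary L, comp_one_unary L, hηη]
  abel

include hηη in
theorem one_sub_comp_one_add :
    P.comp 0 (Nat.zero_add 0) (zero_add 0) (P.one - η) (P.one + η) = P.one := by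
  simp only [map_add, map_sub, LinearMap.sub_apply, one_comp_unary L, comp_one_unary L, hηη]
  abel

include hη in
theorem d_one_add : P.d (zero_add 1) (P.one + η) = 0 := by
  rw [map_add, L.d_one, hη, add_zero]

include hη in
theorem d_one_sub : P.d (zero_add 1) (P.one - η) = 0 := by
  rw [map_sub, L.d_one, hη, sub_zero]

/-- Conjugation by `1 + η` for a closed even operation `η` with `η² = 0`. -/
def shear : DGOperadHom P P :=
  conj L (d_one_add L hη) (d_one_sub L hη) (one_add_comp_one_sub L hηη)

theorem shear_isUnital : (shear L hη hηη).IsUnital :=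
  conj_isUnital L _ _ _ (one_sub_comp_one_add L hηη)

end Shear

/-- The differential of an odd operation `τ` with `e τ = τ` and `τ e = 0` for some closed `e`
has square zero. -/
theorem d_comp_d_eq_zero (L : P.IsDGOperad) {e : P.Op 0 0} {τ : P.Op 0 1}
    (he : P.d (zero_add 1) e = 0)
    (heτ : P.comp 0 (Nat.zero_add 0) (zero_add 1) e τ = τ)
    (hτe : P.comp 0 (Nat.zero_add 0) (add_zero 1) τ e = 0) (h : (1 : ZMod 2) + 1 = 0) :
    P.comp 0 (Nat.zero_add 0) (zero_add 0) (P.d h τ) (P.d h τ) = 0 := by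
  have e₁ : P.comp 0 (Nat.zero_add 0) (zero_add 0) e (P.d h τ) = P.d h τ := by
    have := L.d_comp 0 (Nat.zero_add 0) (zero_add 1) (zero_add 1) h h h (zero_add 0) e τ
    rw [heτ, he, map_zero, LinearMap.zero_apply, zero_add, ksign_zero_right, one_smul] at this
    exact this.symm
  have e₂ : P.comp 0 (Nat.zero_add 0) (zero_add 0) (P.d h τ) e = 0 := by
    have := L.d_comp 0 (Nat.zero_add 0) (add_zero 1) h (zero_add 1) h (zero_add 0) h τ e
    rw [hτe, he, map_zero, map_zero, smul_zero, add_zero] at this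
    exact this.symm
  -- With e dτ = dτ and dτ e = 0, the square is dτ (e dτ) = (dτ e) dτ = 0.
  have e₃ := L.isGradedOperad.unary_comp 0 (Nat.zero_add 0) (zero_add 0) (zero_add 0)
    (zero_add 0) (zero_add 0) (P.d h τ) e (P.d h τ)
  rw [e₁] at e₃
  refine e₃.trans ?_
  have e₄ : P.comp 0 (Nat.zero_add 0) (zero_add 0) (P.comp 0 (Nat.zero_add 0) (zero_add 0)
      (P.d h τ) e) (P.d h τ) = 0 := by rw [e₂, map_zero, LinearMap.zero_apply]
  exact e₄

end DGOperadData

theorem BVRelations.map {k : Type u} [Field k] {P : DGOperadData.{u, v} k}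
    {Q : DGOperadData.{u, w} k} (f : DGOperadHom P Q) (hf : f.IsUnital) {s : P.Op 0 1}
    {t : P.Op 0 0} (R : BVRelations P s t) : BVRelations Q (f.app s) (f.app t) where
  s_s := by rw [← f.map_comp, R.s_s, map_zero]
  t_t := by rw [← f.map_comp, R.t_t]
  s_t := by rw [← f.map_comp, R.s_t, map_zero]
  t_s := by rw [← f.map_comp, R.t_s, map_zero]
  d_s := by rw [← f.map_d, R.d_s, map_sub, show f.app P.one = Q.one from hf]
  d_t := by rw [← f.map_d, R.d_t, map_zero]

namespace DGSpace

variable {k : Type u} [Field k] (V : DGSpace.{u, v} k)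

theorem value_unary {g : ZMod 2} {φ : V.carrier →ₗ[k] V.carrier}
    (hφ : ∀ a x, x ∈ V.deg a → φ x ∈ V.deg (a + g)) (x : Fin 1 → V.carrier) :
    V.value x (V.unary φ hφ) = φ (x 0) := rfl

theorem value_one (x : Fin 1 → V.carrier) : V.value x V.endOperad.one = x 0 := rfl

theorem value_d_unary {g b : ZMod 2} {φ : V.carrier →ₗ[k] V.carrier}
    (hφ : ∀ a x, x ∈ V.deg a → φ x ∈ V.deg (a + g)) (h : g + 1 = b) (x : Fin 1 → V.carrier) :
    V.value x (V.endOperad.d h (V.unary φ hφ)) = V.d (φ (x 0)) - ksign k 1 g • φ (V.d (x 0)) := by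
  rw [value_d, Fin.sum_univ_one]
  rfl

/-! ### Operators on the thickening -/

theorem thickTLinear_mem (a : ZMod 2) (x : V.thick.carrier) (hx : x ∈ V.thick.deg a) :
    (V.thickIn.toLinear ∘ₗ V.thickPr.toLinear) x ∈ V.thick.deg (a + 0) := by
  rw [add_zero]; exact V.thickIn.map_deg _ _ (V.thickPr.map_deg _ _ hx)

/-- The operator `(x, u, w) ↦ (x, 0, 0)`. -/
noncomputable def thickT : V.thick.endOperad.Op 0 0 :=
  V.thick.unary (V.thickIn.toLinear ∘ₗ V.thickPr.toLinear) V.thickTLinear_mem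

/-- The linear operator `(x, u, w) ↦ (0, 0, u)`. -/
def thickSLinear : V.thick.carrier →ₗ[k] V.thick.carrier where
  toFun x := (0, 0, x.2.1)
  map_add' _ _ := Prod.ext (add_zero _).symm (Prod.ext (add_zero _).symm rfl)
  map_smul' _ _ := Prod.ext (smul_zero _).symm (Prod.ext (smul_zero _).symm rfl)

theorem thickSLinear_mem (a : ZMod 2) (x : V.thick.carrier) (hx : x ∈ V.thick.deg a) :
    V.thickSLinear x ∈ V.thick.deg (a + 1) :=
  ⟨Submodule.zero_mem _, Submodule.zero_mem _, by
    rw [add_assoc, show (1 : ZMod 2) + 1 = 0 from rfl, add_zero]; exact hx.2.1⟩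

/-- The operator `(x, u, w) ↦ (0, 0, u)`. -/
noncomputable def thickS : V.thick.endOperad.Op 0 1 := V.thick.unary V.thickSLinear
  V.thickSLinear_mem

/-- The linear operator `(x, u, w) ↦ (0, x, 0)`. -/
def thickShiftLinear : V.thick.carrier →ₗ[k] V.thick.carrier where
  toFun x := (0, x.1, 0)
  map_add' _ _ := Prod.ext (add_zero _).symm (Prod.ext rfl (add_zero _).symm)
  map_smul' _ _ := Prod.ext (smul_zero _).symm (Prod.ext rfl (smul_zero _).symm)

theorem thickShiftLinear_mem (a : ZMod 2) (x : V.thick.carrier) (hx : x ∈ V.thick.deg a) :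
    V.thickShiftLinear x ∈ V.thick.deg (a + 0) :=
  ⟨Submodule.zero_mem _, by rw [add_zero]; exact hx.1, Submodule.zero_mem _⟩

/-- The operator `(x, u, w) ↦ (0, x, 0)`. -/
noncomputable def thickShift : V.thick.endOperad.Op 0 0 := V.thick.unary V.thickShiftLinear
  V.thickShiftLinear_mem

/-- The linear operator `(x, u, w) ↦ (S u, 0, 0)`. -/
def thickHomotopyLinear (S : V.carrier →ₗ[k] V.carrier) :
    V.thick.carrier →ₗ[k] V.thick.carrier where
  toFun x := (S x.2.1, 0, 0)
  map_add' _ _ := Prod.ext (map_add S _ _) (Prod.ext (add_zero _).symm (add_zero _).symm)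
  map_smul' _ _ := Prod.ext (map_smul S _ _) (Prod.ext (smul_zero _).symm (smul_zero _).symm)

theorem thickHomotopyLinear_mem {S : V.carrier →ₗ[k] V.carrier}
    (hS : ∀ a x, x ∈ V.deg a → S x ∈ V.deg (a + 1)) (a : ZMod 2) (x : V.thick.carrier)
    (hx : x ∈ V.thick.deg a) : V.thickHomotopyLinear S x ∈ V.thick.deg (a + 1) :=
  ⟨hS _ _ hx.2.1, Submodule.zero_mem _, Submodule.zero_mem _⟩

/-- The operator `(x, u, w) ↦ (S u, 0, 0)` for an odd operator `S`. -/
noncomputable def thickHomotopy (S : V.carrier →ₗ[k] V.carrier)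
    (hS : ∀ a x, x ∈ V.deg a → S x ∈ V.deg (a + 1)) : V.thick.endOperad.Op 0 1 :=
  V.thick.unary (V.thickHomotopyLinear S) (V.thickHomotopyLinear_mem hS)

theorem thick_ext {x y : V.thick.carrier} (h₁ : x.1 = y.1) (h₂ : x.2.1 = y.2.1)
    (h₃ : x.2.2 = y.2.2) : x = y := Prod.ext h₁ (Prod.ext h₂ h₃)

/-- `thickS` contracts the cone and vanishes on the first summand, so its boundary is the projection
away from that summand. Neither operator depends on a Hodge decomposition of V. -/
theorem thick_bvRelations : BVRelations V.thick.endOperad V.thickS V.thickT where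
  s_s := op_ext fun _ => value_unary_comp _ _ _ _ _
  t_t := op_ext fun _ => value_unary_comp _ _ _ _ _
  s_t := op_ext fun _ => value_unary_comp _ _ _ _ _
  t_s := op_ext fun _ => value_unary_comp _ _ _ _ _
  d_s := op_ext fun x => by
    refine (value_d_unary V.thick V.thickSLinear_mem _ x).trans ?_
    rw [ksign_one_one, map_sub, value_one, thickT, value_unary, neg_smul,
      one_smul, sub_neg_eq_add]
    obtain ⟨x, u, w⟩ := x 0
    refine V.thick_ext ?_ ?_ ?_
    · change V.d 0 + 0 = x - x
      rw [map_zero, add_zero, sub_self]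
    · change V.d 0 + u + 0 = u - 0
      rw [map_zero, zero_add, add_zero, sub_zero]
    · change -V.d u + (V.d u + w) = w - 0
      rw [neg_add_cancel_left, sub_zero]
  d_t := op_ext fun x => by
    refine (value_d_unary V.thick V.thickTLinear_mem _ x).trans ?_
    rw [ksign_zero_right, one_smul, map_zero]
    change V.thick.d (V.thickIn (V.thickPr (x 0))) - V.thickIn (V.thickPr (V.thick.d (x 0))) = 0
    rw [V.thickPr.map_d, V.thickIn.map_d, sub_self]

theorem d_thickShift : V.thick.endOperad.d (zero_add 1) V.thickShift = 0 := op_ext fun x => by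
  refine (value_d_unary V.thick V.thickShiftLinear_mem _ x).trans ?_
  rw [ksign_zero_right, one_smul, map_zero]
  obtain ⟨x, u, w⟩ := x 0
  refine V.thick_ext ?_ ?_ ?_
  · change V.d 0 - 0 = 0
    rw [map_zero, sub_zero]
  · change V.d x + 0 - V.d x = 0
    rw [add_zero, sub_self]
  · change -V.d 0 - 0 = 0
    rw [map_zero, neg_zero, sub_zero]

theorem thickShift_comp_self :
    V.thick.endOperad.comp 0 (Nat.zero_add 0) (zero_add 0) V.thickShift V.thickShift = 0 :=
  op_ext fun _ => value_unary_comp _ _ _ _ _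

section Homotopy

variable {S : V.carrier →ₗ[k] V.carrier} (hS : ∀ a x, x ∈ V.deg a → S x ∈ V.deg (a + 1))

/-- Values lie in the first summand, and the next lemma says that this summand is killed. These are
the hypotheses of `d_comp_d_eq_zero`, which makes the boundary square to zero for an arbitrary odd
S. -/
theorem thickT_comp_thickHomotopy :
    V.thick.endOperad.comp 0 (Nat.zero_add 0) (zero_add 1) V.thickT (V.thickHomotopy S hS) =
      V.thickHomotopy S hS :=
  op_ext fun _ => value_unary_comp _ _ _ _ _

theorem thickHomotopy_comp_thickT :
    V.thick.endOperad.comp 0 (Nat.zero_add 0) (add_zero 1) (V.thickHomotopy S hS) V.thickT = 0 :=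
  op_ext fun x => by
    refine (value_unary_comp _ _ _ _ _).trans ?_
    exact Prod.ext (map_zero S) rfl

/-- The linear operator `(x, u, w) ↦ ((d S + S d) u + S w, 0, 0)`. -/
def thickBoundary (S : V.carrier →ₗ[k] V.carrier) : V.thick.carrier →ₗ[k] V.thick.carrier where
  toFun x := (V.d (S x.2.1) + S (V.d x.2.1) + S x.2.2, 0, 0)
  map_add' x y := by
    refine Prod.ext ?_ (Prod.ext (add_zero _).symm (add_zero _).symm)
    change V.d (S (x.2.1 + y.2.1)) + S (V.d (x.2.1 + y.2.1)) + S (x.2.2 + y.2.2) =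
      (V.d (S x.2.1) + S (V.d x.2.1) + S x.2.2) + (V.d (S y.2.1) + S (V.d y.2.1) + S y.2.2)
    simp only [map_add]
    abel
  map_smul' r x := by
    refine Prod.ext ?_ (Prod.ext (smul_zero _).symm (smul_zero _).symm)
    change V.d (S (r • x.2.1)) + S (V.d (r • x.2.1)) + S (r • x.2.2) =
      r • (V.d (S x.2.1) + S (V.d x.2.1) + S x.2.2)
    simp only [map_smul, smul_add]

/-- The term S w comes from the component w in the differential of (u, w). For a Hodge decomposition
the value in the first summand is u - T u + S w. -/
theorem value_d_thickHomotopy (h : (1 : ZMod 2) + 1 = 0) (x : Fin 1 → V.thick.carrier) :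
    V.thick.value x (V.thick.endOperad.d h (V.thickHomotopy S hS)) = V.thickBoundary S (x 0) := by
  refine (value_d_unary V.thick (V.thickHomotopyLinear_mem hS) _ x).trans ?_
  rw [ksign_one_one, neg_smul, one_smul, sub_neg_eq_add]
  obtain ⟨x, u, w⟩ := x 0
  refine V.thick_ext ?_ ?_ ?_
  · change V.d (S u) + S (V.d u + w) = V.d (S u) + S (V.d u) + S w
    rw [map_add, add_assoc]
  · change V.d 0 + 0 + 0 = 0
    rw [map_zero, add_zero, add_zero]
  · change -V.d 0 + 0 = 0
    rw [map_zero, neg_zero, add_zero]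

end Homotopy

end DGSpace

/-! ### Transfer with polynomial coefficients -/

namespace DGSpace

open Polynomial

variable {k : Type u} [Field k] {V W : DGSpace.{u, w} k} (A : Map V W) (B : Map W V)

theorem Map.comp_mem (A : Map V W) (B : Map W V) (a : ZMod 2) (x : W.carrier)
    (hx : x ∈ W.deg a) : (A.toLinear ∘ₗ B.toLinear) x ∈ W.deg (a + 0) := by
  rw [add_zero]; exact A.map_deg _ _ (B.map_deg _ _ hx)

/-- The operator `A ∘ B` as an operation. -/
noncomputable def roundTrip (A : Map V W) (B : Map W V) : W.endOperad.Op 0 0 :=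
  W.unary (A.toLinear ∘ₗ B.toLinear) (A.comp_mem B)

/-- Transfer to a summand is not multiplicative in general. It is so once A B has been inserted on
the inner edge, which costs nothing for operations whose values are fixed by A B. -/
theorem transfer_comp_roundTrip {m n l : ℕ} {a b c : ZMod 2}
    (i : Fin (m + 1)) (h : m + n = l) (hg : a + b = c) (f : W.endOperad.Op m a)
    (g : W.endOperad.Op n b) :
    transfer A B l c (W.endOperad.comp i h hg f
        (W.endOperad.comp 0 (Nat.zero_add n) (zero_add b) (roundTrip A B) g)) =
      V.endOperad.comp i h hg (transfer A B m a f) (transfer A B n b g) :=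
  transfer_comp A B i h hg f g _ fun _ => (W.value_unary_comp (A.comp_mem B) _ g _).symm

theorem rTensor_transfer_comp {m n l : ℕ} {a b c : ZMod 2}
    (i : Fin (m + 1)) (h : m + n = l) (hg : a + b = c) (x : W.endOperad.Op m a ⊗[k] k[X])
    (y : W.endOperad.Op n b ⊗[k] k[X]) :
    (transfer A B l c).rTensor k[X] (W.endOperad.polyComp i h hg x
        (W.endOperad.polyComp 0 (Nat.zero_add n) (zero_add b) (roundTrip A B ⊗ₜ 1) y)) =
      V.endOperad.polyComp i h hg ((transfer A B m a).rTensor k[X] x)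
        ((transfer A B n b).rTensor k[X] y) := by
  induction x using TensorProduct.induction_on with
  | zero => simp only [map_zero, LinearMap.zero_apply]
  | add x x' hx hx' => simp only [map_add, LinearMap.add_apply, hx, hx']
  | tmul x p =>
    induction y using TensorProduct.induction_on with
    | zero => simp only [map_zero]
    | add y y' hy hy' => simp only [map_add, hy, hy']
    | tmul y q =>
      rw [DGOperadData.polyComp_tmul, DGOperadData.polyComp_tmul, LinearMap.rTensor_tmul,
        LinearMap.rTensor_tmul, LinearMap.rTensor_tmul, DGOperadData.polyComp_tmul,
        transfer_comp_roundTrip, one_mul]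

theorem rTensor_transfer_act {n : ℕ} {a : ZMod 2} (σ : Equiv.Perm (Fin (n + 1)))
    (x : W.endOperad.Op n a ⊗[k] k[X]) :
    (transfer A B n a).rTensor k[X] ((W.endOperad.act σ).rTensor k[X] x) =
      (V.endOperad.act σ).rTensor k[X] ((transfer A B n a).rTensor k[X] x) := by
  rw [← LinearMap.rTensor_comp_apply, ← LinearMap.rTensor_comp_apply]
  congr 2
  exact LinearMap.ext fun f => transfer_act A B σ f

theorem rTensor_transfer_d {n : ℕ} {a b : ZMod 2} (h : a + 1 = b)
    (x : W.endOperad.Op n a ⊗[k] k[X]) :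
    (transfer A B n b).rTensor k[X] ((W.endOperad.d h).rTensor k[X] x) =
      (V.endOperad.d h).rTensor k[X] ((transfer A B n a).rTensor k[X] x) := by
  rw [← LinearMap.rTensor_comp_apply, ← LinearMap.rTensor_comp_apply]
  congr 2
  exact LinearMap.ext fun f => transfer_d A B h f

theorem rTensor_transfer_polyDeriv {n : ℕ} {a b : ZMod 2} (h : a = b)
    (x : W.endOperad.Op n a ⊗[k] k[X]) :
    (transfer A B n b).rTensor k[X] (W.endOperad.polyDeriv h x) =
      V.endOperad.polyDeriv h ((transfer A B n a).rTensor k[X] x) := by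
  subst h
  induction x using TensorProduct.induction_on with
  | zero => simp only [map_zero]
  | add x x' hx hx' => simp only [map_add, hx, hx']
  | tmul x p =>
    rw [DGOperadData.polyDeriv_tmul, LinearMap.rTensor_tmul, LinearMap.rTensor_tmul,
      DGOperadData.polyDeriv_tmul]

/-- The transfer of operations with coefficients in `k[z, dz]`. -/
noncomputable def drTransfer (n : ℕ) (a : ZMod 2) :
    W.endOperad.tensorDeRham.Op n a →ₗ[k] V.endOperad.tensorDeRham.Op n a :=
  LinearMap.prodMap ((transfer A B n a).rTensor k[X]) ((transfer A B n (a + 1)).rTensor k[X])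

theorem drFst_drTransfer {n : ℕ} {a : ZMod 2} (x : W.endOperad.tensorDeRham.Op n a) :
    V.endOperad.drFst n a (drTransfer A B n a x) =
      (transfer A B n a).rTensor k[X] (W.endOperad.drFst n a x) := rfl

theorem drSnd_drTransfer {n : ℕ} {a : ZMod 2} (x : W.endOperad.tensorDeRham.Op n a) :
    V.endOperad.drSnd n a (drTransfer A B n a x) =
      (transfer A B n (a + 1)).rTensor k[X] (W.endOperad.drSnd n a x) := rfl

theorem drTransfer_comp {m n l : ℕ} {a b c : ZMod 2} (i : Fin (m + 1)) (h : m + n = l)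
    (hg : a + b = c) (x : W.endOperad.tensorDeRham.Op m a)
    (y : W.endOperad.tensorDeRham.Op n b) :
    drTransfer A B l c (W.endOperad.tensorDeRham.comp i h hg x
        (W.endOperad.tensorDeRham.comp 0 (Nat.zero_add n) (zero_add b)
          (W.endOperad.constHom.app (roundTrip A B)) y)) =
      V.endOperad.tensorDeRham.comp i h hg (drTransfer A B m a x) (drTransfer A B n b y) := by
  have e₁ : W.endOperad.drSnd n b (W.endOperad.tensorDeRham.comp 0 (Nat.zero_add n) (zero_add b)
      (W.endOperad.constHom.app (roundTrip A B)) y) =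
      W.endOperad.polyComp 0 (Nat.zero_add n) (zero_add (b + 1)) (roundTrip A B ⊗ₜ 1)
        (W.endOperad.drSnd n b y) := by
    rw [DGOperadData.drSnd_comp, DGOperadData.constHom_app, DGOperadData.drFst_mk,
      DGOperadData.drSnd_mk, map_zero, LinearMap.zero_apply, smul_zero, add_zero]
  refine DGOperadData.dr_ext ?_ ?_
  · rw [drFst_drTransfer, DGOperadData.drFst_comp, DGOperadData.drFst_comp,
      DGOperadData.drFst_comp, DGOperadData.constHom_app, DGOperadData.drFst_mk,
      rTensor_transfer_comp]
    rfl
  · rw [drSnd_drTransfer, DGOperadData.drSnd_comp, e₁, DGOperadData.drFst_comp,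
      DGOperadData.drSnd_comp, DGOperadData.constHom_app, DGOperadData.drFst_mk, map_add,
      map_smul, rTensor_transfer_comp, rTensor_transfer_comp]
    rfl

theorem drTransfer_act {n : ℕ} {a : ZMod 2} (σ : Equiv.Perm (Fin (n + 1)))
    (x : W.endOperad.tensorDeRham.Op n a) :
    drTransfer A B n a (W.endOperad.tensorDeRham.act σ x) =
      V.endOperad.tensorDeRham.act σ (drTransfer A B n a x) :=
  DGOperadData.dr_ext (rTensor_transfer_act A B σ _) (rTensor_transfer_act A B σ _)

theorem drTransfer_d {n : ℕ} {a b : ZMod 2} (h : a + 1 = b)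
    (x : W.endOperad.tensorDeRham.Op n a) :
    drTransfer A B n b (W.endOperad.tensorDeRham.d h x) =
      V.endOperad.tensorDeRham.d h (drTransfer A B n a x) := by
  refine DGOperadData.dr_ext (rTensor_transfer_d A B h _) ?_
  rw [drSnd_drTransfer, DGOperadData.drSnd_d, DGOperadData.drSnd_d, map_add, map_smul,
    rTensor_transfer_polyDeriv, rTensor_transfer_d, drFst_drTransfer, drSnd_drTransfer]

theorem drTransfer_constHom {n : ℕ} {a : ZMod 2} (x : W.endOperad.Op n a) :
    drTransfer A B n a (W.endOperad.constHom.app x) =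
      V.endOperad.constHom.app (transfer A B n a x) := by
  refine DGOperadData.dr_ext ?_ (map_zero ((transfer A B n (a + 1)).rTensor k[X]))
  rw [drFst_drTransfer, DGOperadData.constHom_app, DGOperadData.constHom_app,
    DGOperadData.drFst_mk, DGOperadData.drFst_mk, LinearMap.rTensor_tmul]

theorem evalHom_drTransfer (c : k) {n : ℕ} {a : ZMod 2}
    (x : W.endOperad.tensorDeRham.Op n a) :
    (V.endOperad.evalHom c).app (drTransfer A B n a x) =
      transfer A B n a ((W.endOperad.evalHom c).app x) := by
  rw [DGOperadData.evalHom_app, DGOperadData.evalHom_app, drFst_drTransfer]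
  generalize W.endOperad.drFst n a x = x
  induction x using TensorProduct.induction_on with
  | zero => simp only [map_zero]
  | add x x' hx hx' => simp only [map_add, hx, hx']
  | tmul x p =>
    rw [LinearMap.rTensor_tmul, DGOperadData.polyEval_tmul, DGOperadData.polyEval_tmul, map_smul]

variable {A B}

/-- A family of `BV O`-algebra structures on `W` for which `t` is the projection onto a summand `V`
restricts to a family of `bv O`-algebra structures on `V`. -/
noncomputable def restrictHom {O : DGOperadData.{u, v} k}
    (Φ : DGOperadHom (bvResolution O) W.endOperad.tensorDeRham)
    (hΦ : Φ.app (bvT O) = W.endOperad.constHom.app (roundTrip A B)) :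
    DGOperadHom (bvTruncation O) V.endOperad.tensorDeRham where
  app {n a} := drTransfer A B n a ∘ₗ Φ.app ∘ₗ (bvInclusion O).app
  map_comp i h hg x y := by
    -- Membership in the truncation says t ∘ y = y. As t acts by A B, this inserts the idempotent
    -- that `drTransfer_comp` requires.
    have e := congrArg Φ.app y.2.1
    rw [Φ.map_comp, hΦ] at e
    simp only [LinearMap.comp_apply, (bvInclusion O).map_comp, Φ.map_comp]
    rw [← drTransfer_comp]
    exact congrArg (fun z => drTransfer A B _ _ (W.endOperad.tensorDeRham.comp i h hg _ z)) e.symm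
  map_act σ x := by
    simp only [LinearMap.comp_apply, (bvInclusion O).map_act, Φ.map_act, drTransfer_act]
  map_d h x := by
    simp only [LinearMap.comp_apply, (bvInclusion O).map_d, Φ.map_d, drTransfer_d]

theorem constHom_isUnital (V : DGSpace.{u, w} k) : V.endOperad.constHom.IsUnital := rfl

theorem restrictHom_isUnital {O : DGOperadData.{u, v} k}
    (Φ : DGOperadHom (bvResolution O) W.endOperad.tensorDeRham)
    (hΦ : Φ.app (bvT O) = W.endOperad.constHom.app (roundTrip A B)) (hBA : ∀ x, B (A x) = x) :
    (restrictHom Φ hΦ).IsUnital := by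
  -- The unit of `bv O` is t, which acts on W by A B. Its transfer is B A B A, the identity by B A =
  -- 1.
  change drTransfer A B 0 0 (Φ.app (bvT O)) = _
  rw [hΦ, drTransfer_constHom, ← constHom_isUnital]
  refine congrArg V.endOperad.constHom.app (op_ext fun x => ?_)
  rw [value_transfer, roundTrip, value_unary, value_one]
  exact (congrArg B.toLinear (congrArg A.toLinear (hBA _))).trans (hBA _)

/-! ### Values of sheared operations -/

/-- A unital map carries a shear to conjugation by the image of 1 + η. With g an evaluation, a shear
over k[z, dz] becomes conjugation by an explicit operator at each end. -/
theorem value_app_shear {P : DGOperadData.{u, v} k} (L : P.IsDGOperad) {η : P.Op 0 0}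
    (hη : P.d (zero_add 1) η = 0) (hηη : P.comp 0 (Nat.zero_add 0) (zero_add 0) η η = 0)
    (g : DGOperadHom P V.endOperad) (hg : g.IsUnital) (φ : V.carrier →ₗ[k] V.carrier)
    (hφ : ∀ a x, x ∈ V.deg a → φ x ∈ V.deg (a + 0)) (hgη : ∀ x, V.value x (g.app η) = φ (x 0))
    {n : ℕ} {a : ZMod 2} (x : P.Op n a) (z : Fin (n + 1) → V.carrier) :
    V.value z (g.app ((DGOperadData.shear L hη hηη).app x)) =
      V.value (fun j => z j + φ (z j)) (g.app x) -
        φ (V.value (fun j => z j + φ (z j)) (g.app x)) := by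
  set I : V.carrier →ₗ[k] V.carrier := LinearMap.id with hI
  have hid : ∀ a x, x ∈ V.deg a → I x ∈ V.deg (a + 0) :=
    fun a x hx => by rw [add_zero]; exact hx
  have hp : ∀ a x, x ∈ V.deg a → (I + φ) x ∈ V.deg (a + 0) :=
    fun a x hx => Submodule.add_mem _ (hid a x hx) (hφ a x hx)
  have hm : ∀ a x, x ∈ V.deg a → (I - φ) x ∈ V.deg (a + 0) :=
    fun a x hx => Submodule.sub_mem _ (hid a x hx) (hφ a x hx)
  have e₁ : g.app (P.one + η) = V.unary (I + φ) hp := op_ext fun x => by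
    rw [map_add, map_add, hgη, show g.app P.one = V.endOperad.one from hg]; rfl
  have e₂ : g.app (P.one - η) = V.unary (I - φ) hm := op_ext fun x => by
    rw [map_sub, map_sub, hgη, show g.app P.one = V.endOperad.one from hg]; rfl
  have e₃ : g.app ((DGOperadData.shear L hη hηη).app x) = V.endOperad.comp 0 (Nat.zero_add n)
      (zero_add a) (V.unary (I - φ) hm) (DGOperadData.graftAll (V.unary (I + φ) hp) (g.app x)) := by
    rw [← e₁, ← e₂, DGOperadData.graftAll, ← DGOperadData.app_graftList, ← g.map_comp]
    rfl
  rw [e₃, value_conj]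
  rfl

end DGSpace

/-! ### The retraction of the thickening given by a Hodge decomposition -/

namespace HodgeDecomposition

open DGSpace

variable {k : Type u} [Field k] {V : DGSpace.{u, w} k} (H : HodgeDecomposition V)

/-- The map `(x, u, w) ↦ T x - (u - T u) - S w`. -/
noncomputable def retract : Map V.thick V where
  toLinear :=
    { toFun := fun x => H.t x.1 - (x.2.1 - H.t x.2.1) - H.s x.2.2
      map_add' := fun x y => by
        change H.t (x.1 + y.1) - (x.2.1 + y.2.1 - H.t (x.2.1 + y.2.1)) - H.s (x.2.2 + y.2.2) = _
        simp only [map_add]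
        abel
      map_smul' := fun r x => by
        change H.t (r • x.1) - (r • x.2.1 - H.t (r • x.2.1)) - H.s (r • x.2.2) = _
        simp only [map_smul, smul_sub, RingHom.id_apply] }
  map_deg a x hx := by
    have ht := H.t_even a
    have hs := H.s_odd (a + 1)
    rw [add_assoc, show (1 : ZMod 2) + 1 = 0 from rfl, add_zero] at hs
    rw [add_zero] at ht
    exact Submodule.sub_mem _ (Submodule.sub_mem _ (ht _ hx.1)
      (Submodule.sub_mem _ hx.2.1 (ht _ hx.2.1))) (hs _ hx.2.2)
  map_d x := by
    change H.t (V.d x.1) - (V.d x.2.1 + x.2.2 - H.t (V.d x.2.1 + x.2.2)) - H.s (-V.d x.2.2) =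
      V.d (H.t x.1 - (x.2.1 - H.t x.2.1) - H.s x.2.2)
    have h := H.homotopy x.2.2
    simp only [map_sub, map_add, map_neg, H.d_t]
    -- The Hodge relation, applied to w, replaces d S w by w - T w - S d w. The new terms account
    -- for the component w in the differential of the cone.
    rw [eq_sub_of_add_eq h]
    abel

theorem retract_apply (x : V.thick.carrier) :
    H.retract x = H.t x.1 - (x.2.1 - H.t x.2.1) - H.s x.2.2 := rfl

/-- The section `y ↦ (T y, -y, 0)` of the retraction. -/
def lift (y : V.carrier) : V.thick.carrier := (H.t y, -y, 0)

theorem retract_lift (y : V.carrier) : H.retract (H.lift y) = y := by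
  rw [retract_apply]
  change H.t (H.t y) - (-y - H.t (-y)) - H.s 0 = y
  rw [H.t_t, map_neg, map_zero]
  abel

/-- The elements whose first component is harmonic. -/
def harmonic : Submodule k V.thick.carrier where
  carrier := {x | H.t x.1 = x.1}
  zero_mem' := map_zero H.t
  add_mem' := fun {x y} hx hy => (map_add H.t x.1 y.1).trans (congrArg₂ (· + ·) hx hy)
  smul_mem' := fun r x hx => (map_smul H.t r x.1).trans (congrArg (r • ·) hx)

theorem lift_mem_harmonic (y : V.carrier) : H.lift y ∈ H.harmonic := H.t_t y

theorem d_mem_harmonic {x : V.thick.carrier} (hx : x ∈ H.harmonic) :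
    V.thick.d x ∈ H.harmonic :=
  (H.d_t x.1).symm.trans (congrArg V.d hx)

/-! ### Comparison of a structure on the thickening with the one given by a Hodge decomposition -/

section Comparison

variable {O : DGOperad.{u, v} k} (hO : O.IsAdmissible)
  {f : DGOperadHom O.toDGOperadData V.endOperad}
  {h : DGOperadHom (bvResolution O.toDGOperadData) V.endOperad}
  (hh : H.Determines f h) {Ψ : DGOperadHom (bvResolution O.toDGOperadData) V.thick.endOperad}
  (hΨ : Ψ.app (bvResolution O.toDGOperadData).one = V.thick.endOperad.one)
  (hs : Ψ.app (bvS O.toDGOperadData) = V.thickS) (ht : Ψ.app (bvT O.toDGOperadData) = V.thickT)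
  (hf : ∀ (n : ℕ) (a : ZMod 2) (x : O.Op (n + 1) a) (z : Fin (n + 1 + 1) → V.thick.carrier),
    V.thick.value z (Ψ.app ((bvOf O.toDGOperadData).app x)) =
      H.lift (V.value (fun j => H.retract (z j)) (f.app x)))
include hO hΨ hs ht hf

-- The retraction is a chain map, so compatibility passes through all dg operad operations and only
-- generators matter. For s both sides are -S u by S T = S² = 0; for t both are T x by T² = T and T
-- S = 0. For O in arity ≥ 2 it holds because `retract` is a left inverse of `lift`, and arity one
-- acts by scalars.
include hh in
theorem compatible_retract {n : ℕ} {a : ZMod 2} (x : (bvResolution O.toDGOperadData).Op n a) :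
    Compatible H.retract (Ψ.app x) (h.app x) := by
  induction x using bv_induction with
  | @of n a x =>
    rcases n with _ | n
    · refine hO.unary_cases (C := fun {a} x => Compatible H.retract
        (Ψ.app ((bvOf O.toDGOperadData).app x)) (h.app ((bvOf O.toDGOperadData).app x))) ?_ ?_ x
      · intro z; simp only [map_zero]
      · intro c z
        simp only [map_smul]
        rw [show (bvOf O.toDGOperadData).app O.one = (bvResolution O.toDGOperadData).one from rfl,
          hΨ, hh.isUnital]
        rfl
    · intro z
      rw [hf, retract_lift, hh.on_operad]
  | s =>
    intro z
    rw [hs, hh.on_s]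
    change H.t 0 - (0 - H.t 0) - H.s (z 0).2.1 =
      H.s (H.t (z 0).1 - ((z 0).2.1 - H.t (z 0).2.1) - H.s (z 0).2.2)
    simp only [map_sub, map_zero, H.s_t, H.s_s]
    abel
  | t =>
    intro z
    rw [ht, hh.on_t]
    change H.t (z 0).1 - (0 - H.t 0) - H.s 0 =
      H.t (H.t (z 0).1 - ((z 0).2.1 - H.t (z 0).2.1) - H.s (z 0).2.2)
    simp only [map_sub, map_zero, H.t_s, H.t_t]
    abel
  | zero => intro z; simp only [map_zero]
  | add x y hx hy => intro z; simp only [map_add, hx z, hy z]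
  | smul r x hx => intro z; simp only [map_smul, hx z]
  | comp i h' hg x y hx hy => rw [Ψ.map_comp, h.map_comp]; exact hx.comp i h' hg hy
  | act σ x hx => rw [Ψ.map_act, h.map_act]; exact hx.act σ
  | d h' x hx => rw [Ψ.map_d, h.map_d]; exact hx.d h'

/-- The first component of `lift` is always harmonic, so in arity ≥ 2 nothing is asked of the
inputs. Unary operations such as the unit only preserve harmonicity, hence the condition on inputs
when n = 0. -/
theorem value_mem_harmonic {n : ℕ} {a : ZMod 2} (x : (bvResolution O.toDGOperadData).Op n a) :
    ∀ z : Fin (n + 1) → V.thick.carrier, (n = 0 → ∀ j, z j ∈ H.harmonic) →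
      V.thick.value z (Ψ.app x) ∈ H.harmonic := by
  induction x using bv_induction with
  | @of n a x =>
    rcases n with _ | n
    · refine hO.unary_cases (C := fun {a} x => ∀ z : Fin (0 + 1) → V.thick.carrier,
        (0 = 0 → ∀ j, z j ∈ H.harmonic) →
          V.thick.value z (Ψ.app ((bvOf O.toDGOperadData).app x)) ∈ H.harmonic) ?_ ?_ x
      · intro z _; simp only [map_zero]; exact Submodule.zero_mem _
      · intro c z hz
        simp only [map_smul]
        rw [show (bvOf O.toDGOperadData).app O.one = (bvResolution O.toDGOperadData).one from rfl,
          hΨ]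
        exact Submodule.smul_mem _ _ (hz rfl 0)
    · intro z _
      rw [hf]
      exact H.lift_mem_harmonic _
  | s =>
    intro z _
    rw [hs]
    exact map_zero H.t
  | t =>
    intro z hz
    rw [ht]
    exact hz rfl 0
  | zero => intro z _; simp only [map_zero]; exact Submodule.zero_mem _
  | add x y hx hy =>
    intro z hz; simp only [map_add]; exact Submodule.add_mem _ (hx z hz) (hy z hz)
  | smul r x hx => intro z hz; simp only [map_smul]; exact Submodule.smul_mem _ _ (hx z hz)
  | @comp m n l a b c i h' hg x y hx hy =>
    intro z hz
    rw [Ψ.map_comp, value_comp]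
    -- The inputs of x matter only when x is unary. Its single input is then a value of y, harmonic
    -- by induction; if y is unary as well, so is the composite, and `hz` applies.
    refine hx _ fun hm j => ?_
    subst hm
    obtain rfl : j = i := Fin.ext (by omega)
    simp only [signedArg, lt_irrefl, if_true, if_false]
    exact hy _ fun hn q => hz (by omega) _
  | @act n a σ x hx =>
    intro z hz
    rw [Ψ.map_act]
    rcases n with _ | n
    · obtain rfl : σ = 1 := Equiv.ext fun j => Fin.ext (by omega)
      rw [V.thick.endOperad_isDGOperad.act_one]
      exact hx z hz
    · change (permute σ (Ψ.app x : V.thick.endOp (n + 1) a).1) z ∈ H.harmonic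
      simp only [permute, LinearMap.coe_mk, AddHom.coe_mk, _root_.sum_apply,
        _root_.smul_apply]
      exact Submodule.sum_mem _ fun e _ => Submodule.smul_mem _ _
        (hx _ fun hn => absurd hn n.succ_ne_zero)
  | @d n a b h' x hx =>
    intro z hz
    rw [Ψ.map_d, value_d]
    refine Submodule.sub_mem _ (H.d_mem_harmonic (hx z hz)) (Submodule.smul_mem _ _
      (Submodule.sum_mem _ fun p _ => hx _ fun hn q => ?_))
    subst hn
    obtain rfl : q = p := Fin.ext (by omega)
    simp only [lt_irrefl, if_true, if_false]
    exact H.d_mem_harmonic (hz rfl _)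

include hh in
/-- On operations of `bv O` with at least two inputs, the structure on the thickening restricts to
the given one on `V`. -/
theorem transfer_app_eq {n : ℕ} (hn : 1 ≤ n) {a : ZMod 2}
    (x : (bvTruncation O.toDGOperadData).Op n a) :
    transfer V.thickIn V.thickPr n a (Ψ.app ((bvInclusion O.toDGOperadData).app x)) =
      h.app ((bvInclusion O.toDGOperadData).app x) := op_ext fun z => by
  -- The two halves of truncation are used on different sides. Idempotence at the root puts values
  -- on W into the first summand; idempotence at the leaves lets arguments in V be replaced by their
  -- images under T.
  have e₁ : V.thick.endOperad.comp 0 (Nat.zero_add n) (zero_add a) V.thickT (Ψ.app x.1) =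
      Ψ.app x.1 := by
    rw [← ht, ← Ψ.map_comp]; exact congrArg Ψ.app x.2.1
  have e₂ : DGOperadData.graftAll (V.unary H.t H.t_even) (h.app x.1) = h.app x.1 := by
    rw [DGOperadData.graftAll]
    generalize List.finRange (n + 1) = s
    induction s with
    | nil => rfl
    | cons i s ih =>
      rw [DGOperadData.graftList_cons, ih, DGOperadData.graft_apply]
      have := congrArg h.app (x.2.2 i)
      rw [h.map_comp, hh.on_t] at this
      exact this
  -- This value has the form (y₁, 0, 0) with T y₁ = y₁, so `retract` returns y₁. By compatibility
  -- `retract` also returns the operation of V on the elements T z_j, which by truncation is its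
  -- value on the z_j.
  set y := V.thick.value (fun j => V.thickIn (z j)) (Ψ.app x.1) with hy
  have e₃ : V.thickIn (V.thickPr y) = y := by
    have := value_unary_comp V.thick V.thickTLinear_mem (zero_add a) (Ψ.app x.1)
      fun j => V.thickIn (z j)
    exact this.symm.trans (congrArg (V.thick.value _) e₁)
  have e₄ : y ∈ H.harmonic := H.value_mem_harmonic hO hΨ hs ht hf x.1 _ fun hn' => by omega
  have e₅ : H.retract y = V.value (fun j => H.retract (V.thickIn (z j))) (h.app x.1) :=
    H.compatible_retract hO hh hΨ hs ht hf x.1 _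
  have e₆ : ∀ v, H.retract (V.thickIn v) = H.t v := fun v => by
    rw [retract_apply]
    change H.t v - (0 - H.t 0) - H.s 0 = H.t v
    simp
  change V.thickPr y = V.value z (h.app x.1)
  rw [← e₂, value_graftAll]
  simp only [e₆] at e₅
  rw [← e₅, ← e₃, e₆]
  exact e₄.symm

end Comparison

end HodgeDecomposition

namespace DGOperadHom

variable {k : Type u} [Field k]

theorem IsUnital.trans {P : DGOperadData.{u, v} k} {Q : DGOperadData.{u, w} k}
    {R : DGOperadData k} {f : DGOperadHom P Q} {g : DGOperadHom Q R} (hf : f.IsUnital)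
    (hg : g.IsUnital) : (f.trans g).IsUnital :=
  (congrArg g.app hf).trans hg

end DGOperadHom

/-! ### The family of structures on the thickening -/

namespace HodgeDecomposition

open DGSpace Polynomial

variable {k : Type u} [Field k] {V : DGSpace.{u, w} k} (H₁ H₂ : HodgeDecomposition V)

/-- The segment between the operations `(x, u, w) ↦ (S u, 0, 0)` of two Hodge decompositions. -/
noncomputable def path : V.thick.endOperad.tensorDeRham.Op 0 1 :=
  DGOperadData.drMk (V.thickHomotopy H₁.s H₁.s_odd ⊗ₜ (1 - X) +
    V.thickHomotopy H₂.s H₂.s_odd ⊗ₜ X) 0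

theorem thickT_comp_path : V.thick.endOperad.tensorDeRham.comp 0 (Nat.zero_add 0) (zero_add 1)
    (V.thick.endOperad.constHom.app V.thickT) (path H₁ H₂) = path H₁ H₂ := by
  refine DGOperadData.dr_ext ?_ ?_
  · rw [DGOperadData.drFst_comp, DGOperadData.constHom_app, DGOperadData.drFst_mk, path,
      DGOperadData.drFst_mk, map_add, DGOperadData.polyComp_tmul, DGOperadData.polyComp_tmul,
      thickT_comp_thickHomotopy, thickT_comp_thickHomotopy, one_mul, one_mul]
  · rw [DGOperadData.drSnd_comp, DGOperadData.constHom_app, DGOperadData.drSnd_mk, path,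
      DGOperadData.drSnd_mk, map_zero, map_zero, LinearMap.zero_apply, smul_zero, add_zero]

theorem path_comp_thickT : V.thick.endOperad.tensorDeRham.comp 0 (Nat.zero_add 0) (add_zero 1)
    (path H₁ H₂) (V.thick.endOperad.constHom.app V.thickT) = 0 := by
  refine DGOperadData.dr_ext ?_ ?_
  · rw [DGOperadData.drFst_comp, DGOperadData.constHom_app, DGOperadData.drFst_mk, path,
      DGOperadData.drFst_mk, map_add, LinearMap.add_apply, DGOperadData.polyComp_tmul,
      DGOperadData.polyComp_tmul, thickHomotopy_comp_thickT, thickHomotopy_comp_thickT,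
      TensorProduct.zero_tmul, TensorProduct.zero_tmul, add_zero, map_zero]
  · rw [DGOperadData.drSnd_comp, DGOperadData.constHom_app, DGOperadData.drSnd_mk, path,
      DGOperadData.drSnd_mk, map_zero, map_zero, LinearMap.zero_apply, smul_zero, add_zero,
      map_zero]

/-- The boundary of the segment, with the opposite sign. -/
noncomputable def pathBoundary : V.thick.endOperad.tensorDeRham.Op 0 0 :=
  -V.thick.endOperad.tensorDeRham.d (show (1 : ZMod 2) + 1 = 0 from rfl) (path H₁ H₂)

theorem d_pathBoundary :
    V.thick.endOperad.tensorDeRham.d (zero_add 1) (pathBoundary H₁ H₂) = 0 := by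
  rw [pathBoundary, map_neg,
    (DGOperadData.tensorDeRham_isDGOperad V.thick.endOperad_isDGOperad).d_d, neg_zero]

theorem d_constHom_thickT : V.thick.endOperad.tensorDeRham.d (zero_add 1)
    (V.thick.endOperad.constHom.app V.thickT) = 0 :=
  (V.thick_bvRelations.map _ (constHom_isUnital V.thick)).d_t

/-- The whole segment maps the cone to V and kills V, so its boundary has square zero although the
interpolated operator (1 - z)S₁ + zS₂ need not. Being a boundary over k[z, dz], it is closed,
including its dz-term. -/
theorem pathBoundary_comp_self : V.thick.endOperad.tensorDeRham.comp 0 (Nat.zero_add 0)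
    (zero_add 0) (pathBoundary H₁ H₂) (pathBoundary H₁ H₂) = 0 := by
  rw [pathBoundary, map_neg, map_neg, LinearMap.neg_apply, neg_neg]
  exact DGOperadData.d_comp_d_eq_zero
    (DGOperadData.tensorDeRham_isDGOperad V.thick.endOperad_isDGOperad) d_constHom_thickT
    (thickT_comp_path H₁ H₂) (path_comp_thickT H₁ H₂) _

theorem d_constHom_thickShift : V.thick.endOperad.tensorDeRham.d (zero_add 1)
    (V.thick.endOperad.constHom.app V.thickShift) = 0 := by
  rw [← DGOperadHom.map_d, d_thickShift, map_zero]

theorem constHom_thickShift_comp_self : V.thick.endOperad.tensorDeRham.comp 0 (Nat.zero_add 0)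
    (zero_add 0) (V.thick.endOperad.constHom.app V.thickShift)
    (V.thick.endOperad.constHom.app V.thickShift) = 0 := by
  rw [← DGOperadHom.map_comp, thickShift_comp_self, map_zero]

/-- The composite of the three shears by `-π`, `ι` and `-π`, where `π` is the boundary of the
segment between the two Hodge decompositions and `ι` is `(x, u, w) ↦ (0, x, 0)`. -/
noncomputable def pathShear :
    DGOperadHom V.thick.endOperad.tensorDeRham V.thick.endOperad.tensorDeRham :=
  have L := DGOperadData.tensorDeRham_isDGOperad V.thick.endOperad_isDGOperad
  ((DGOperadData.shear L (d_pathBoundary H₁ H₂) (pathBoundary_comp_self H₁ H₂)).trans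
    (DGOperadData.shear L d_constHom_thickShift constHom_thickShift_comp_self)).trans
    (DGOperadData.shear L (d_pathBoundary H₁ H₂) (pathBoundary_comp_self H₁ H₂))

theorem pathShear_isUnital : (pathShear H₁ H₂).IsUnital :=
  ((DGOperadData.shear_isUnital ..).trans (DGOperadData.shear_isUnital ..)).trans
    (DGOperadData.shear_isUnital ..)

theorem thickBoundary_mem (H : HodgeDecomposition V) (a : ZMod 2) (x : V.thick.carrier)
    (hx : x ∈ V.thick.deg a) : (-V.thickBoundary H.s) x ∈ V.thick.deg (a + 0) := by
  have e : a + 1 + 1 = a + 0 := by rw [add_assoc]; rfl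
  rw [LinearMap.neg_apply]
  refine Submodule.neg_mem _ ⟨?_, Submodule.zero_mem _, Submodule.zero_mem _⟩
  rw [← e]
  exact Submodule.add_mem _ (Submodule.add_mem _ (V.d_mem _ _ (H.s_odd _ _ hx.2.1))
    (H.s_odd _ _ (V.d_mem _ _ hx.2.1))) (H.s_odd _ _ hx.2.2)

/-- With P(u, w) = u - T u + S w, conjugation is by g = (1 - P)(1 + ι)(1 - P). Since P ι = 1 - T and
T P = 0, the first row of g is (T, -P), which is `retract`. The inverse (1 + P)(1 - ι)(1 + P) sends
(v, 0, 0) to (T v, -v, 0), which is `lift`. Operations supported on V see nothing else of g and its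
inverse. -/
theorem value_evalHom_pathShear (H : HodgeDecomposition V) (c : k)
    (hc : (V.thick.endOperad.evalHom c).app (path H₁ H₂) = V.thickHomotopy H.s H.s_odd)
    {n : ℕ} {a : ZMod 2} (y : V.endOperad.Op n a) (z : Fin (n + 1) → V.thick.carrier) :
    V.thick.value z ((V.thick.endOperad.evalHom c).app
        ((pathShear H₁ H₂).app (V.thick.endOperad.constHom.app
          (transfer V.thickPr V.thickIn n a y)))) =
      H.lift (V.value (fun j => H.retract (z j)) y) := by
  have L := DGOperadData.tensorDeRham_isDGOperad V.thick.endOperad_isDGOperad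
  have hev : (V.thick.endOperad.evalHom c).IsUnital := DGOperadData.evalHom_constHom c _
  set φ : Module.End k V.thick.carrier := -V.thickBoundary H.s with hφ
  set ψ : Module.End k V.thick.carrier := V.thickShiftLinear with hψ
  have s₁ : ∀ (x : V.thick.endOperad.tensorDeRham.Op n a) (z : Fin (n + 1) → V.thick.carrier),
      V.thick.value z ((V.thick.endOperad.evalHom c).app ((DGOperadData.shear L
        (d_pathBoundary H₁ H₂) (pathBoundary_comp_self H₁ H₂)).app x)) =
      (1 - φ) (V.thick.value (fun j => (1 + φ) (z j)) ((V.thick.endOperad.evalHom c).app x)) :=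
    value_app_shear L _ _ _ hev φ (thickBoundary_mem H) fun x => by
      rw [pathBoundary, map_neg, DGOperadHom.map_d, hc, map_neg, value_d_thickHomotopy]
      rfl
  have s₂ : ∀ (x : V.thick.endOperad.tensorDeRham.Op n a) (z : Fin (n + 1) → V.thick.carrier),
      V.thick.value z ((V.thick.endOperad.evalHom c).app ((DGOperadData.shear L
        d_constHom_thickShift constHom_thickShift_comp_self).app x)) =
      (1 - ψ) (V.thick.value (fun j => (1 + ψ) (z j)) ((V.thick.endOperad.evalHom c).app x)) :=
    value_app_shear L _ _ _ hev ψ V.thickShiftLinear_mem fun x => by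
      rw [DGOperadData.evalHom_constHom]
      rfl
  have p₁ : ∀ z, ((1 + φ) z).1 = z.1 - (z.2.1 - H.t z.2.1 + H.s z.2.2) := fun z =>
    (congrArg (fun v : V.carrier => z.1 + -v) (congrArg (· + H.s z.2.2)
      (H.homotopy z.2.1))).trans (sub_eq_add_neg _ _).symm
  have p₂ : ∀ z, ((1 + φ) z).2.1 = z.2.1 := fun z =>
    (congrArg (z.2.1 + ·) neg_zero).trans (add_zero z.2.1)
  have p₃ : ∀ z, ((1 + φ) z).2.2 = z.2.2 := fun z =>
    (congrArg (z.2.2 + ·) neg_zero).trans (add_zero z.2.2)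
  have m₁ : ∀ z, ((1 - φ) z).1 = z.1 + (z.2.1 - H.t z.2.1 + H.s z.2.2) := fun z =>
    (congrArg (fun v : V.carrier => z.1 - -v) (congrArg (· + H.s z.2.2)
      (H.homotopy z.2.1))).trans (sub_neg_eq_add _ _)
  have m₂ : ∀ z, ((1 - φ) z).2.1 = z.2.1 := fun z =>
    (congrArg (z.2.1 - ·) neg_zero).trans (sub_zero z.2.1)
  have m₃ : ∀ z, ((1 - φ) z).2.2 = z.2.2 := fun z =>
    (congrArg (z.2.2 - ·) neg_zero).trans (sub_zero z.2.2)
  have q₁ : ∀ z, ((1 + ψ) z).1 = z.1 := fun z => add_zero z.1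
  have q₂ : ∀ z, ((1 + ψ) z).2.1 = z.2.1 + z.1 := fun z => rfl
  have q₃ : ∀ z, ((1 + ψ) z).2.2 = z.2.2 := fun z => add_zero z.2.2
  have r₁ : ∀ z, ((1 - ψ) z).1 = z.1 := fun z => sub_zero z.1
  have r₂ : ∀ z, ((1 - ψ) z).2.1 = z.2.1 - z.1 := fun z => rfl
  have r₃ : ∀ z, ((1 - ψ) z).2.2 = z.2.2 := fun z => sub_zero z.2.2
  have e₁ : ∀ z, V.thickPr ((1 + φ) ((1 + ψ) ((1 + φ) z))) = H.retract z := fun z => by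
    change ((1 + φ) ((1 + ψ) ((1 + φ) z))).1 = _
    rw [p₁, q₁, q₂, q₃, p₁, p₂, p₃, retract_apply]
    simp only [map_sub, map_add, H.t_t, H.t_s]
    abel
  have e₂ : ∀ v, (1 - φ) ((1 - ψ) ((1 - φ) (V.thickIn v))) = H.lift v := fun v => by
    have h₁ : ((1 - φ) (V.thickIn v)).1 = v := by
      rw [m₁]
      change v + (0 - H.t 0 + H.s 0) = v
      simp
    have h₂ : ((1 - φ) (V.thickIn v)).2.1 = 0 := m₂ _
    have h₃ : ((1 - φ) (V.thickIn v)).2.2 = 0 := m₃ _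
    refine V.thick_ext ?_ ?_ ?_
    · rw [m₁, r₁, r₂, r₃, h₁, h₂, h₃, map_zero, map_sub, map_zero]
      change _ = H.t v
      abel
    · rw [m₂, r₂, h₁, h₂]
      exact zero_sub v
    · rw [m₃, r₃, h₃]
      rfl
  -- The last shear of the composite is unfolded first: it acts outermost on the value and first on
  -- the arguments.
  have e₃ := (s₁ _ z).trans (congrArg (DFunLike.coe (1 - φ)) ((s₂ _ _).trans
    (congrArg (DFunLike.coe (1 - ψ)) (s₁ (V.thick.endOperad.constHom.app
      (transfer V.thickPr V.thickIn n a y)) _))))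
  refine e₃.trans ?_
  rw [DGOperadData.evalHom_constHom, value_transfer, e₂]
  simp only [e₁]

theorem evalHom_zero_path : (V.thick.endOperad.evalHom 0).app (path H₁ H₂) =
    V.thickHomotopy H₁.s H₁.s_odd := by
  rw [DGOperadData.evalHom_app, path, DGOperadData.drFst_mk, map_add,
    DGOperadData.polyEval_tmul, DGOperadData.polyEval_tmul]
  simp

theorem evalHom_one_path : (V.thick.endOperad.evalHom 1).app (path H₁ H₂) =
    V.thickHomotopy H₂.s H₂.s_odd := by
  rw [DGOperadData.evalHom_app, path, DGOperadData.drFst_mk, map_add,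
    DGOperadData.polyEval_tmul, DGOperadData.polyEval_tmul]
  simp

end HodgeDecomposition

section Endpoints

variable {k : Type u} [Field k] {O : DGOperad.{u, v} k} {V : DGSpace.{u, w} k}

open DGSpace

/-- A unital family of `BV O`-algebra structures on the thickening, restricted to `V`, has the
expected `bv O`-algebra structure as its value at `c`. -/
theorem HodgeDecomposition.isBvAlgebraOf_evalHom (hO : O.IsAdmissible) (H : HodgeDecomposition V)
    {f : DGOperadHom O.toDGOperadData V.endOperad}
    {h : DGOperadHom (bvResolution O.toDGOperadData) V.endOperad} (hh : H.Determines f h)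
    {Φ : DGOperadHom (bvResolution O.toDGOperadData) V.thick.endOperad.tensorDeRham}
    (hΦ : Φ.app (bvResolution O.toDGOperadData).one = V.thick.endOperad.tensorDeRham.one)
    (hs : Φ.app (bvS O.toDGOperadData) = V.thick.endOperad.constHom.app V.thickS)
    (ht : Φ.app (bvT O.toDGOperadData) = V.thick.endOperad.constHom.app V.thickT) (c : k)
    (hf : ∀ (n : ℕ) (a : ZMod 2) (x : O.Op (n + 1) a) (z : Fin (n + 1 + 1) → V.thick.carrier),
      V.thick.value z ((V.thick.endOperad.evalHom c).app
        (Φ.app ((bvOf O.toDGOperadData).app x))) =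
        H.lift (V.value (fun j => H.retract (z j)) (f.app x))) :
    IsBvAlgebraOf h ((restrictHom (A := V.thickIn) (B := V.thickPr) Φ ht).trans
      (V.endOperad.evalHom c)) where
  isUnital := (restrictHom_isUnital (A := V.thickIn) (B := V.thickPr) Φ ht
    V.thickPr_thickIn).trans (DGOperadData.evalHom_constHom c _)
  app_eq n a x hn := by
    have key := H.transfer_app_eq hO hh (Ψ := Φ.trans (V.thick.endOperad.evalHom c))
      ((congrArg (V.thick.endOperad.evalHom c).app hΦ).trans
        (DGOperadData.evalHom_constHom c _))
      ((congrArg (V.thick.endOperad.evalHom c).app hs).trans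
        (DGOperadData.evalHom_constHom c _))
      ((congrArg (V.thick.endOperad.evalHom c).app ht).trans
        (DGOperadData.evalHom_constHom c _)) hf hn x
    exact (evalHom_drTransfer V.thickIn V.thickPr c _).trans key

end Endpoints

theorem theorem4p7 {k : Type u} [Field k] [CharZero k] (O : DGOperad.{u, v} k)
    (hO : O.IsAdmissible) (V : DGSpace.{u, w} k)
    (f : DGOperadHom O.toDGOperadData V.endOperad) (hf : f.IsUnital)
    (H₁ H₂ : HodgeDecomposition V)
    (h₁ h₂ : DGOperadHom (bvResolution O.toDGOperadData) V.endOperad)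
    (hh₁ : H₁.Determines f h₁) (hh₂ : H₂.Determines f h₂) :
    ∃ g₁ g₂ : DGOperadHom (bvTruncation O.toDGOperadData) V.endOperad,
      IsBvAlgebraOf h₁ g₁ ∧ IsBvAlgebraOf h₂ g₂ ∧ g₁.Homotopic g₂ := by
  obtain ⟨φ, hφ⟩ := hO.exists_unary V.thick.endOperad
  have LQ := DGOperadData.tensorDeRham_isDGOperad V.thick.endOperad_isDGOperad
  set fW := (DGSpace.extendHom hO f V.thickPr V.thickIn V.thickPr_thickIn φ hφ).trans
    V.thick.endOperad.constHom with hfW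
  have hfQ : (fW.trans (H₁.pathShear H₂)).IsUnital :=
    (DGOperadHom.IsUnital.trans (show DGOperadHom.IsUnital (DGSpace.extendHom ..) from hφ)
      (DGSpace.constHom_isUnital _)).trans (H₁.pathShear_isUnital H₂)
  -- s and t are constant in z; only the action of O moves along the family.
  have R := V.thick_bvRelations.map _ (DGSpace.constHom_isUnital V.thick)
  set Φ := bvLift LQ (fW.trans (H₁.pathShear H₂)) hfQ R with hΦ
  have hone : Φ.app (bvResolution O.toDGOperadData).one = V.thick.endOperad.tensorDeRham.one := hfQ
  -- Both algebra structures are obtained as the values at 0 and 1 of the restricted family, so the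
  -- endpoint conditions of the homotopy hold by definition. What has to be proved is that they are
  -- the structures given by the two Hodge decompositions.
  refine ⟨_, _, H₁.isBvAlgebraOf_evalHom hO hh₁ (Φ := Φ) hone rfl rfl 0 fun n a x z => ?_,
    H₂.isBvAlgebraOf_evalHom hO hh₂ (Φ := Φ) hone rfl rfl 1 fun n a x z => ?_,
    DGSpace.restrictHom (A := V.thickIn) (B := V.thickPr) Φ rfl,
    DGSpace.restrictHom_isUnital Φ rfl V.thickPr_thickIn, fun _ _ _ => rfl, fun _ _ _ => rfl⟩
  · exact H₁.value_evalHom_pathShear H₂ H₁ 0 (H₁.evalHom_zero_path H₂) (f.app x) z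
  · exact H₁.value_evalHom_pathShear H₂ H₂ 1 (H₁.evalHom_one_path H₂) (f.app x) z
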